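/- **Theorem (model-free MLE estimation).** There are universal constants $c,C>0$ such that the following holds. *Process.* Let $\mathcal M$ be an episodic MDP with horizon $H\ge 1$, a fixed initial state law, transition kernels $\mathbb P_h(\cdot\mid s,a)$ and reward kernels $\mathbb R_h(\cdot\mid s,a)$ on $[0,1]$, and let $K\ge 2$ be the number of episodes. Augmented states are $s^\dagger_h=(s_h,y_h)$ with $y_h=\sum_{h'<h}r_{h'}$. Let $\Pi^\dagger$ be a class of policies $\pi=(\pi_h)_{h\in[H]}$, each $\pi_h(\cdot\mid s^\dagger)$ being a density with respect to a fixed $\sigma$-finite measure on actions. Let $\mu^\pi_h$ be the law of $(s_h^\dagger,a_h)$ under $\pi$, $Z_h^\pi(s^\dagger,a)$ the return $\sum_{h'\ge h}r_{h'}$ after taking $a$ in $s^\dagger$ at step $h$ and then following $\pi$, and $Z^\pi$ the cumulative reward of an episode under $\pi$. Let $$\mathcal T^\dagger_{h,\pi}f_{h+1}(z\mid s_h^\dagger,a_h)=\int \mathbb R_h(dr\mid s_h,a_h)\,\mathbb P_h(ds'\mid s_h,a_h)\,\pi_{h+1}(da'\mid s',y_h+r)\,f_{h+1}(z-r\mid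 (s',y_h+r),a')\quad (h<H),$$ and let $\mathcal T^\dagger_{H,\pi}f_{H+1}$ be the density of the last reward (the return after step $H$ being $0$). *Function class.* Let $\boldsymbol{\mathcal Z}$ be represented by $\mathcal F=\mathcal F_1\times\dots\times\mathcal F_H$, where $\mathcal F_h$ is a class of conditional Lebesgue densities $f_h(\cdot\mid s^\dagger,a)$ on $\mathbb R$. Assume that a density of $\mathbb R_H$ belongs to $\mathcal F_H$, and that $\mathcal T^\dagger_{h,\pi}f_{h+1}\in\mathcal F_h$ for all $h<H$, $f_{h+1}\in\mathcal F_{h+1}$, $\pi\in\Pi^\dagger$. *Complexities.* Let $0<\delta\le1$ and $0<\epsilon\le 1/K$. Let $\mathcal N_{[\cdot]}(\boldsymbol{\mathcal Z},\epsilon,\|\cdot\|_1)$ and $\mathcal N_{[\cdot]}(\Pi^\dagger,\epsilon,\|\cdot\|_1)$, assumed finite, be the least numbers of $\epsilon$-brackets $[l,u]$ (pairs of measurable nonnegative functions $l\le u$) that cover $\mathcal F$, for the norm $\sup_{h,s^\dagger,a}\|\cdot(\cdot\mid s^\dagger,a)\|_1$, and $\Pi^\dagger$, for the norm $\sup_{h,s^\dagger}\|\cdot(\cdot\mid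 s^\dagger)\|_1$. Put $$\gamma^{\mathrm{MLE}}=\log\mathcal N_{[\cdot]}(\boldsymbol{\mathcal Z},\epsilon,\|\cdot\|_1)+\log\mathcal N_{[\cdot]}(\Pi^\dagger,\epsilon,\|\cdot\|_1)+\log(KH/\delta).$$ For a class $\Phi$ of functions and a family $\mathcal D$ of laws, let $\mathrm d_{\mathrm{DE}}(\Phi,\mathcal D,\varepsilon)$ be the supremum of the lengths $L$ of sequences $\mu_1,\dots,\mu_L\in\mathcal D$ for which there is $\varepsilon'>\varepsilon$ such that for every $t$ some $\phi\in\Phi$ has $|\mathbb E_{\mu_t}\phi|\ge\varepsilon'$ and $\sum_{i<t}(\mathbb E_{\mu_i}\phi)^2\le\varepsilon'^2$. The Bellman eluder dimension is $\mathrm d_{\mathrm{BE}}=\max_{h}\mathrm d_{\mathrm{DE}}(\Phi_h,\mathcal D_h,1/K)$, with $\Phi_h=\{(s^\dagger,a)\mapsto\mathrm{TV}(f_h(s^\dagger,a)\,\|\,\mathcal T^\dagger_{h,\pi}f_{h+1}(s^\dagger,a)):f\in\mathcal F,\pi\in\Pi^\dagger\}$ and $\mathcal D_h=\{\mu_h^\pi:\pi\in\Pi^\dagger\}$.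 *Estimation function V-Est-MLE.* Fix minimal $\epsilon$-bracket covers of $\mathcal F$ and $\Pi^\dagger$ and, for each $f$ and $\pi$, a bracket containing it; let $\underline f,\underline\pi$ be the normalized lower ends of these brackets. For every past episode $i$, every $h$ and every pair $(\underline f,\underline\pi)$, draw $a'\sim\underline\pi_{h+1}(\cdot\mid s^\dagger_{i,h+1})$ and $z_{i,h+1}\sim\underline f_{h+1}(\cdot\mid s_{i,h+1}^\dagger,a')$ (with $z_{i,H+1}=0$), and set $z^{\underline f,\underline\pi}_{i,h}=z_{i,h+1}+r_{i,h}$. After $k$ episodes the confidence set $\widehat{\mathcal Z}_{k+1,\pi}$ of $\pi\in\Pi^\dagger$ consists of all $f\in\mathcal F$ such that for every $h\in[H]$ $$\sum_{i=1}^{k}\log f_h(z_{i,h}^{\underline f,\underline\pi}\mid s_{i,h}^\dagger,a_{i,h})\ \ge\ \sup_{f'\in\mathcal F}\sum_{i=1}^{k}\log f'_h(z_{i,h}^{\underline f,\underline\pi}\mid s_{i,h}^\dagger,a_{i,h})-c\,\gamma^{\mathrm{MLE}}.$$ *Algorithm.* In episode $k$ the agent chooses $(\pi^k,\widehat Z^k)$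 maximizing $\rho(Z)$ over all $\pi\in\Pi^\dagger$, $Z\in\widehat{\mathcal Z}_{k,\pi}$, where $\rho$ is any real functional of the law of the cumulative reward (the law predicted by $f$ under $\pi$ is that of a draw from $f_1(\cdot\mid s_1^\dagger,a_1)$ with $(s_1^\dagger,a_1)\sim\mu_1^\pi$). It then executes $\pi^k$. *Conclusion.* 1. (Concentration) With probability at least $1-\delta$: for all $\pi\in\Pi^\dagger$ and all confidence sets built from at most $K$ episodes, $Z^\pi\in\widehat{\mathcal Z}_{k,\pi}$, i.e. some $f$ in the confidence set is such that $f_h(\cdot\mid s^\dagger,a)$ is a density of $Z_h^\pi(s^\dagger,a)$ for all $h,s^\dagger,a$. 2. (General elliptical potential) If $\mathrm d_{\mathrm{BE}}<\infty$, then with probability at least $1-\delta$ $$\sum_{k=1}^K\big\|F_{\widehat Z^k}-F_{Z^{\pi^k}}\big\|_\infty\le \zeta^{\mathrm{MLE}}:=C\,H\sqrt{\max(\mathrm d_{\mathrm{BE}},1)\,\gamma^{\mathrm{MLE}}K}=\widetilde{\mathcal O}\big(\mathrm{poly}(H)\sqrt{\mathrm d_{\mathrm{BE}}\gamma^{\mathrm{MLE}}K}\big).$$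 -/

import Mathlib

open MeasureTheory ProbabilityTheory
open scoped ENNReal

namespace RSDisRL

noncomputable section

/-! ## Tuples of conditional densities and their bracketing numbers

Steps are numbered `0, …, H - 1`.  A tuple `g : ℕ → X → Y → ℝ≥0∞` stands for `(g_h)_{h < H}`;
its entries at indices `h ≥ H` are never used. -/

/-- `g x ·` is a probability density with respect to `ν` for every `x`, jointly measurable. -/
def IsCondDensity {X Y : Type*} [MeasurableSpace X] [MeasurableSpace Y] (ν : Measure Y)
    (g : X → Y → ℝ≥0∞) : Prop :=
  Measurable (Function.uncurry g) ∧ ∀ x, ∫⁻ y, g x y ∂ν = 1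

/-- A cover of the class `G` of tuples by `n` brackets of width `ε`, for the norm
`sup_{h < H} sup_x ‖·(x)‖_{L¹(ν)}`, with a choice, for each member of `G`, of a bracket that
contains it.  The end points of a bracket need not belong to `G`. -/
structure BracketCover {X Y : Type*} [MeasurableSpace X] [MeasurableSpace Y] (H : ℕ)
    (ν : Measure Y) (G : Set (ℕ → X → Y → ℝ≥0∞)) (ε : ℝ) (n : ℕ) where
  lower : Fin n → ℕ → X → Y → ℝ≥0∞
  upper : Fin n → ℕ → X → Y → ℝ≥0∞
  measurable_lower : ∀ j, ∀ h < H, Measurable (Function.uncurry (lower j h))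
  measurable_upper : ∀ j, ∀ h < H, Measurable (Function.uncurry (upper j h))
  lower_le_upper : ∀ j, ∀ h < H, ∀ x y, lower j h x y ≤ upper j h x y
  width_le : ∀ j, ∀ h < H, ∀ x, ∫⁻ y, (upper j h x y - lower j h x y) ∂ν ≤ ENNReal.ofReal ε
  index : G → Fin n
  lower_le : ∀ g : G, ∀ h < H, ∀ x y, lower (index g) h x y ≤ g.1 h x y
  le_upper : ∀ g : G, ∀ h < H, ∀ x y, g.1 h x y ≤ upper (index g) h x y

/-- The bracketing number: the least number of `ε`-brackets that cover `G`. -/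
def bracketingNumber {X Y : Type*} [MeasurableSpace X] [MeasurableSpace Y] (H : ℕ)
    (ν : Measure Y) (G : Set (ℕ → X → Y → ℝ≥0∞)) (ε : ℝ) : ℕ :=
  sInf {n | Nonempty (BracketCover H ν G ε n)}

/-- The normalized lower end of the `j`-th bracket. -/
def BracketCover.normLower {X Y : Type*} [MeasurableSpace X] [MeasurableSpace Y] {H : ℕ}
    {ν : Measure Y} {G : Set (ℕ → X → Y → ℝ≥0∞)} {ε : ℝ} {n : ℕ}
    (B : BracketCover H ν G ε n) (j : Fin n) (h : ℕ) (x : X) (y : Y) : ℝ≥0∞ :=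
  B.lower j h x y / ∫⁻ y', B.lower j h x y' ∂ν

/-- Total variation distance `½ ∫ |p - q|` of two Lebesgue densities on the line (with truncated
subtraction, `|p - q| = (p - q) + (q - p)`). -/
def tvDist (p q : ℝ → ℝ≥0∞) : ℝ :=
  ((∫⁻ z, ((p z - q z) + (q z - p z))) / 2).toReal

/-- Supremum distance of the cumulative distribution functions of two laws on the line. -/
def cdfDist (μ ν : Measure ℝ) : ℝ :=
  ⨆ x : ℝ, |μ.real (Set.Iic x) - ν.real (Set.Iic x)|

/-- The distributional eluder dimension: the supremum of the lengths `L` of sequences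
`μ_1, …, μ_L` in `D` such that, for some `ε' > ε`, each `μ_t` is `ε'`-independent of its
predecessors. -/
def distEluderDim {X : Type*} [MeasurableSpace X] (Φ : Set (X → ℝ)) (D : Set (Measure X))
    (ε : ℝ) : ℕ∞ :=
  ⨆ (L : ℕ) (_ : ∃ ε' > ε, ∃ μ : Fin L → Measure X, (∀ t, μ t ∈ D) ∧
    ∀ t, ∃ φ ∈ Φ, ε' ≤ |∫ x, φ x ∂(μ t)| ∧
      ∑ i ∈ Finset.univ.filter (fun i => i < t), (∫ x, φ x ∂(μ i)) ^ 2 ≤ ε' ^ 2), (L : ℕ∞)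

/-! ## The decision process -/

/-- An episodic Markov decision process: law of the initial state, transition kernels, and reward
kernels with values in `[0, 1]`. -/
structure MDP (S A : Type*) [MeasurableSpace S] [MeasurableSpace A] where
  init : Measure S
  trans : ℕ → Kernel (S × A) S
  reward : ℕ → Kernel (S × A) ℝ
  init_prob : IsProbabilityMeasure init
  trans_markov : ∀ h, IsMarkovKernel (trans h)
  reward_markov : ∀ h, IsMarkovKernel (reward h)
  reward_mem : ∀ h x, reward h x (Set.Icc 0 1)ᶜ = 0

/-- Augmented states `(s, y)`, where `y` is the reward accumulated so far. -/
abbrev AugState (S : Type*) := S × ℝ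

/-- A Markov policy of the augmented process: `π h (s, y)` is the density of the action at step `h`
with respect to a reference measure on actions. -/
abbrev Policy (S A : Type*) := ℕ → AugState S → A → ℝ≥0∞

/-- A tuple of conditional return densities: `f h ((s, y), a)` is a Lebesgue density on `ℝ`. -/
abbrev Returns (S A : Type*) := ℕ → AugState S × A → ℝ → ℝ≥0∞

/-- A trajectory: augmented state, action and reward at each of `n` consecutive steps. -/
abbrev Traj (S A : Type*) (n : ℕ) := Fin n → AugState S × A × ℝ

/-- The product class `𝓕_0 × ⋯ × 𝓕_{H-1}`. -/
def prodClass {S A : Type*} (H : ℕ) (F : ℕ → Set (AugState S × A → ℝ → ℝ≥0∞)) :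
    Set (Returns S A) :=
  {f | ∀ h < H, f h ∈ F h}

namespace MDP

variable {S A : Type*} [MeasurableSpace S] [MeasurableSpace A]

/-- The law of the `n` steps that start at step `h` in the augmented state `x`, under `π`. -/
def rollout (M : MDP S A) (α : Measure A) (π : Policy S A) :
    (n : ℕ) → (h : ℕ) → AugState S → Measure (Traj S A n)
  | 0, _, _ => Measure.dirac Fin.elim0
  | n + 1, h, x =>
      (α.withDensity (π h x)).bind fun a =>
        (M.reward h (x.1, a)).bind fun r =>
          (M.trans h (x.1, a)).bind fun s' =>
            (M.rollout α π n (h + 1) (s', x.2 + r)).map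
              (Fin.cons (α := fun _ => AugState S × A × ℝ) (x, a, r))

/-- The law of the trajectory of one episode of horizon `H` under `π`. -/
def trajLaw (M : MDP S A) (α : Measure A) (H : ℕ) (π : Policy S A) : Measure (Traj S A H) :=
  M.init.bind fun s => M.rollout α π H 0 (s, 0)

/-- The visitation measure: the law of the augmented state and the action at step `h`. -/
def visit (M : MDP S A) (α : Measure A) (H : ℕ) (π : Policy S A) (h : Fin H) :
    Measure (AugState S × A) :=
  (M.trajLaw α H π).map fun τ => ((τ h).1, (τ h).2.1)

/-- The law of the reward-to-go `∑_{h' = h}^{H-1} r_{h'}` after action `a` in the augmented state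
`x` at step `h`, when `π` is followed afterwards. -/
def returnLaw (M : MDP S A) (α : Measure A) (H : ℕ) (π : Policy S A) (h : ℕ)
    (x : AugState S) (a : A) : Measure ℝ :=
  (M.reward h (x.1, a)).bind fun r =>
    (M.trans h (x.1, a)).bind fun s' =>
      (M.rollout α π (H - h - 1) (h + 1) (s', x.2 + r)).map fun τ => r + ∑ j, (τ j).2.2

/-- The law of the cumulative reward of one episode under `π`. -/
def totalLaw (M : MDP S A) (α : Measure A) (H : ℕ) (π : Policy S A) : Measure ℝ :=
  (M.trajLaw α H π).map fun τ => ∑ h, (τ h).2.2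

/-- The law of the cumulative reward predicted by the candidate `f` under `π`: initial state from
the process, first action from `π`, return from `f` at the first step. -/
def predLaw (M : MDP S A) (α : Measure A) (π : Policy S A) (f : Returns S A) : Measure ℝ :=
  M.init.bind fun s =>
    (α.withDensity (π 0 (s, 0))).bind fun a =>
      volume.withDensity (f 0 ((s, 0), a))

/-- The augmented distributional Bellman operator at step `h` on densities `g` for step `h + 1`. -/
def bellman (M : MDP S A) (α : Measure A) (π : Policy S A) (h : ℕ)
    (g : AugState S × A → ℝ → ℝ≥0∞) : AugState S × A → ℝ → ℝ≥0∞ :=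
  fun xa z =>
    ∫⁻ r, ∫⁻ s', ∫⁻ a', π (h + 1) (s', xa.1.2 + r) a' * g ((s', xa.1.2 + r), a') (z - r)
      ∂α ∂(M.trans h (xa.1.1, xa.2)) ∂(M.reward h (xa.1.1, xa.2))

/-- The Bellman target of the candidate `f` at step `h`.  After the last step the return is `0`, so
the target there is the density `fLast` of the last reward. -/
def target (M : MDP S A) (α : Measure A) (H : ℕ) (fLast : AugState S × A → ℝ → ℝ≥0∞)
    (π : Policy S A) (f : Returns S A) (h : ℕ) : AugState S × A → ℝ → ℝ≥0∞ :=
  if h + 1 < H then M.bellman α π h (f (h + 1)) else fLast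

/-- Bellman errors at step `h`, measured in total variation, as functions of `(s, y), a`. -/
def bellmanErrors (M : MDP S A) (α : Measure A) (H : ℕ)
    (fLast : AugState S × A → ℝ → ℝ≥0∞) (F : ℕ → Set (AugState S × A → ℝ → ℝ≥0∞))
    (Pol : Set (Policy S A)) (h : ℕ) : Set (AugState S × A → ℝ) :=
  {φ | ∃ f ∈ prodClass H F, ∃ π ∈ Pol,
    φ = fun xa => tvDist (f h xa) (M.target α H fLast π f h xa)}

/-- The Bellman eluder dimension at scale `ε`. -/
def bellmanEluderDim (M : MDP S A) (α : Measure A) (H : ℕ)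
    (fLast : AugState S × A → ℝ → ℝ≥0∞) (F : ℕ → Set (AugState S × A → ℝ → ℝ≥0∞))
    (Pol : Set (Policy S A)) (ε : ℝ) : ℕ∞ :=
  ⨆ h : Fin H, distEluderDim (M.bellmanErrors α H fLast F Pol h)
    {μ | ∃ π ∈ Pol, μ = M.visit α H π h} ε

end MDP

/-! ## The estimation function and the algorithm that calls it -/

section Algorithm

variable {S A : Type*} [MeasurableSpace S] [MeasurableSpace A] {α : Measure A} {H : ℕ}
  {F : ℕ → Set (AugState S × A → ℝ → ℝ≥0∞)} {Pol : Set (Policy S A)} {ε : ℝ} {nF nP : ℕ}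

/-- The law of the auxiliary draw for step `h` and the brackets `p`, `q`, given the trajectory `τ`
of an episode: an action from the normalized lower bracket policy at the next augmented state, then
a return from the normalized lower bracket density.  After the last step the draw is `0`. -/
def drawLaw (BF : BracketCover H volume (prodClass H F) ε nF) (BP : BracketCover H α Pol ε nP)
    (h : Fin H) (p : Fin nF) (q : Fin nP) (τ : Traj S A H) : Measure ℝ :=
  if hh : (h : ℕ) + 1 < H then
    (α.withDensity (BP.normLower q (h + 1) (τ ⟨h + 1, hh⟩).1)).bind fun a' =>
      volume.withDensity (BF.normLower p (h + 1) ((τ ⟨h + 1, hh⟩).1, a'))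
  else Measure.dirac 0

/-- The log-likelihood of the candidate `f` at step `h` on the data of the episodes `i < k`, with
the one-step-back samples `draw + reward`; `log 0 = -∞`. -/
def logLik (τ : ℕ → Traj S A H) (w : ℕ → Fin H → Fin nF → Fin nP → ℝ) (k : ℕ) (h : Fin H)
    (p : Fin nF) (q : Fin nP) (f : Returns S A) : EReal :=
  ∑ i ∈ Finset.range k,
    ENNReal.log (f h ((τ i h).1, (τ i h).2.1) (w i h p q + (τ i h).2.2))

/-- The estimation function: the members of the class whose log-likelihood, at each step and on the
samples drawn from their own bracket and the bracket of `π`, is within `β` of the maximum over the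
class. -/
def vEstMLE (BF : BracketCover H volume (prodClass H F) ε nF) (BP : BracketCover H α Pol ε nP)
    (β : ℝ) (τ : ℕ → Traj S A H) (w : ℕ → Fin H → Fin nF → Fin nP → ℝ) (k : ℕ) (π : Pol) :
    Set (prodClass H F) :=
  {f | ∀ h : Fin H, ∀ f' ∈ prodClass H F,
    logLik τ w k h (BF.index f) (BP.index π) f' - (β : EReal) ≤
      logLik τ w k h (BF.index f) (BP.index π) f}

/-- A run of `K` episodes of the model-free meta-algorithm with this estimation function and radius
`β`, on a probability space with measure `P`.  Episodes are numbered `0, …, K - 1`. -/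
structure Run (M : MDP S A) (K : ℕ) (BF : BracketCover H volume (prodClass H F) ε nF)
    (BP : BracketCover H α Pol ε nP) (ρ : Measure ℝ → ℝ) (β : ℝ)
    {Ω : Type*} [mΩ : MeasurableSpace Ω] (P : Measure Ω) where
  /-- The information available before each episode. -/
  info : Filtration ℕ mΩ
  /-- The policy that is executed. -/
  pol : ℕ → Ω → Pol
  /-- The candidate that is chosen together with the policy. -/
  est : ℕ → Ω → prodClass H F
  /-- The observed trajectory. -/
  traj : ℕ → Ω → Traj S A H
  /-- The auxiliary draws, for each step and each pair of brackets. -/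
  draw : ℕ → Fin H → Fin nF → Fin nP → Ω → ℝ
  measurable_traj : ∀ k < K, Measurable[info (k + 1)] (traj k)
  measurable_draw : ∀ k < K, ∀ h p q, Measurable[info (k + 1)] (draw k h p q)
  measurable_law : ∀ k < K, ∀ B : Set (Traj S A H), MeasurableSet B →
    Measurable[info k] fun ω => M.trajLaw α H (pol k ω) B
  /-- Given the past, the trajectory has the law induced by the chosen policy; given the past and
  the trajectory, each auxiliary draw has the law `drawLaw`. -/
  cond_law : ∀ k < K, ∀ h p q, ∀ E : Set Ω, MeasurableSet[info k] E →
    ∀ B : Set (Traj S A H × ℝ), MeasurableSet B →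
      P (E ∩ {ω | (traj k ω, draw k h p q ω) ∈ B}) =
        ∫⁻ ω in E, ((M.trajLaw α H (pol k ω)).bind fun τ =>
          (drawLaw BF BP h p q τ).map (Prod.mk τ)) B ∂P
  /-- Optimistic planning: policy and candidate jointly maximize the risk functional over all pairs
  that the confidence sets admit (and are arbitrary if there is no such pair). -/
  plan : ∀ k < K, ∀ ω,
    (∃ π : Pol, (vEstMLE BF BP β (fun i => traj i ω) (fun i h p q => draw i h p q ω) k π).Nonempty) →
      est k ω ∈ vEstMLE BF BP β (fun i => traj i ω) (fun i h p q => draw i h p q ω) k (pol k ω) ∧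
      ∀ π : Pol,
        ∀ f ∈ vEstMLE BF BP β (fun i => traj i ω) (fun i h p q => draw i h p q ω) k π,
          ρ (M.predLaw α π f) ≤ ρ (M.predLaw α (pol k ω) (est k ω))

variable {M : MDP S A} {K : ℕ} {BF : BracketCover H volume (prodClass H F) ε nF}
  {BP : BracketCover H α Pol ε nP} {ρ : Measure ℝ → ℝ} {β : ℝ}
  {Ω : Type*} [MeasurableSpace Ω] {P : Measure Ω}

/-- The confidence set for the policy `π` built from the first `k` episodes of a run. -/
def Run.confSet (run : Run M K BF BP ρ β P) (k : ℕ) (ω : Ω) (π : Pol) : Set (prodClass H F) :=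
  vEstMLE BF BP β (fun i => run.traj i ω) (fun i h p q => run.draw i h p q ω) k π

/-- Concentration: with probability at least `1 - δ`, for all `π` and after any number `k ≤ K` of
episodes, the confidence set of `π` contains (densities of) the true return laws of `π`.  The
exceptional event has outer measure at most `δ`. -/
def Run.Concentration (run : Run M K BF BP ρ β P) (δ : ℝ) : Prop :=
  P {ω | ¬ ∀ k ≤ K, ∀ π : Pol, ∃ f ∈ run.confSet k ω π,
    ∀ h < H, ∀ x a, volume.withDensity (f.1 h (x, a)) = M.returnLaw α H π h x a}
    ≤ ENNReal.ofReal δ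

/-- General elliptical potential: with probability at least `1 - δ`, the distances between predicted
and true laws of the cumulative reward under the executed policies sum up to at most `ζ`. -/
def Run.EllipticalPotential (run : Run M K BF BP ρ β P) (δ ζ : ℝ) : Prop :=
  P {ω | ¬ ∑ k ∈ Finset.range K,
    cdfDist (M.predLaw α (run.pol k ω) (run.est k ω)) (M.totalLaw α H (run.pol k ω)) ≤ ζ}
    ≤ ENNReal.ofReal δ

end Algorithm

/-- `γ = log N(𝓕, ε) + log N(Π, ε) + log (K H / δ)` with bracketing numbers. -/
def gammaMLE {S A : Type*} [MeasurableSpace S] [MeasurableSpace A] (α : Measure A) (H K : ℕ)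
    (F : ℕ → Set (AugState S × A → ℝ → ℝ≥0∞)) (Pol : Set (Policy S A)) (ε δ : ℝ) : ℝ :=
  Real.log (bracketingNumber H volume (prodClass H F) ε) +
    Real.log (bracketingNumber H α Pol ε) + Real.log (K * H / δ)

end

end RSDisRL

open MeasureTheory ProbabilityTheory RSDisRL
open scoped ENNReal

/-! The proof joins maximum likelihood theory to an eluder argument. For a fixed step and a fixed
pair of brackets, the one-step-back samples have an explicit conditional density g, the Bellman
target of the normalized lower ends (`lintegral_sample`, `Run.setLIntegral_sample`). This g is
deterministic, so martingale bounds hold for each of finitely many tuples of brackets, and a union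
bound covers every data-dependent candidate and policy. Moreover g is at most e^{4ε} times the
target of f under π, for all f and π in the two brackets (`WellSpecified.sample_le_target`). As ε ≤
1/K, this costs only a constant factor of likelihood over K episodes.

Concentration: if u is an upper bracket end, u/g has conditional mean at most 1 + ε ≤ e^ε, so the
products of e^{-ε} u/g form a supermartingale and are unlikely to be large (`Run.measure_ratio_le`).
By completeness there is f in the class that equals its own Bellman target under π. It dominates g
up to e^{4ε}, hence no competitor beats it by more than the radius (`Run.exists_mem_confSet`), and
having no Bellman error it gives the true return laws (`MDP.withDensity_eq_returnLaw`).

Small errors on past data: the same argument for √(u/g), whose conditional mean is bounded by a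
Hellinger affinity, limits how much affinity can be lost when the likelihood of u is not much below
that of g (`Run.measure_sqrt_ratio_le`, `sum_one_sub_le`). A member f of a confidence set is in that
position, because f with one entry replaced by its Bellman target is an admissible competitor. The
loss of affinity controls the square of total variation (`lintegral_sqrt_mul_add_le`), so the
squared Bellman errors of f under the past visitation measures sum to O(γ)
(`Run.sum_sq_bellmanErr_le`).

Summation: the simulation lemma bounds the distance of the distribution functions by the sum over
steps of the expected Bellman errors under the executed policy (`MDP.cdfDist_le`). The eluder
dimension converts smallness on past measures into a bound O(√(dγK)) for the sum of current errors
at each step (`sum_le_of_distEluderDim`), and adding the H steps gives the factor H. -/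

namespace RSDisRL

/-! ## The eluder argument -/

/-- A greedy assignment to `m` bins: if the squares in each row of `e` sum to less than `m t²`, then
every index can be put into a bin whose earlier members contribute at most `t²` to its row. -/
lemma exists_binning (e : ℕ → ℕ → ℝ) (S : ℕ → Prop) [DecidablePred S] (B t : ℝ) (m : ℕ)
    (hm : B < m * t ^ 2) (hB0 : 0 ≤ B) (K : ℕ)
    (hB : ∀ k < K, ∑ i ∈ Finset.range k, (e k i) ^ 2 ≤ B) :
    ∃ c : ℕ → Fin m, ∀ k < K,
      ∑ i ∈ (Finset.range k).filter (fun i => S i ∧ c i = c k), (e k i) ^ 2 ≤ t ^ 2 := by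
  have hm0 : 0 < m := by
    rcases Nat.eq_zero_or_pos m with h | h
    · subst h; simp at hm; linarith
    · exact h
  have key : ∀ n ≤ K, ∃ c : ℕ → Fin m, ∀ k < n,
      ∑ i ∈ (Finset.range k).filter (fun i => S i ∧ c i = c k), (e k i) ^ 2 ≤ t ^ 2 := by
    intro n
    induction n with
    | zero => intro _; exact ⟨fun _ => ⟨0, hm0⟩, fun k hk => absurd hk (Nat.not_lt_zero _)⟩
    | succ n ih =>
      intro hn
      obtain ⟨c, hc⟩ := ih (by omega)
      -- Pigeonhole: if every bin were over t², the bins together would carry at least m t² > B.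
      have hb : ∃ b : Fin m,
          ∑ i ∈ (Finset.range n).filter (fun i => S i ∧ c i = b), (e n i) ^ 2 ≤ t ^ 2 := by
        by_contra! hcon
        have h1 : (m : ℝ) * t ^ 2 ≤
            ∑ b : Fin m, ∑ i ∈ (Finset.range n).filter (fun i => S i ∧ c i = b), (e n i) ^ 2 := by
          calc (m : ℝ) * t ^ 2 = ∑ _b : Fin m, t ^ 2 := by simp
            _ ≤ _ := Finset.sum_le_sum fun b _ => (hcon b).le
        have h2 : ∑ b : Fin m, ∑ i ∈ (Finset.range n).filter (fun i => S i ∧ c i = b), (e n i) ^ 2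
            = ∑ i ∈ (Finset.range n).filter S, (e n i) ^ 2 := by
          rw [← Finset.sum_fiberwise (s := (Finset.range n).filter S) (g := c)]
          refine Finset.sum_congr rfl fun b _ => ?_
          rw [Finset.filter_filter]
        have h3 : ∑ i ∈ (Finset.range n).filter S, (e n i) ^ 2 ≤ B :=
          (Finset.sum_le_sum_of_subset_of_nonneg (Finset.filter_subset _ _)
            fun _ _ _ => sq_nonneg _).trans (hB n (by omega))
        linarith
      obtain ⟨b, hb⟩ := hb
      refine ⟨Function.update c n b, fun k hk => ?_⟩
      have hupd : ∀ i < n, Function.update c n b i = c i := fun i hi =>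
        Function.update_of_ne hi.ne _ _
      rcases Nat.lt_succ_iff_lt_or_eq.1 hk with hk' | rfl
      · rw [hupd k hk']
        convert hc k hk' using 2
        refine Finset.filter_congr fun i hi => ?_
        rw [hupd i ((Finset.mem_range.1 hi).trans hk')]
      · rw [Function.update_self]
        convert hb using 2
        refine Finset.filter_congr fun i hi => ?_
        rw [hupd i (Finset.mem_range.1 hi)]
  exact key K le_rfl

/-- Distribute the large indices greedily over ⌊B/t²⌋ + 1 bins. Listed in increasing order, each bin
is an independent sequence at scale t in the sense of the eluder dimension, so it has at most d
members. -/
lemma card_le_of_distEluderDim {X : Type*} [MeasurableSpace X] {Φ : Set (X → ℝ)}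
    {D : Set (Measure X)} {ε : ℝ} {d K : ℕ} (hd : distEluderDim Φ D ε ≤ d)
    (μ : ℕ → Measure X) (φ : ℕ → X → ℝ) (hμ : ∀ k < K, μ k ∈ D) (hφ : ∀ k < K, φ k ∈ Φ)
    {B : ℝ} (hB0 : 0 ≤ B)
    (hB : ∀ k < K, ∑ i ∈ Finset.range k, (∫ x, φ k x ∂(μ i)) ^ 2 ≤ B)
    {t : ℝ} (ht : ε < t) (ht0 : 0 < t) :
    (((Finset.range K).filter (fun k => t ≤ |∫ x, φ k x ∂(μ k)|)).card : ℝ) ≤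
      (B / t ^ 2 + 1) * d := by
  classical
  set S : ℕ → Prop := fun k => t ≤ |∫ x, φ k x ∂(μ k)| with hS
  set m : ℕ := ⌊B / t ^ 2⌋₊ + 1 with hm
  have ht2 : 0 < t ^ 2 := by positivity
  have hmB : B < m * t ^ 2 := by
    rw [← div_lt_iff₀ ht2, hm]
    push_cast
    exact Nat.lt_floor_add_one _
  obtain ⟨c, hc⟩ := exists_binning (fun k i => ∫ x, φ k x ∂(μ i)) S B t m hmB hB0 K hB
  have hbin : ∀ b : Fin m, (((Finset.range K).filter S).filter (fun k => c k = b)).card ≤ d := by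
    intro b
    set T := ((Finset.range K).filter S).filter (fun k => c k = b) with hT
    have hmem : ∀ k ∈ T, k < K ∧ S k ∧ c k = b := by
      intro k hk
      simp only [hT, Finset.mem_filter, Finset.mem_range] at hk
      exact ⟨hk.1.1, hk.1.2, hk.2⟩
    let g := T.orderEmbOfFin rfl
    have hg : ∀ i, g i ∈ T := fun i => Finset.orderEmbOfFin_mem T rfl i
    have : ((T.card : ℕ) : ℕ∞) ≤ d := by
      refine le_trans ?_ hd
      refine le_iSup₂_of_le (f := fun (L : ℕ) (_ : ∃ ε' > ε, ∃ μ : Fin L → Measure X,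
        (∀ t, μ t ∈ D) ∧ ∀ t, ∃ φ ∈ Φ, ε' ≤ |∫ x, φ x ∂(μ t)| ∧
          ∑ i ∈ Finset.univ.filter (fun i => i < t), (∫ x, φ x ∂(μ i)) ^ 2 ≤ ε' ^ 2) => (L : ℕ∞))
        T.card ⟨t, ht, fun i => μ (g i), fun i => hμ _ (hmem _ (hg i)).1, fun j =>
          ⟨φ (g j), hφ _ (hmem _ (hg j)).1, (hmem _ (hg j)).2.1, ?_⟩⟩ le_rfl
      -- The predecessors of `g j` in its bin are among the indices that the binning bound sums
      -- over.
      refine le_trans ?_ (hc (g j) (hmem _ (hg j)).1)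
      refine (Finset.sum_map (Finset.univ.filter (fun i => i < j)) g.toEmbedding
        (fun i => (∫ x, φ (g j) x ∂(μ i)) ^ 2)).symm.le.trans ?_
      refine Finset.sum_le_sum_of_subset_of_nonneg ?_ fun _ _ _ => sq_nonneg _
      intro i hi
      simp only [Finset.mem_map, Finset.mem_filter, Finset.mem_univ, true_and] at hi
      obtain ⟨i', hi', rfl⟩ := hi
      simp only [Finset.mem_filter, Finset.mem_range]
      exact ⟨g.strictMono hi', (hmem _ (hg i')).2.1,
        (hmem _ (hg i')).2.2.trans (hmem _ (hg j)).2.2.symm⟩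
    exact_mod_cast this
  have hcard : ((Finset.range K).filter S).card ≤ m * d := by
    rw [Finset.card_eq_sum_card_fiberwise (f := c) (t := Finset.univ) (fun _ _ => Finset.mem_univ _)]
    calc _ ≤ ∑ _b : Fin m, d := Finset.sum_le_sum fun b _ => hbin b
      _ = m * d := by simp
  have hm' : (m : ℝ) ≤ B / t ^ 2 + 1 := by
    rw [hm]; push_cast
    linarith [Nat.floor_le (show 0 ≤ B / t ^ 2 by positivity)]
  calc (((Finset.range K).filter S).card : ℝ) ≤ ((m * d : ℕ) : ℝ) := by exact_mod_cast hcard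
    _ = m * d := by push_cast; ring
    _ ≤ _ := by gcongr

/-- Summation from the counting bound `#{k : e k ≥ t} ≤ (B / t² + 1) d`. -/
lemma sum_le_of_card_le (e : ℕ → ℝ) (he1 : ∀ k, e k ≤ 1) {ω B : ℝ} (hω : 0 ≤ ω) (hB0 : 0 ≤ B)
    (d : ℕ) (n : ℕ) : ∀ s : Finset ℕ, s.card = n → (∀ k ∈ s, ω < e k) →
    (∀ t, ω < t → ((s.filter (fun k => t ≤ e k)).card : ℝ) ≤ (B / t ^ 2 + 1) * d) →
    ∑ k ∈ s, e k ≤ min (n : ℝ) d + 2 * Real.sqrt (B * d * (n - d : ℕ)) := by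
  induction n with
  | zero =>
    intro s hs _ _
    rw [Finset.card_eq_zero.1 hs]
    simp
  | succ n ih =>
    intro s hs hse hcard
    have hne : s.Nonempty := Finset.card_pos.1 (by omega)
    -- Remove the smallest value t. All of `s` lies above t, so the counting bound at t controls the
    -- size of `s` and thereby t: (n + 1 - d) t² ≤ B d. The terms beyond the d-th thus sum like
    -- √(Bd/j), that is, to at most 2√(Bd(n - d)).
    obtain ⟨k₀, hk₀, hmin⟩ := Finset.exists_min_image s e hne
    set t := e k₀ with ht
    have htω : ω < t := hse k₀ hk₀
    have ht0 : 0 < t := hω.trans_lt htω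
    have hIH := ih (s.erase k₀) (by rw [Finset.card_erase_of_mem hk₀, hs]; rfl)
      (fun k hk => hse k (Finset.mem_of_mem_erase hk))
      (fun t' ht' => le_trans (by
        exact_mod_cast Finset.card_le_card (Finset.filter_subset_filter _ (Finset.erase_subset _ _)))
        (hcard t' ht'))
    rw [← Finset.add_sum_erase s e hk₀]
    have hall : s.filter (fun k => t ≤ e k) = s := Finset.filter_true_of_mem fun k hk => hmin k hk
    have hc := hcard t htω
    rw [hall, hs] at hc
    rcases le_or_gt (n + 1) d with hnd | hnd
    · have h1 : n + 1 - d = 0 := by omega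
      have h2 : n - d = 0 := by omega
      rw [h1]; rw [h2] at hIH
      have h3 : min (n : ℝ) d = n := min_eq_left (by exact_mod_cast (by omega : n ≤ d))
      have h4 : min ((n + 1 : ℕ) : ℝ) d = n + 1 := by
        rw [min_eq_left (by exact_mod_cast hnd)]; push_cast; ring
      rw [h4]; rw [h3] at hIH
      have := he1 k₀
      simp only [Nat.cast_zero, mul_zero, Real.sqrt_zero, add_zero] at hIH ⊢
      linarith
    · obtain ⟨m, hm⟩ : ∃ m, n = d + m := ⟨n - d, by omega⟩
      have h1 : n + 1 - d = m + 1 := by omega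
      have h2 : n - d = m := by omega
      have h3 : min (n : ℝ) d = d := min_eq_right (by exact_mod_cast (by omega : d ≤ n))
      have h4 : min ((n + 1 : ℕ) : ℝ) d = d := min_eq_right (by exact_mod_cast hnd.le)
      rw [h1, h4]; rw [h2, h3] at hIH
      set a : ℝ := B * d with ha
      have ha0 : 0 ≤ a := by positivity
      have hmt : ((m : ℝ) + 1) * t ^ 2 ≤ a := by
        have : ((n + 1 : ℕ) : ℝ) = d + m + 1 := by rw [hm]; push_cast; ring
        rw [this] at hc
        have h5 : (m : ℝ) + 1 ≤ B * d / t ^ 2 := by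
          have : (B / t ^ 2 + 1) * (d : ℝ) = B * d / t ^ 2 + d := by ring
          linarith
        rwa [le_div_iff₀ (by positivity)] at h5
      push_cast
      set x := Real.sqrt (a * (m + 1)) with hx
      have hx2 : x ^ 2 = a * (m + 1) := Real.sq_sqrt (by positivity)
      have hx0 : 0 ≤ x := Real.sqrt_nonneg _
      have hm0 : (0 : ℝ) ≤ m := Nat.cast_nonneg _
      have hta : t ^ 2 ≤ a := by nlinarith [sq_nonneg t]
      have hxt : x * t ≤ a := by
        refine abs_le_of_sq_le_sq' ?_ ha0 |>.2
        calc (x * t) ^ 2 = a * ((m + 1) * t ^ 2) := by rw [mul_pow, hx2]; ring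
          _ ≤ a * a := by gcongr
          _ = a ^ 2 := by ring
      have hxt' : t ≤ x := by
        refine abs_le_of_sq_le_sq' ?_ hx0 |>.2
        rw [hx2]; nlinarith
      -- Discrete form of the derivative of the square root: passing from m to m + 1 raises 2√(am)
      -- by at least t, because t √(a(m+1)) ≤ a.
      have hy : Real.sqrt (a * m) ≤ x - t / 2 := by
        refine Real.sqrt_le_iff.2 ⟨by linarith, ?_⟩
        nlinarith [sq_nonneg t]
      linarith

/-- Terms of size at most 1/K add up to at most 1. The others lie above the scale of the eluder
dimension, where the counting bound holds. -/
theorem sum_le_of_distEluderDim {X : Type*} [MeasurableSpace X] {Φ : Set (X → ℝ)}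
    {D : Set (Measure X)} {d K : ℕ} (hK : 0 < K) (hd : distEluderDim Φ D (1 / K) ≤ d)
    (μ : ℕ → Measure X) (φ : ℕ → X → ℝ) (hμ : ∀ k < K, μ k ∈ D) (hφ : ∀ k < K, φ k ∈ Φ)
    (h1 : ∀ k, |∫ x, φ k x ∂(μ k)| ≤ 1) {B : ℝ} (hB0 : 0 ≤ B)
    (hB : ∀ k < K, ∑ i ∈ Finset.range k, (∫ x, φ k x ∂(μ i)) ^ 2 ≤ B) :
    ∑ k ∈ Finset.range K, |∫ x, φ k x ∂(μ k)| ≤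
      1 + Real.sqrt (d * K) + 2 * Real.sqrt (B * d * K) := by
  classical
  have hK' : (0 : ℝ) < K := by exact_mod_cast hK
  set e : ℕ → ℝ := fun k => |∫ x, φ k x ∂(μ k)| with he
  rw [← Finset.sum_filter_add_sum_filter_not (Finset.range K) (fun k => 1 / (K : ℝ) < e k) e]
  set s := (Finset.range K).filter (fun k => 1 / (K : ℝ) < e k) with hs
  have hsK : s.card ≤ K := (Finset.card_filter_le _ _).trans (by simp)
  have hbig := sum_le_of_card_le e h1 (ω := 1 / K) (by positivity) hB0 d s.card s rfl
    (fun k hk => (Finset.mem_filter.1 hk).2) (fun t ht => by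
      refine le_trans ?_ (card_le_of_distEluderDim hd μ φ hμ hφ hB0 hB ht
        (lt_trans (by positivity) ht))
      exact_mod_cast Finset.card_le_card (Finset.filter_subset_filter _ (Finset.filter_subset _ _)))
  have hsmall : ∑ k ∈ (Finset.range K).filter (fun k => ¬ 1 / (K : ℝ) < e k), e k ≤ 1 := by
    calc _ ≤ ∑ _k ∈ (Finset.range K).filter (fun k => ¬ 1 / (K : ℝ) < e k), 1 / (K : ℝ) :=
          Finset.sum_le_sum fun k hk => not_lt.1 (Finset.mem_filter.1 hk).2
      _ ≤ ∑ _k ∈ Finset.range K, 1 / (K : ℝ) :=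
          Finset.sum_le_sum_of_subset_of_nonneg (Finset.filter_subset _ _)
            fun _ _ _ => by positivity
      _ = 1 := by simp [hK'.ne']
  -- A minimum is at most the geometric mean. This gives the initial d terms the same √(dK) growth
  -- as the rest.
  have hmin : min (s.card : ℝ) d ≤ Real.sqrt (d * K) := by
    refine Real.le_sqrt_of_sq_le ?_
    have hsK' : (s.card : ℝ) ≤ K := by exact_mod_cast hsK
    rw [sq]
    exact mul_le_mul (min_le_right _ _) ((min_le_left _ _).trans hsK')
      (le_min (Nat.cast_nonneg _) (Nat.cast_nonneg _)) (Nat.cast_nonneg _)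
  have hsq : Real.sqrt (B * d * (s.card - d : ℕ)) ≤ Real.sqrt (B * d * K) := by
    refine Real.sqrt_le_sqrt ?_
    have : ((s.card - d : ℕ) : ℝ) ≤ K := by exact_mod_cast (Nat.sub_le _ _).trans hsK
    gcongr
  linarith

end RSDisRL

namespace RSDisRL

/-! ## Parametrized integrals -/

lemma measurable_lintegral_param {X Y : Type*} [MeasurableSpace X] [MeasurableSpace Y]
    {m : X → Measure Y} (hm : Measurable m) (hp : ∀ x, IsProbabilityMeasure (m x))
    {f : X → Y → ℝ≥0∞} (hf : Measurable (Function.uncurry f)) :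
    Measurable fun x => ∫⁻ y, f x y ∂(m x) := by
  let κ : Kernel X Y := ⟨m, hm⟩
  have : IsMarkovKernel κ := ⟨hp⟩
  exact Measurable.lintegral_kernel_prod_right (κ := κ) hf

lemma measurable_bind_param {X Y Z : Type*} [MeasurableSpace X] [MeasurableSpace Y]
    [MeasurableSpace Z] {m : X → Measure Y} (hm : Measurable m)
    (hp : ∀ x, IsProbabilityMeasure (m x)) {κ : X → Y → Measure Z}
    (hκ : Measurable (Function.uncurry κ)) : Measurable fun x => (m x).bind (κ x) := by
  refine Measure.measurable_of_measurable_coe _ fun B hB => ?_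
  have h : ∀ x, (m x).bind (κ x) B = ∫⁻ y, κ x y B ∂(m x) := fun x =>
    Measure.bind_apply hB (hκ.comp measurable_prodMk_left).aemeasurable
  simp_rw [h]
  exact measurable_lintegral_param hm hp ((Measure.measurable_coe hB).comp hκ)

lemma isProbabilityMeasure_bind_param {Y Z : Type*} [MeasurableSpace Y] [MeasurableSpace Z]
    {m : Measure Y} [IsProbabilityMeasure m] {κ : Y → Measure Z} (hκ : Measurable κ)
    (hp : ∀ y, IsProbabilityMeasure (κ y)) : IsProbabilityMeasure (m.bind κ) :=
  isProbabilityMeasure_bind hκ.aemeasurable (Filter.Eventually.of_forall hp)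

namespace IsCondDensity

variable {X Y : Type*} [MeasurableSpace X] [MeasurableSpace Y] {ν : Measure Y}
  {g : X → Y → ℝ≥0∞}

lemma measurable_apply (hg : IsCondDensity ν g) (x : X) : Measurable (g x) :=
  hg.1.comp measurable_prodMk_left

lemma measurable_withDensity [SFinite ν] (hg : IsCondDensity ν g) :
    Measurable fun x => ν.withDensity (g x) := by
  refine Measure.measurable_of_measurable_coe _ fun B hB => ?_
  simp_rw [withDensity_apply _ hB, ← lintegral_indicator hB]
  refine Measurable.lintegral_prod_right ?_
  exact hg.1.indicator (measurable_snd hB)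

lemma isProbabilityMeasure (hg : IsCondDensity ν g) (x : X) :
    IsProbabilityMeasure (ν.withDensity (g x)) :=
  ⟨by rw [withDensity_apply _ MeasurableSet.univ, Measure.restrict_univ, hg.2 x]⟩

lemma lintegral_withDensity (hg : IsCondDensity ν g) (x : X) {F : Y → ℝ≥0∞} (hF : Measurable F) :
    ∫⁻ y, F y ∂(ν.withDensity (g x)) = ∫⁻ y, g x y * F y ∂ν :=
  lintegral_withDensity_eq_lintegral_mul ν (hg.measurable_apply x) hF

end IsCondDensity

/-! ## A supermartingale bound -/

/-- Stands in for the rule that an `m`-measurable factor comes out of a conditional expectation: the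
hypothesis compares the measures with densities `Y` and `A` on `m`, and an `m`-measurable `Z` can be
integrated against their restrictions to `m`. -/
lemma lintegral_mul_le_of_setLIntegral_le {Ω : Type*} {m mΩ : MeasurableSpace Ω} (hm : m ≤ mΩ)
    {P : Measure Ω} {Y A Z : Ω → ℝ≥0∞} (hY : Measurable[mΩ] Y) (hA : Measurable[mΩ] A)
    (hZ : Measurable[m] Z)
    (h : ∀ E, MeasurableSet[m] E → ∫⁻ ω in E, Y ω ∂P ≤ ∫⁻ ω in E, A ω ∂P) :
    ∫⁻ ω, Y ω * Z ω ∂P ≤ ∫⁻ ω, A ω * Z ω ∂P := by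
  have h1 : ∀ {Y : Ω → ℝ≥0∞}, Measurable[mΩ] Y →
      ∫⁻ ω, Y ω * Z ω ∂P = ∫⁻ ω, Z ω ∂(P.withDensity Y) := fun hY =>
    (lintegral_withDensity_eq_lintegral_mul P hY (hZ.mono hm le_rfl)).symm
  rw [h1 hY, h1 hA, ← lintegral_trim hm hZ, ← lintegral_trim hm hZ]
  refine lintegral_mono' ?_ le_rfl
  refine Measure.le_iff.2 fun E hE => ?_
  rw [trim_measurableSet_eq hm hE, trim_measurableSet_eq hm hE, withDensity_apply _ (hm _ hE),
    withDensity_apply _ (hm _ hE)]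
  exact h E hE

/-- Each factor has conditional mean at most 1 given the past, stated through integrals over past
events. So the partial products form a supermartingale that starts at 1. -/
lemma lintegral_prod_le_one {Ω : Type*} {mΩ : MeasurableSpace Ω} {P : Measure Ω}
    [IsProbabilityMeasure P] (ℱ : Filtration ℕ mΩ) (Y : ℕ → Ω → ℝ≥0∞) (n : ℕ)
    (hY : ∀ k < n, Measurable[ℱ (k + 1)] (Y k))
    (h : ∀ k < n, ∀ E, MeasurableSet[ℱ k] E → ∫⁻ ω in E, Y k ω ∂P ≤ P E) :
    ∀ j ≤ n, ∫⁻ ω, ∏ i ∈ Finset.range j, Y i ω ∂P ≤ 1 := by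
  intro j
  induction j with
  | zero => intro _; simp
  | succ j ih =>
    intro hj
    have hZ : Measurable[ℱ j] fun ω => ∏ i ∈ Finset.range j, Y i ω := by
      refine Finset.measurable_fun_prod _ fun i hi => ?_
      have hi' := Finset.mem_range.1 hi
      exact (hY i (by omega)).mono (ℱ.mono (by omega)) le_rfl
    calc ∫⁻ ω, ∏ i ∈ Finset.range (j + 1), Y i ω ∂P
        = ∫⁻ ω, Y j ω * ∏ i ∈ Finset.range j, Y i ω ∂P := by
          refine lintegral_congr fun ω => ?_
          rw [Finset.prod_range_succ, mul_comm]
      _ ≤ ∫⁻ ω, 1 * ∏ i ∈ Finset.range j, Y i ω ∂P :=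
          lintegral_mul_le_of_setLIntegral_le (ℱ.le j)
            ((hY j (by omega)).mono (ℱ.le _) le_rfl) measurable_const hZ
            (by simpa using h j (by omega))
      _ = ∫⁻ ω, ∏ i ∈ Finset.range j, Y i ω ∂P := by simp only [one_mul]
      _ ≤ 1 := ih (by omega)

/-- Markov's inequality at a fixed time `j`. Uniformity in time comes later from a union bound over
the K + 1 times, which costs only a logarithm. -/
lemma measure_le_prod_le {Ω : Type*} {mΩ : MeasurableSpace Ω} {P : Measure Ω}
    [IsProbabilityMeasure P] (ℱ : Filtration ℕ mΩ) (Y : ℕ → Ω → ℝ≥0∞) (n : ℕ)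
    (hY : ∀ k < n, Measurable[ℱ (k + 1)] (Y k))
    (h : ∀ k < n, ∀ E, MeasurableSet[ℱ k] E → ∫⁻ ω in E, Y k ω ∂P ≤ P E)
    {T : ℝ} (hT : 0 < T) {j : ℕ} (hj : j ≤ n) :
    P {ω | ENNReal.ofReal T ≤ ∏ i ∈ Finset.range j, Y i ω} ≤ ENNReal.ofReal (1 / T) := by
  have hmeas : Measurable fun ω => ∏ i ∈ Finset.range j, Y i ω := by
    refine Finset.measurable_fun_prod _ fun i hi => ?_
    have hi' := Finset.mem_range.1 hi
    exact (hY i (by omega)).mono (ℱ.le _) le_rfl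
  refine (meas_ge_le_lintegral_div hmeas.aemeasurable
    (by simpa using hT) ENNReal.ofReal_ne_top).trans ?_
  rw [ENNReal.ofReal_div_of_pos hT, ENNReal.ofReal_one]
  gcongr
  exact lintegral_prod_le_one ℱ Y n hY h j hj

/-! ## Integral inequalities -/

lemma sq_lintegral_le {X : Type*} [MeasurableSpace X] {μ : Measure X} [IsProbabilityMeasure μ]
    {f : X → ℝ≥0∞} (hf : Measurable f) : (∫⁻ x, f x ∂μ) ^ 2 ≤ ∫⁻ x, f x ^ 2 ∂μ := by
  have h := ENNReal.lintegral_mul_le_Lp_mul_Lq μ Real.HolderConjugate.two_two hf.aemeasurable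
    (aemeasurable_const (b := (1 : ℝ≥0∞)))
  simp only [Pi.mul_apply, mul_one, ENNReal.one_rpow, lintegral_const, measure_univ] at h
  have h2 : ∫⁻ x, f x ^ (2 : ℝ) ∂μ = ∫⁻ x, f x ^ 2 ∂μ :=
    lintegral_congr fun x => by norm_cast
  rw [h2] at h
  calc (∫⁻ x, f x ∂μ) ^ 2 ≤ ((∫⁻ x, f x ^ 2 ∂μ) ^ ((1 : ℝ) / 2)) ^ 2 := by gcongr
    _ = ∫⁻ x, f x ^ 2 ∂μ := by
      rw [← ENNReal.rpow_natCast, ← ENNReal.rpow_mul]; norm_num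

/-- Lower bound on the loss of affinity of a density `g` and a function `u` of mass at most `1 + ε`,
by the mass of `g` above `u`. -/
lemma lintegral_sqrt_mul_add_le {Y : Type*} [MeasurableSpace Y] {ν : Measure Y}
    {u g : Y → ℝ≥0∞} (hu : Measurable u) (hg : Measurable g) {ε : ℝ} (hε : 0 ≤ ε)
    (hgi : ∫⁻ y, g y ∂ν = 1) (hui : ∫⁻ y, u y ∂ν ≤ ENNReal.ofReal (1 + ε)) :
    ∫⁻ y, (u y * g y) ^ ((1 : ℝ) / 2) ∂ν + (∫⁻ y, (g y - u y) ∂ν) ^ 2 / 2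
      ≤ ENNReal.ofReal (1 + ε / 2) := by
  set t := ∫⁻ y, min (u y) (g y) ∂ν with ht
  set s := ∫⁻ y, (g y - u y) ∂ν with hs
  set b := ∫⁻ y, max (u y) (g y) ∂ν with hb
  have hst : t + s = 1 := by
    rw [ht, hs, ← lintegral_add_left (hu.min hg), ← hgi]
    refine lintegral_congr fun y => ?_
    rcases le_total (u y) (g y) with h | h
    · rw [min_eq_left h, add_tsub_cancel_of_le h]
    · rw [min_eq_right h, tsub_eq_zero_of_le h, add_zero]
  have hbs : b ≤ ENNReal.ofReal (1 + ε) + s := by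
    refine le_trans ?_ (add_le_add_left hui s)
    rw [hs, ← lintegral_add_left hu]
    refine lintegral_mono fun y => max_le le_self_add le_add_tsub
  -- Cauchy–Schwarz after writing u g = min(u, g) · max(u, g). The masses of minimum and maximum are
  -- 1 - s and at most 1 + ε + s, whereas u and g themselves would lose the dependence on s.
  have hA : ∫⁻ y, (u y * g y) ^ ((1 : ℝ) / 2) ∂ν ≤ t ^ ((1 : ℝ) / 2) * b ^ ((1 : ℝ) / 2) := by
    have h := ENNReal.lintegral_mul_le_Lp_mul_Lq ν Real.HolderConjugate.two_two
      (f := fun y => (min (u y) (g y)) ^ ((1 : ℝ) / 2))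
      (g := fun y => (max (u y) (g y)) ^ ((1 : ℝ) / 2))
      ((hu.min hg).pow_const _).aemeasurable ((hu.max hg).pow_const _).aemeasurable
    have e : ∀ x : ℝ≥0∞, (x ^ ((1 : ℝ) / 2)) ^ (2 : ℝ) = x := fun x => by
      rw [← ENNReal.rpow_mul]; norm_num
    simp only [Pi.mul_apply, e] at h
    refine le_trans (lintegral_mono fun y => ?_) h
    rw [← ENNReal.mul_rpow_of_nonneg _ _ (by norm_num), min_mul_max]
  have hs1 : s ≤ 1 := hst ▸ le_add_self
  have hsT : s ≠ ⊤ := ne_top_of_le_ne_top ENNReal.one_ne_top hs1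
  have ht1 : t ≤ 1 := hst ▸ le_self_add
  have htT : t ≠ ⊤ := ne_top_of_le_ne_top ENNReal.one_ne_top ht1
  set σ := s.toReal with hσ
  have hσ0 : 0 ≤ σ := ENNReal.toReal_nonneg
  have hσs : s = ENNReal.ofReal σ := (ENNReal.ofReal_toReal hsT).symm
  have hσ1 : σ ≤ 1 := by
    rw [hσ]; exact ENNReal.toReal_le_of_le_ofReal zero_le_one (by simpa using hs1)
  have hts : t = ENNReal.ofReal (1 - σ) := by
    rw [ENNReal.ofReal_sub _ hσ0, ← hσs, ENNReal.ofReal_one, ← hst,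
      ENNReal.add_sub_cancel_right hsT]
  have hbs' : b ≤ ENNReal.ofReal (1 + ε + σ) := by
    rw [ENNReal.ofReal_add (by linarith) hσ0, ← hσs]; exact hbs
  have hroot : t ^ ((1 : ℝ) / 2) * b ^ ((1 : ℝ) / 2) ≤ ENNReal.ofReal (1 + ε / 2 - σ ^ 2 / 2) := by
    rw [← ENNReal.mul_rpow_of_nonneg _ _ (by norm_num)]
    have h1 : t * b ≤ ENNReal.ofReal ((1 + ε / 2 - σ ^ 2 / 2) ^ 2) := by
      calc t * b ≤ ENNReal.ofReal (1 - σ) * ENNReal.ofReal (1 + ε + σ) := by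
            rw [hts]; gcongr
        _ = ENNReal.ofReal ((1 - σ) * (1 + ε + σ)) :=
            (ENNReal.ofReal_mul (by linarith)).symm
        _ ≤ _ := by
            refine ENNReal.ofReal_le_ofReal ?_
            -- The right side minus the left side is (ε/2 - σ²/2)² + σε.
            nlinarith [sq_nonneg (ε / 2 - σ ^ 2 / 2), mul_nonneg hσ0 hε]
    calc (t * b) ^ ((1 : ℝ) / 2)
        ≤ (ENNReal.ofReal ((1 + ε / 2 - σ ^ 2 / 2) ^ 2)) ^ ((1 : ℝ) / 2) := by gcongr
      _ = ENNReal.ofReal (1 + ε / 2 - σ ^ 2 / 2) := by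
          have h0 : 0 ≤ 1 + ε / 2 - σ ^ 2 / 2 := by nlinarith
          rw [ENNReal.ofReal_rpow_of_nonneg (by positivity) (by norm_num), ← Real.sqrt_eq_rpow,
            Real.sqrt_sq h0]
  have hs2 : s ^ 2 / 2 = ENNReal.ofReal (σ ^ 2 / 2) := by
    rw [hσs, ← ENNReal.ofReal_pow hσ0, ENNReal.ofReal_div_of_pos (by norm_num)]
    simp
  rw [hs2]
  calc _ ≤ ENNReal.ofReal (1 + ε / 2 - σ ^ 2 / 2) + ENNReal.ofReal (σ ^ 2 / 2) :=
        add_le_add_left (hA.trans hroot) _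
    _ = ENNReal.ofReal (1 + ε / 2) := by
        rw [← ENNReal.ofReal_add (by nlinarith) (by positivity)]; congr 1; ring

/-! ## Total variation as a one-sided integral -/

/-- Both sides are 1 minus the mass of the minimum. Total variation can therefore be handled as a
one-sided integral of either sign. -/
lemma lintegral_tsub_comm {Y : Type*} [MeasurableSpace Y] {ν : Measure Y} {p q : Y → ℝ≥0∞}
    (hp : Measurable p) (hq : Measurable q) (hpi : ∫⁻ y, p y ∂ν = 1) (hqi : ∫⁻ y, q y ∂ν = 1) :
    ∫⁻ y, (p y - q y) ∂ν = ∫⁻ y, (q y - p y) ∂ν := by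
  have h : ∀ {p q : Y → ℝ≥0∞}, Measurable p → Measurable q → ∫⁻ y, p y ∂ν = 1 →
      ∫⁻ y, min (p y) (q y) ∂ν + ∫⁻ y, (p y - q y) ∂ν = 1 := by
    intro p q hp hq hpi
    rw [← lintegral_add_left (hp.min hq), ← hpi]
    refine lintegral_congr fun y => ?_
    rcases le_total (p y) (q y) with h | h
    · rw [min_eq_left h, tsub_eq_zero_of_le h, add_zero]
    · rw [min_eq_right h, add_tsub_cancel_of_le h]
  have h1 := h hp hq hpi
  have h2 := h hq hp hqi
  simp_rw [min_comm (q _)] at h2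
  have hT : ∫⁻ y, min (p y) (q y) ∂ν ≠ ⊤ :=
    ne_top_of_le_ne_top ENNReal.one_ne_top (h1 ▸ le_self_add)
  exact (ENNReal.add_right_inj hT).1 (h1.trans h2.symm)

lemma tvDist_eq {p q : ℝ → ℝ≥0∞} (hp : Measurable p) (hq : Measurable q)
    (hpi : ∫⁻ y, p y = 1) (hqi : ∫⁻ y, q y = 1) :
    tvDist p q = (∫⁻ y, (q y - p y)).toReal := by
  unfold tvDist
  rw [lintegral_add_left (f := fun z => p z - q z) (hp.sub hq), lintegral_tsub_comm hp hq hpi hqi, ← two_mul,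
    mul_comm, ENNReal.mul_div_cancel_right (by norm_num) (by norm_num)]

lemma lintegral_tsub_le_one {Y : Type*} [MeasurableSpace Y] {ν : Measure Y} {p q : Y → ℝ≥0∞}
    (hpi : ∫⁻ y, p y ∂ν = 1) : ∫⁻ y, (p y - q y) ∂ν ≤ 1 :=
  hpi ▸ lintegral_mono fun _ => tsub_le_self

lemma lintegral_mul_le_add_tsub {Y : Type*} [MeasurableSpace Y] {ν : Measure Y}
    {p q ψ : Y → ℝ≥0∞} (hp : Measurable p) (hq : Measurable q) (hψ : ∀ y, ψ y ≤ 1) :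
    ∫⁻ y, p y * ψ y ∂ν ≤ ∫⁻ y, q y * ψ y ∂ν + ∫⁻ y, (p y - q y) ∂ν := by
  rw [← lintegral_add_right (g := fun y => p y - q y) _ (hp.sub hq)]
  refine lintegral_mono fun y => ?_
  calc p y * ψ y ≤ (q y + (p y - q y)) * ψ y := by gcongr; exact le_add_tsub
    _ = q y * ψ y + (p y - q y) * ψ y := add_mul _ _ _
    _ ≤ q y * ψ y + (p y - q y) := by gcongr; exact mul_le_of_le_one_right' (hψ y)

/-- The g-mean of √(u/g) is at most the affinity of u and g. Equality can fail where g is infinite,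
since division by ⊤ gives 0. -/
lemma mul_div_sqrt_le (u g : ℝ≥0∞) :
    g * (u / g) ^ ((1 : ℝ) / 2) ≤ (u * g) ^ ((1 : ℝ) / 2) := by
  rcases eq_or_ne g 0 with rfl | h0
  · simp
  rcases eq_or_ne g ⊤ with rfl | hT
  · rcases eq_or_ne u ⊤ with rfl | hu
    · simp
    · simp [ENNReal.div_top]
  refine le_of_eq ?_
  have : g = (g * g) ^ ((1 : ℝ) / 2) := by
    rw [← sq, ← ENNReal.rpow_natCast, ← ENNReal.rpow_mul]; norm_num
  conv_lhs => rw [this]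
  rw [← ENNReal.mul_rpow_of_nonneg _ _ (by norm_num)]
  congr 1
  rw [← this, mul_assoc, ENNReal.mul_div_cancel h0 hT, mul_comm]

end RSDisRL

namespace RSDisRL

lemma measurable_map_param {X Y Z : Type*} [MeasurableSpace X] [MeasurableSpace Y]
    [MeasurableSpace Z] {m : X → Measure Y} (hm : Measurable m)
    (hp : ∀ x, IsProbabilityMeasure (m x)) {g : X → Y → Z}
    (hg : Measurable (Function.uncurry g)) : Measurable fun x => (m x).map (g x) := by
  refine Measure.measurable_of_measurable_coe _ fun B hB => ?_
  have h : ∀ x, (m x).map (g x) B = ∫⁻ y, B.indicator 1 (g x y) ∂(m x) := fun x => by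
    have hgx : Measurable (g x) := hg.comp measurable_prodMk_left
    rw [← lintegral_map (measurable_one.indicator hB) hgx, lintegral_indicator_one hB]
  simp_rw [h]
  exact measurable_lintegral_param hm hp ((measurable_one.indicator hB).comp hg)

/-! ## Trajectories of the decision process -/

attribute [instance] MDP.init_prob MDP.trans_markov MDP.reward_markov

namespace MDP

variable {S A : Type*} [MeasurableSpace S] [MeasurableSpace A]

lemma measurable_consTraj (n : ℕ) :
    Measurable fun q : (AugState S × A × ℝ) × Traj S A n =>
      (Fin.cons (α := fun _ => AugState S × A × ℝ) q.1 q.2 : Traj S A (n + 1)) := by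
  refine measurable_pi_iff.2 fun j => ?_
  refine Fin.cases ?_ (fun j => ?_) j
  · exact measurable_fst
  · exact (measurable_pi_apply j).comp measurable_snd

/-- The law of a further draw from `κ q r s'`, where `r` and `s'` are the reward and the next state
after the augmented state and action `q` at step `h`. -/
noncomputable def next (M : MDP S A) {Z : Type*} [MeasurableSpace Z] (h : ℕ)
    (κ : AugState S × A → ℝ → S → Measure Z) (q : AugState S × A) : Measure Z :=
  (M.reward h (q.1.1, q.2)).bind fun r => (M.trans h (q.1.1, q.2)).bind fun s' => κ q r s'

section Next

variable (M : MDP S A) {Z : Type*} [MeasurableSpace Z] (h : ℕ)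

lemma measurable_lintegral_trans {f : AugState S × A → ℝ → S → ℝ≥0∞}
    (hf : Measurable fun w : ((AugState S × A) × ℝ) × S => f w.1.1 w.1.2 w.2) :
    Measurable fun w : (AugState S × A) × ℝ => ∫⁻ s', f w.1 w.2 s' ∂(M.trans h (w.1.1.1, w.1.2)) :=
  measurable_lintegral_param (m := fun w : (AugState S × A) × ℝ => M.trans h (w.1.1.1, w.1.2))
    ((M.trans h).measurable.comp (by fun_prop)) (fun _ => inferInstance) hf

lemma measurable_lintegral_reward {f : AugState S × A → ℝ → ℝ≥0∞}
    (hf : Measurable (Function.uncurry f)) :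
    Measurable fun q : AugState S × A => ∫⁻ r, f q r ∂(M.reward h (q.1.1, q.2)) :=
  measurable_lintegral_param (m := fun q : AugState S × A => M.reward h (q.1.1, q.2))
    ((M.reward h).measurable.comp (by fun_prop)) (fun _ => inferInstance) hf

variable {κ : AugState S × A → ℝ → S → Measure Z}

lemma measurable_trans_bind
    (hκ : Measurable fun w : ((AugState S × A) × ℝ) × S => κ w.1.1 w.1.2 w.2) :
    Measurable fun w : (AugState S × A) × ℝ =>
      (M.trans h (w.1.1.1, w.1.2)).bind fun s' => κ w.1 w.2 s' :=
  measurable_bind_param (m := fun w : (AugState S × A) × ℝ => M.trans h (w.1.1.1, w.1.2))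
    ((M.trans h).measurable.comp (by fun_prop)) (fun _ => inferInstance) hκ

lemma measurable_next
    (hκ : Measurable fun w : ((AugState S × A) × ℝ) × S => κ w.1.1 w.1.2 w.2) :
    Measurable (M.next h κ) :=
  measurable_bind_param (m := fun q : AugState S × A => M.reward h (q.1.1, q.2))
    ((M.reward h).measurable.comp (by fun_prop)) (fun _ => inferInstance)
    (M.measurable_trans_bind h (κ := κ) hκ)

lemma lintegral_next
    (hκ : Measurable fun w : ((AugState S × A) × ℝ) × S => κ w.1.1 w.1.2 w.2)
    (q : AugState S × A) {F : Z → ℝ≥0∞} (hF : Measurable F) :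
    ∫⁻ z, F z ∂(M.next h κ q) = ∫⁻ r, ∫⁻ s', ∫⁻ z, F z ∂(κ q r s')
      ∂(M.trans h (q.1.1, q.2)) ∂(M.reward h (q.1.1, q.2)) := by
  have m1 : Measurable fun r => (M.trans h (q.1.1, q.2)).bind fun s' => κ q r s' :=
    measurable_bind_param (m := fun _ : ℝ => M.trans h (q.1.1, q.2)) measurable_const
      (fun _ => inferInstance) (hκ.comp (f := fun w : ℝ × S => ((q, w.1), w.2)) (by fun_prop))
  have m2 : ∀ r, Measurable fun s' => κ q r s' := fun r =>
    hκ.comp (f := fun s' => ((q, r), s')) (by fun_prop)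
  unfold next
  rw [Measure.lintegral_bind m1.aemeasurable hF.aemeasurable]
  refine lintegral_congr fun r => ?_
  rw [Measure.lintegral_bind (m2 r).aemeasurable hF.aemeasurable]

lemma isProbabilityMeasure_next
    (hκ : Measurable fun w : ((AugState S × A) × ℝ) × S => κ w.1.1 w.1.2 w.2)
    (hp : ∀ q r s', IsProbabilityMeasure (κ q r s')) (q : AugState S × A) :
    IsProbabilityMeasure (M.next h κ q) := by
  constructor
  rw [← lintegral_one, M.lintegral_next h (κ := κ) hκ q measurable_const]
  simp

end Next

/-- The law of the trajectory that starts at step `h`, given the first augmented state and action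
`q`, the first reward `r` and the next state `s'`. -/
noncomputable def rolloutCons (M : MDP S A) (α : Measure A) (π : Policy S A) (n h : ℕ)
    (q : AugState S × A) (r : ℝ) (s' : S) : Measure (Traj S A (n + 1)) :=
  (M.rollout α π n (h + 1) (s', q.1.2 + r)).map
    (Fin.cons (α := fun _ => AugState S × A × ℝ) (q.1, q.2, r))

lemma measurable_rolloutCons (M : MDP S A) {α : Measure A} {π : Policy S A} {n h : ℕ}
    (hm : Measurable (M.rollout α π n (h + 1)))
    (hp : ∀ x, IsProbabilityMeasure (M.rollout α π n (h + 1) x)) :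
    Measurable fun w : ((AugState S × A) × ℝ) × S => M.rolloutCons α π n h w.1.1 w.1.2 w.2 := by
  refine measurable_map_param (m := fun w : ((AugState S × A) × ℝ) × S =>
    M.rollout α π n (h + 1) (w.2, w.1.1.1.2 + w.1.2)) (hm.comp (by fun_prop)) (fun _ => hp _) ?_
  exact (measurable_consTraj n).comp
    (f := fun q : (((AugState S × A) × ℝ) × S) × Traj S A n =>
      ((q.1.1.1.1, q.1.1.1.2, q.1.1.2), q.2)) (by fun_prop)

lemma measurable_cons_left (n : ℕ) (v : AugState S × A × ℝ) :
    Measurable (Fin.cons (α := fun _ => AugState S × A × ℝ) v : Traj S A n → Traj S A (n + 1)) :=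
  (measurable_consTraj n).comp (measurable_prodMk_left (x := v))

lemma rollout_succ (M : MDP S A) (α : Measure A) (π : Policy S A) (n h : ℕ) (x : AugState S) :
    M.rollout α π (n + 1) h x = (α.withDensity (π h x)).bind fun a =>
      M.next h (M.rolloutCons α π n h) (x, a) := rfl

section Rollout

variable (M : MDP S A) {α : Measure A} [SFinite α] {H : ℕ} {π : Policy S A}

/-- Measurability and total mass 1 are proved together, because measurability of the longer rollout
uses that the shorter ones are probability measures. -/
lemma rollout_regular (hπ : ∀ h < H, IsCondDensity α (π h)) (n : ℕ) : ∀ h, h + n ≤ H →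
    Measurable (M.rollout α π n h) ∧ ∀ x, IsProbabilityMeasure (M.rollout α π n h x) := by
  induction n with
  | zero =>
    intro h _
    exact ⟨measurable_const, fun x => Measure.dirac.isProbabilityMeasure⟩
  | succ n ih =>
    intro h hn
    obtain ⟨ihm, ihp⟩ := ih (h + 1) (by omega)
    have hπh := hπ h (by omega)
    have mκ := M.measurable_rolloutCons ihm ihp
    have mn := M.measurable_next h (κ := M.rolloutCons α π n h) mκ
    have pn := M.isProbabilityMeasure_next h (κ := M.rolloutCons α π n h) mκ fun q r s' =>
      have := ihp (s', q.1.2 + r)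
      Measure.isProbabilityMeasure_map (measurable_cons_left n _).aemeasurable
    constructor
    · have := measurable_bind_param hπh.measurable_withDensity hπh.isProbabilityMeasure
        (κ := fun x a => M.next h (M.rolloutCons α π n h) (x, a)) mn
      exact this
    · intro x
      have := hπh.isProbabilityMeasure x
      rw [rollout_succ]
      exact isProbabilityMeasure_bind_param (mn.comp (measurable_prodMk_left (x := x)))
        fun a => pn (x, a)

lemma measurable_rollout (hπ : ∀ h < H, IsCondDensity α (π h)) {n h : ℕ} (hn : h + n ≤ H) :
    Measurable (M.rollout α π n h) :=
  (M.rollout_regular hπ n h hn).1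

lemma isProbabilityMeasure_rollout (hπ : ∀ h < H, IsCondDensity α (π h)) {n h : ℕ}
    (hn : h + n ≤ H) (x : AugState S) : IsProbabilityMeasure (M.rollout α π n h x) :=
  (M.rollout_regular hπ n h hn).2 x

lemma lintegral_rollout_succ (hπ : ∀ h < H, IsCondDensity α (π h)) {n h : ℕ} (hn : h + (n + 1) ≤ H)
    (x : AugState S) {F : Traj S A (n + 1) → ℝ≥0∞} (hF : Measurable F) :
    ∫⁻ τ, F τ ∂(M.rollout α π (n + 1) h x) = ∫⁻ a, ∫⁻ r, ∫⁻ s', ∫⁻ τ,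
        F (Fin.cons (α := fun _ => AugState S × A × ℝ) (x, a, r) τ)
        ∂(M.rollout α π n (h + 1) (s', x.2 + r)) ∂(M.trans h (x.1, a)) ∂(M.reward h (x.1, a))
      ∂(α.withDensity (π h x)) := by
  have mκ := M.measurable_rolloutCons (M.measurable_rollout hπ (n := n) (h := h + 1) (by omega))
    (M.isProbabilityMeasure_rollout hπ (by omega))
  have mn : Measurable fun a => M.next h (M.rolloutCons α π n h) (x, a) :=
    (M.measurable_next h (κ := M.rolloutCons α π n h) mκ).comp (measurable_prodMk_left (x := x))
  rw [rollout_succ, Measure.lintegral_bind mn.aemeasurable hF.aemeasurable]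
  refine lintegral_congr fun a => ?_
  rw [M.lintegral_next h (κ := M.rolloutCons α π n h) mκ (x, a) hF]
  refine lintegral_congr fun r => lintegral_congr fun s' => ?_
  exact lintegral_map hF (measurable_cons_left n _)

/-- The rollout starts at the given state. -/
lemma lintegral_rollout_head (hπ : ∀ h < H, IsCondDensity α (π h)) {n h : ℕ}
    (hn : h + (n + 1) ≤ H) (x : AugState S) {f : AugState S → ℝ≥0∞} (hf : Measurable f) :
    ∫⁻ τ, f (τ 0).1 ∂(M.rollout α π (n + 1) h x) = f x := by
  have hF : Measurable fun τ : Traj S A (n + 1) => f (τ 0).1 :=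
    hf.comp (measurable_fst.comp (measurable_pi_apply 0))
  rw [M.lintegral_rollout_succ hπ hn x hF]
  have hp := fun y => M.isProbabilityMeasure_rollout hπ (n := n) (h := h + 1) (by omega) y
  have := (hπ h (by omega)).isProbabilityMeasure x
  simp only [Fin.cons_zero, lintegral_const, measure_univ, mul_one]

/-- Markov property: the reward at step `j` of a rollout, given the state and the action. -/
lemma lintegral_rollout_reward (hπ : ∀ h < H, IsCondDensity α (π h)) {n : ℕ} :
    ∀ {h : ℕ} (_ : h + n ≤ H) (x : AugState S) (j : ℕ) (hj : j < n)
    {G : AugState S × A → ℝ → ℝ≥0∞} (_ : Measurable (Function.uncurry G)),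
    ∫⁻ τ, G ((τ ⟨j, hj⟩).1, (τ ⟨j, hj⟩).2.1) (τ ⟨j, hj⟩).2.2 ∂(M.rollout α π n h x) =
      ∫⁻ τ, ∫⁻ r, G ((τ ⟨j, hj⟩).1, (τ ⟨j, hj⟩).2.1) r
        ∂(M.reward (h + j) ((τ ⟨j, hj⟩).1.1, (τ ⟨j, hj⟩).2.1)) ∂(M.rollout α π n h x) := by
  induction n with
  | zero => intro h _ x j hj; omega
  | succ n ih =>
    intro h hn x j hj G hG
    have e1 : Measurable fun τ : Traj S A (n + 1) =>
        G ((τ ⟨j, hj⟩).1, (τ ⟨j, hj⟩).2.1) (τ ⟨j, hj⟩).2.2 :=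
      hG.comp (f := fun τ : Traj S A (n + 1) =>
        (((τ ⟨j, hj⟩).1, (τ ⟨j, hj⟩).2.1), (τ ⟨j, hj⟩).2.2)) (by fun_prop)
    have e2 : Measurable fun τ : Traj S A (n + 1) =>
        ∫⁻ r, G ((τ ⟨j, hj⟩).1, (τ ⟨j, hj⟩).2.1) r
          ∂(M.reward (h + j) ((τ ⟨j, hj⟩).1.1, (τ ⟨j, hj⟩).2.1)) :=
      (M.measurable_lintegral_reward (h + j) hG).comp (f := fun τ : Traj S A (n + 1) =>
        ((τ ⟨j, hj⟩).1, (τ ⟨j, hj⟩).2.1)) (by fun_prop)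
    rw [M.lintegral_rollout_succ hπ hn x e1, M.lintegral_rollout_succ hπ hn x e2]
    have hp := fun y => M.isProbabilityMeasure_rollout hπ (n := n) (h := h + 1) (by omega) y
    refine lintegral_congr fun a => ?_
    cases j with
    | zero =>
      change ∫⁻ r, ∫⁻ s', ∫⁻ τ, G (x, a) r ∂(M.rollout α π n (h + 1) (s', x.2 + r))
        ∂(M.trans h (x.1, a)) ∂(M.reward h (x.1, a)) = ∫⁻ r, ∫⁻ s', ∫⁻ τ,
          ∫⁻ r', G (x, a) r' ∂(M.reward h (x.1, a)) ∂(M.rollout α π n (h + 1) (s', x.2 + r))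
        ∂(M.trans h (x.1, a)) ∂(M.reward h (x.1, a))
      simp only [lintegral_const, measure_univ, mul_one]
    | succ j =>
      refine lintegral_congr fun r => lintegral_congr fun s' => ?_
      have := ih (h := h + 1) (by omega) (s', x.2 + r) j (by omega) hG
      rw [show h + 1 + j = h + (j + 1) by omega] at this
      exact this

/-- Markov property: the reward at step `j` of a rollout and the state at the next step, given the
state and the action at step `j`. -/
lemma lintegral_rollout_trans (hπ : ∀ h < H, IsCondDensity α (π h)) {n : ℕ} :
    ∀ {h : ℕ} (_ : h + n ≤ H) (x : AugState S) (j : ℕ) (hj : j < n) (hj' : j + 1 < n)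
    {G : AugState S × A → ℝ → AugState S → ℝ≥0∞}
    (_ : Measurable fun w : ((AugState S × A) × ℝ) × AugState S => G w.1.1 w.1.2 w.2),
    ∫⁻ τ, G ((τ ⟨j, hj⟩).1, (τ ⟨j, hj⟩).2.1) (τ ⟨j, hj⟩).2.2 (τ ⟨j + 1, hj'⟩).1
        ∂(M.rollout α π n h x) =
      ∫⁻ τ, ∫⁻ r, ∫⁻ s', G ((τ ⟨j, hj⟩).1, (τ ⟨j, hj⟩).2.1) r (s', (τ ⟨j, hj⟩).1.2 + r)
        ∂(M.trans (h + j) ((τ ⟨j, hj⟩).1.1, (τ ⟨j, hj⟩).2.1))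
        ∂(M.reward (h + j) ((τ ⟨j, hj⟩).1.1, (τ ⟨j, hj⟩).2.1)) ∂(M.rollout α π n h x) := by
  induction n with
  | zero => intro h _ x j hj; omega
  | succ n ih =>
    intro h hn x j hj hj' G hG
    have e1 : Measurable fun τ : Traj S A (n + 1) =>
        G ((τ ⟨j, hj⟩).1, (τ ⟨j, hj⟩).2.1) (τ ⟨j, hj⟩).2.2 (τ ⟨j + 1, hj'⟩).1 :=
      hG.comp (f := fun τ : Traj S A (n + 1) =>
        ((((τ ⟨j, hj⟩).1, (τ ⟨j, hj⟩).2.1), (τ ⟨j, hj⟩).2.2), (τ ⟨j + 1, hj'⟩).1)) (by fun_prop)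
    have e0 : Measurable fun w : ((AugState S × A) × ℝ) × S =>
        G w.1.1 w.1.2 (w.2, w.1.1.1.2 + w.1.2) :=
      hG.comp (f := fun w : ((AugState S × A) × ℝ) × S =>
        (w.1, (w.2, w.1.1.1.2 + w.1.2))) (by fun_prop)
    have e2 : Measurable fun τ : Traj S A (n + 1) =>
        ∫⁻ r, ∫⁻ s', G ((τ ⟨j, hj⟩).1, (τ ⟨j, hj⟩).2.1) r (s', (τ ⟨j, hj⟩).1.2 + r)
          ∂(M.trans (h + j) ((τ ⟨j, hj⟩).1.1, (τ ⟨j, hj⟩).2.1))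
          ∂(M.reward (h + j) ((τ ⟨j, hj⟩).1.1, (τ ⟨j, hj⟩).2.1)) :=
      (M.measurable_lintegral_reward (h + j)
        (f := fun q r => ∫⁻ s', G q r (s', q.1.2 + r) ∂(M.trans (h + j) (q.1.1, q.2)))
        (M.measurable_lintegral_trans (h + j) (f := fun q r s' => G q r (s', q.1.2 + r)) e0)).comp
        (f := fun τ : Traj S A (n + 1) => ((τ ⟨j, hj⟩).1, (τ ⟨j, hj⟩).2.1)) (by fun_prop)
    rw [M.lintegral_rollout_succ hπ hn x e1, M.lintegral_rollout_succ hπ hn x e2]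
    have hp := fun y => M.isProbabilityMeasure_rollout hπ (n := n) (h := h + 1) (by omega) y
    refine lintegral_congr fun a => ?_
    cases j with
    | zero =>
      -- The remaining rollout is not empty, so its first state is the next state, which
      -- `lintegral_rollout_head` evaluates.
      obtain ⟨m, rfl⟩ : ∃ m, n = m + 1 := ⟨n - 1, by omega⟩
      change ∫⁻ r, ∫⁻ s', ∫⁻ τ, G (x, a) r (τ 0).1
          ∂(M.rollout α π (m + 1) (h + 1) (s', x.2 + r))
        ∂(M.trans h (x.1, a)) ∂(M.reward h (x.1, a)) = ∫⁻ r, ∫⁻ s', ∫⁻ τ,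
          ∫⁻ r', ∫⁻ s'', G (x, a) r' (s'', x.2 + r') ∂(M.trans h (x.1, a)) ∂(M.reward h (x.1, a))
            ∂(M.rollout α π (m + 1) (h + 1) (s', x.2 + r))
        ∂(M.trans h (x.1, a)) ∂(M.reward h (x.1, a))
      simp only [lintegral_const, measure_univ, mul_one]
      refine lintegral_congr fun r => lintegral_congr fun s' => ?_
      exact M.lintegral_rollout_head hπ (by omega) _
        (hG.comp (measurable_prodMk_left (x := ((x, a), r))))
    | succ j =>
      refine lintegral_congr fun r => lintegral_congr fun s' => ?_
      have := ih (h := h + 1) (by omega) (s', x.2 + r) j (by omega) (by omega) hG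
      rw [show h + 1 + j = h + (j + 1) by omega] at this
      exact this

end Rollout
end MDP
end RSDisRL

namespace RSDisRL
namespace MDP

variable {S A : Type*} [MeasurableSpace S] [MeasurableSpace A]

/-! ## The Bellman operator -/

section Bellman

variable (M : MDP S A) {α : Measure A} {π : Policy S A} {h : ℕ}
  {g : AugState S × A → ℝ → ℝ≥0∞}

lemma measurable_bellman_integrand (hπ : IsCondDensity α (π (h + 1)))
    (hg : IsCondDensity volume g) :
    Measurable fun w : (((AugState S × A) × ℝ) × (ℝ × S)) × A =>
      π (h + 1) (w.1.2.2, w.1.1.1.1.2 + w.1.2.1) w.2 *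
        g ((w.1.2.2, w.1.1.1.1.2 + w.1.2.1), w.2) (w.1.1.2 - w.1.2.1) :=
  (hπ.1.comp (f := fun w : (((AugState S × A) × ℝ) × (ℝ × S)) × A =>
      ((w.1.2.2, w.1.1.1.1.2 + w.1.2.1), w.2)) (by fun_prop)).mul
    (hg.1.comp (f := fun w : (((AugState S × A) × ℝ) × (ℝ × S)) × A =>
      (((w.1.2.2, w.1.1.1.1.2 + w.1.2.1), w.2), w.1.1.2 - w.1.2.1)) (by fun_prop))

/-- Bellman updates are monotone up to constants. -/
lemma bellman_le_mul {π' : Policy S A} {g' : AugState S × A → ℝ → ℝ≥0∞} {c : ℝ≥0∞} (hc : c ≠ ⊤)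
    (hle : ∀ x a z, π' (h + 1) x a * g' (x, a) z ≤ c * (π (h + 1) x a * g (x, a) z))
    (q : AugState S × A) (z : ℝ) : M.bellman α π' h g' q z ≤ c * M.bellman α π h g q z := by
  unfold bellman
  rw [← lintegral_const_mul' _ _ hc]
  refine lintegral_mono fun r => ?_
  rw [← lintegral_const_mul' _ _ hc]
  refine lintegral_mono fun s' => ?_
  rw [← lintegral_const_mul' _ _ hc]
  exact lintegral_mono fun a' => hle _ _ _

variable [SFinite α]

/-- A single integral over a product measure, so that Tonelli's theorem can exchange it with the
integral over the return. -/
lemma bellman_eq_lintegral_prod (hπ : IsCondDensity α (π (h + 1)))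
    (hg : IsCondDensity volume g) (q : AugState S × A) (z : ℝ) :
    M.bellman α π h g q z = ∫⁻ w : (ℝ × S) × A,
      π (h + 1) (w.1.2, q.1.2 + w.1.1) w.2 * g ((w.1.2, q.1.2 + w.1.1), w.2) (z - w.1.1)
      ∂(((M.reward h (q.1.1, q.2)).prod (M.trans h (q.1.1, q.2))).prod α) := by
  have hm : Measurable fun w : (ℝ × S) × A =>
      π (h + 1) (w.1.2, q.1.2 + w.1.1) w.2 * g ((w.1.2, q.1.2 + w.1.1), w.2) (z - w.1.1) :=
    (measurable_bellman_integrand hπ hg).comp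
      (f := fun w : (ℝ × S) × A => (((q, z), w.1), w.2)) (by fun_prop)
  rw [lintegral_prod _ hm.aemeasurable, lintegral_prod _ hm.lintegral_prod_right'.aemeasurable]
  rfl

lemma measurable_bellman (hπ : IsCondDensity α (π (h + 1))) (hg : IsCondDensity volume g) :
    Measurable (Function.uncurry (M.bellman α π h g)) := by
  have hm := measurable_bellman_integrand hπ hg
  have h1 : Measurable fun w : ((AugState S × A) × ℝ) × (ℝ × S) =>
      ∫⁻ a', π (h + 1) (w.2.2, w.1.1.1.2 + w.2.1) a' *
        g ((w.2.2, w.1.1.1.2 + w.2.1), a') (w.1.2 - w.2.1) ∂α := hm.lintegral_prod_right'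
  have h2 : Measurable fun w : ((AugState S × A) × ℝ) × ℝ => ∫⁻ s', ∫⁻ a',
      π (h + 1) (s', w.1.1.1.2 + w.2) a' * g ((s', w.1.1.1.2 + w.2), a') (w.1.2 - w.2) ∂α
      ∂(M.trans h (w.1.1.1.1, w.1.1.2)) :=
    measurable_lintegral_param
      (m := fun w : ((AugState S × A) × ℝ) × ℝ => M.trans h (w.1.1.1.1, w.1.1.2))
      ((M.trans h).measurable.comp (by fun_prop)) (fun _ => inferInstance)
      (h1.comp (f := fun w : (((AugState S × A) × ℝ) × ℝ) × S => (w.1.1, (w.1.2, w.2)))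
        (by fun_prop))
  exact measurable_lintegral_param
      (m := fun w : (AugState S × A) × ℝ => M.reward h (w.1.1.1, w.1.2))
      ((M.reward h).measurable.comp (by fun_prop)) (fun _ => inferInstance) h2

/-- The Bellman update is the density of r + Z, where Z is drawn from `g` at the next state and
action. In this weak form the shift by the reward moves onto the test function. -/
lemma lintegral_bellman_mul (hπ : IsCondDensity α (π (h + 1))) (hg : IsCondDensity volume g)
    (q : AugState S × A) {ψ : ℝ → ℝ≥0∞} (hψ : Measurable ψ) :
    ∫⁻ z, M.bellman α π h g q z * ψ z = ∫⁻ r, ∫⁻ s', ∫⁻ a',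
        ∫⁻ z, g ((s', q.1.2 + r), a') z * ψ (z + r) ∂volume
        ∂(α.withDensity (π (h + 1) (s', q.1.2 + r))) ∂(M.trans h (q.1.1, q.2))
      ∂(M.reward h (q.1.1, q.2)) := by
  have hm : Measurable fun w : ℝ × ((ℝ × S) × A) =>
      π (h + 1) (w.2.1.2, q.1.2 + w.2.1.1) w.2.2 *
        g ((w.2.1.2, q.1.2 + w.2.1.1), w.2.2) (w.1 - w.2.1.1) :=
    (measurable_bellman_integrand hπ hg).comp
      (f := fun w : ℝ × ((ℝ × S) × A) => (((q, w.1), w.2.1), w.2.2)) (by fun_prop)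
  have hG : Measurable fun w : ((ℝ × S) × A) × ℝ =>
      g ((w.1.1.2, q.1.2 + w.1.1.1), w.1.2) w.2 * ψ (w.2 + w.1.1.1) :=
    (hg.1.comp (f := fun w : ((ℝ × S) × A) × ℝ =>
      (((w.1.1.2, q.1.2 + w.1.1.1), w.1.2), w.2)) (by fun_prop)).mul
      (hψ.comp (f := fun w : ((ℝ × S) × A) × ℝ => w.2 + w.1.1.1) (by fun_prop))
  have hG' : Measurable fun w : (ℝ × S) × A =>
      ∫⁻ z, g ((w.1.2, q.1.2 + w.1.1), w.2) z * ψ (z + w.1.1) := hG.lintegral_prod_right'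
  have hP : Measurable fun w : (ℝ × S) × A => π (h + 1) (w.1.2, q.1.2 + w.1.1) w.2 :=
    hπ.1.comp (f := fun w : (ℝ × S) × A => ((w.1.2, q.1.2 + w.1.1), w.2)) (by fun_prop)
  calc ∫⁻ z, M.bellman α π h g q z * ψ z
      = ∫⁻ z, ∫⁻ w : (ℝ × S) × A, π (h + 1) (w.1.2, q.1.2 + w.1.1) w.2 *
          g ((w.1.2, q.1.2 + w.1.1), w.2) (z - w.1.1) * ψ z
          ∂(((M.reward h (q.1.1, q.2)).prod (M.trans h (q.1.1, q.2))).prod α) := by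
        refine lintegral_congr fun z => ?_
        rw [M.bellman_eq_lintegral_prod hπ hg, lintegral_mul_const _ ?_]
        exact hm.comp (measurable_prodMk_left (x := z))
    _ = ∫⁻ w : (ℝ × S) × A, ∫⁻ z, π (h + 1) (w.1.2, q.1.2 + w.1.1) w.2 *
          g ((w.1.2, q.1.2 + w.1.1), w.2) (z - w.1.1) * ψ z ∂volume
          ∂(((M.reward h (q.1.1, q.2)).prod (M.trans h (q.1.1, q.2))).prod α) :=
        lintegral_lintegral_swap (hm.mul (hψ.comp measurable_fst)).aemeasurable
    _ = ∫⁻ w : (ℝ × S) × A, π (h + 1) (w.1.2, q.1.2 + w.1.1) w.2 *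
          ∫⁻ z, g ((w.1.2, q.1.2 + w.1.1), w.2) z * ψ (z + w.1.1) ∂volume
          ∂(((M.reward h (q.1.1, q.2)).prod (M.trans h (q.1.1, q.2))).prod α) := by
        refine lintegral_congr fun w => ?_
        have hGw : Measurable fun z => g ((w.1.2, q.1.2 + w.1.1), w.2) z * ψ (z + w.1.1) :=
          hG.comp (measurable_prodMk_left (x := w))
        rw [← lintegral_const_mul _ hGw]
        -- Translation invariance of Lebesgue measure: substitute z - r for z.
        conv_rhs => rw [← lintegral_sub_right_eq_self _ w.1.1]
        refine lintegral_congr fun z => ?_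
        simp only [sub_add_cancel, mul_assoc]
    _ = _ := by
        have hPG : Measurable fun w : (ℝ × S) × A => π (h + 1) (w.1.2, q.1.2 + w.1.1) w.2 *
          ∫⁻ z, g ((w.1.2, q.1.2 + w.1.1), w.2) z * ψ (z + w.1.1) := hP.mul hG'
        rw [lintegral_prod _ hPG.aemeasurable,
          lintegral_prod _ hPG.lintegral_prod_right'.aemeasurable]
        refine lintegral_congr fun r => lintegral_congr fun s' => ?_
        rw [hπ.lintegral_withDensity]
        exact hG'.comp (measurable_prodMk_left (x := (r, s')))

lemma isCondDensity_bellman (hπ : IsCondDensity α (π (h + 1))) (hg : IsCondDensity volume g) :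
    IsCondDensity volume (M.bellman α π h g) := by
  refine ⟨M.measurable_bellman hπ hg, fun q => ?_⟩
  have := M.lintegral_bellman_mul hπ hg q (ψ := fun _ => 1) measurable_const
  simp only [mul_one, hg.2] at this
  rw [this]
  have hp := fun x => hπ.isProbabilityMeasure x
  simp

end Bellman

/-! ### Simulation inequality: predicted returns against true returns -/

section Simulation

variable (M : MDP S A) {α : Measure A} [SFinite α] {H : ℕ} {π : Policy S A}
  {fLast : AugState S × A → ℝ → ℝ≥0∞} {f : Returns S A}

lemma isCondDensity_target (hπ : ∀ h < H, IsCondDensity α (π h))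
    (hf : ∀ h < H, IsCondDensity volume (f h)) (hl : IsCondDensity volume fLast) (h : ℕ) :
    IsCondDensity volume (M.target α H fLast π f h) := by
  unfold target
  split_ifs with hh
  · exact M.isCondDensity_bellman (hπ _ hh) (hf _ hh)
  · exact hl

lemma lintegral_last_mul (hl : IsCondDensity volume fLast)
    (hlast : ∀ s y a, volume.withDensity (fLast ((s, y), a)) = M.reward (H - 1) (s, a))
    (q : AugState S × A) {ψ : ℝ → ℝ≥0∞} (hψ : Measurable ψ) :
    ∫⁻ z, fLast q z * ψ z = ∫⁻ r, ψ r ∂(M.reward (H - 1) (q.1.1, q.2)) := by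
  rw [← hlast q.1.1 q.1.2 q.2, hl.lintegral_withDensity _ hψ]

/-- The one-sided total variation error of `f` at step `h` against its Bellman target. -/
noncomputable def bellmanErr (M : MDP S A) (α : Measure A) (H : ℕ)
    (fLast : AugState S × A → ℝ → ℝ≥0∞) (π : Policy S A) (f : Returns S A) (h : ℕ)
    (q : AugState S × A) : ℝ≥0∞ :=
  ∫⁻ z, (f h q z - M.target α H fLast π f h q z)

lemma measurable_bellmanErr (hπ : ∀ h < H, IsCondDensity α (π h))
    (hf : ∀ h < H, IsCondDensity volume (f h)) (hl : IsCondDensity volume fLast) {h : ℕ}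
    (hh : h < H) : Measurable (M.bellmanErr α H fLast π f h) :=
  Measurable.lintegral_prod_right' (f := fun w : (AugState S × A) × ℝ =>
    f h w.1 w.2 - M.target α H fLast π f h w.1 w.2)
    ((hf h hh).1.sub (M.isCondDensity_target hπ hf hl h).1)

lemma measurable_sum_traj {n : ℕ} {D : ℕ → AugState S × A → ℝ≥0∞} {h : ℕ}
    (hD : ∀ j : Fin n, Measurable (D (h + j))) :
    Measurable fun τ : Traj S A n => ∑ j : Fin n, D (h + j) ((τ j).1, (τ j).2.1) :=
  Finset.measurable_fun_sum _ fun j _ => (hD j).comp (by fun_prop)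

lemma measurable_return (n : ℕ) : Measurable fun τ : Traj S A n => ∑ j, (τ j).2.2 := by
  fun_prop

/-- Simulation inequality for rollouts. -/
lemma lintegral_pred_le (hπ : ∀ h < H, IsCondDensity α (π h))
    (hf : ∀ h < H, IsCondDensity volume (f h)) (hl : IsCondDensity volume fLast)
    (hlast : ∀ s y a, volume.withDensity (fLast ((s, y), a)) = M.reward (H - 1) (s, a))
    (n : ℕ) : ∀ h, h + (n + 1) = H → ∀ (x : AugState S) {ψ : ℝ → ℝ≥0∞}, Measurable ψ →
      (∀ z, ψ z ≤ 1) →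
      ∫⁻ a, ∫⁻ z, f h (x, a) z * ψ z ∂volume ∂(α.withDensity (π h x)) ≤
        ∫⁻ τ, (ψ (∑ j, (τ j).2.2) + ∑ j : Fin (n + 1), M.bellmanErr α H fLast π f (h + j)
          ((τ j).1, (τ j).2.1)) ∂(M.rollout α π (n + 1) h x) := by
  induction n with
  | zero =>
    intro h hn x ψ hψ hψ1
    have hh : h < H := by omega
    have hD : ∀ j : Fin 1, Measurable (M.bellmanErr α H fLast π f (h + j)) := fun j =>
      M.measurable_bellmanErr hπ hf hl (by omega)
    have hF : Measurable fun τ : Traj S A 1 => ψ (∑ j, (τ j).2.2) +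
        ∑ j : Fin 1, M.bellmanErr α H fLast π f (h + j) ((τ j).1, (τ j).2.1) :=
      (hψ.comp (measurable_return _)).add (measurable_sum_traj hD)
    rw [M.lintegral_rollout_succ hπ hn.le x hF]
    refine lintegral_mono fun a => ?_
    have hp := fun y => M.isProbabilityMeasure_rollout hπ (n := 0) (h := h + 1) (by omega) y
    simp only [Fin.sum_univ_succ, Fin.cons_zero, Finset.univ_eq_empty, Finset.sum_empty, add_zero,
      lintegral_const, measure_univ, mul_one, Fin.val_zero]
    rw [lintegral_add_right _ measurable_const, lintegral_const, measure_univ, mul_one]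
    have hT := M.isCondDensity_target hπ hf hl h
    -- At the last step the target is the law of the last reward, so replacing f by it costs one
    -- Bellman error and leaves the true return.
    refine (lintegral_mul_le_add_tsub ((hf h hh).measurable_apply (x, a))
      (hT.measurable_apply (x, a)) hψ1).trans (add_le_add_left (le_of_eq ?_) _)
    have : M.target α H fLast π f h = fLast := by
      unfold target; rw [if_neg (by omega)]
    rw [this, M.lintegral_last_mul hl hlast _ hψ, show H - 1 = h by omega]
  | succ n ih =>
    intro h hn x ψ hψ hψ1
    have hh : h < H := by omega
    have hD : ∀ j : Fin (n + 2), Measurable (M.bellmanErr α H fLast π f (h + j)) := fun j =>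
      M.measurable_bellmanErr hπ hf hl (by omega)
    have hF : Measurable fun τ : Traj S A (n + 2) => ψ (∑ j, (τ j).2.2) +
        ∑ j : Fin (n + 2), M.bellmanErr α H fLast π f (h + j) ((τ j).1, (τ j).2.1) :=
      (hψ.comp (measurable_return _)).add (measurable_sum_traj hD)
    rw [M.lintegral_rollout_succ hπ hn.le x hF]
    refine lintegral_mono fun a => ?_
    have hp := fun y => M.isProbabilityMeasure_rollout hπ (n := n + 1) (h := h + 1) (by omega) y
    have hT := M.isCondDensity_target hπ hf hl h
    -- Replacing f by its Bellman target costs the error at step h. The target then unrolls into f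
    -- at step h + 1 with test function ψ(· + r), to which the induction hypothesis applies.
    refine (lintegral_mul_le_add_tsub ((hf h hh).measurable_apply (x, a))
      (hT.measurable_apply (x, a)) hψ1).trans ?_
    have hE : ∀ r s', ∫⁻ τ, (ψ (∑ j, ((Fin.cons (α := fun _ => AugState S × A × ℝ)
          (x, a, r) τ : Traj S A (n + 2)) j).2.2) + ∑ j : Fin (n + 2),
          M.bellmanErr α H fLast π f (h + j) (((Fin.cons (α := fun _ => AugState S × A × ℝ)
            (x, a, r) τ : Traj S A (n + 2)) j).1, ((Fin.cons (α := fun _ => AugState S × A × ℝ)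
            (x, a, r) τ : Traj S A (n + 2)) j).2.1))
        ∂(M.rollout α π (n + 1) (h + 1) (s', x.2 + r)) =
        ∫⁻ τ, (ψ (∑ j, (τ j).2.2 + r) + ∑ j : Fin (n + 1),
          M.bellmanErr α H fLast π f (h + 1 + j) ((τ j).1, (τ j).2.1))
          ∂(M.rollout α π (n + 1) (h + 1) (s', x.2 + r)) + M.bellmanErr α H fLast π f h (x, a) := by
      intro r s'
      conv_rhs => rw [← mul_one (M.bellmanErr α H fLast π f h (x, a)),
        ← measure_univ (μ := M.rollout α π (n + 1) (h + 1) (s', x.2 + r)), ← lintegral_const,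
        ← lintegral_add_right _ measurable_const]
      refine lintegral_congr fun τ => ?_
      have e1 : ∑ j, ((Fin.cons (α := fun _ => AugState S × A × ℝ)
          (x, a, r) τ : Traj S A (n + 2)) j).2.2 = r + ∑ j, (τ j).2.2 := by
        rw [Fin.sum_univ_succ]; rfl
      have e2 : ∑ j : Fin (n + 2),
          M.bellmanErr α H fLast π f (h + j) (((Fin.cons (α := fun _ => AugState S × A × ℝ)
            (x, a, r) τ : Traj S A (n + 2)) j).1, ((Fin.cons (α := fun _ => AugState S × A × ℝ)
            (x, a, r) τ : Traj S A (n + 2)) j).2.1) = M.bellmanErr α H fLast π f h (x, a) +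
          ∑ j : Fin (n + 1), M.bellmanErr α H fLast π f (h + 1 + j) ((τ j).1, (τ j).2.1) := by
        rw [Fin.sum_univ_succ]
        congr 1
        refine Finset.sum_congr rfl fun j _ => ?_
        rw [Fin.val_succ, show h + ((j : ℕ) + 1) = h + 1 + j by omega]
        rfl
      rw [e1, e2, add_comm r]
      ring
    simp_rw [hE]
    have hE2 : ∀ G : ℝ → S → ℝ≥0∞, ∀ c : ℝ≥0∞,
        ∫⁻ r, ∫⁻ s', (G r s' + c) ∂(M.trans h (x.1, a)) ∂(M.reward h (x.1, a)) =
        ∫⁻ r, ∫⁻ s', G r s' ∂(M.trans h (x.1, a)) ∂(M.reward h (x.1, a)) + c := by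
      intro G c
      simp_rw [lintegral_add_right _ measurable_const, lintegral_const, measure_univ, mul_one]
    rw [hE2]
    refine add_le_add_left ?_ _
    have : M.target α H fLast π f h = M.bellman α π h (f (h + 1)) := by
      unfold target; rw [if_pos (by omega)]
    rw [this, M.lintegral_bellman_mul (hπ _ (by omega)) (hf _ (by omega)) _ hψ]
    refine lintegral_mono fun r => lintegral_mono fun s' => ?_
    exact ih (h + 1) (by omega) (s', x.2 + r) (ψ := fun z => ψ (z + r))
      (hψ.comp (by fun_prop)) fun z => hψ1 _

end Simulation
end MDP
end RSDisRL

namespace RSDisRL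

variable {S A : Type*} [MeasurableSpace S] [MeasurableSpace A]

namespace MDP

/-! ### Whole episodes: predicted and true laws of the cumulative reward -/

section Episode

variable (M : MDP S A) {α : Measure A} {H : ℕ} {π : Policy S A}
  {fLast : AugState S × A → ℝ → ℝ≥0∞} {f : Returns S A}

lemma measurable_stateAction (h : Fin H) :
    Measurable fun τ : Traj S A H => ((τ h).1, (τ h).2.1) := by fun_prop

lemma lintegral_visit (h : Fin H) {G : AugState S × A → ℝ≥0∞} (hG : Measurable G) :
    ∫⁻ q, G q ∂(M.visit α H π h) = ∫⁻ τ, G ((τ h).1, (τ h).2.1) ∂(M.trajLaw α H π) :=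
  lintegral_map hG (measurable_stateAction h)

variable [SFinite α]

lemma lintegral_trajLaw (hπ : ∀ h < H, IsCondDensity α (π h)) {F : Traj S A H → ℝ≥0∞}
    (hF : Measurable F) :
    ∫⁻ τ, F τ ∂(M.trajLaw α H π) = ∫⁻ s, ∫⁻ τ, F τ ∂(M.rollout α π H 0 (s, 0)) ∂M.init := by
  have hm : Measurable fun s : S => M.rollout α π H 0 (s, 0) :=
    (M.measurable_rollout hπ (n := H) (h := 0) (by omega)).comp (by fun_prop)
  unfold trajLaw
  rw [Measure.lintegral_bind hm.aemeasurable hF.aemeasurable]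

lemma isProbabilityMeasure_trajLaw (hπ : ∀ h < H, IsCondDensity α (π h)) :
    IsProbabilityMeasure (M.trajLaw α H π) := by
  have hp := fun x => M.isProbabilityMeasure_rollout hπ (n := H) (h := 0) (by omega) x
  constructor
  rw [← lintegral_one, M.lintegral_trajLaw hπ measurable_const]
  simp

lemma isProbabilityMeasure_visit (hπ : ∀ h < H, IsCondDensity α (π h)) (h : Fin H) :
    IsProbabilityMeasure (M.visit α H π h) :=
  have := M.isProbabilityMeasure_trajLaw hπ
  Measure.isProbabilityMeasure_map (measurable_stateAction h).aemeasurable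

lemma lintegral_predLaw (hH : 0 < H) (hπ : ∀ h < H, IsCondDensity α (π h))
    (hf : ∀ h < H, IsCondDensity volume (f h)) {ψ : ℝ → ℝ≥0∞} (hψ : Measurable ψ) :
    ∫⁻ z, ψ z ∂(M.predLaw α π f) = ∫⁻ s, ∫⁻ a, ∫⁻ z, f 0 ((s, 0), a) z * ψ z ∂volume
      ∂(α.withDensity (π 0 (s, 0))) ∂M.init := by
  have m2 : Measurable fun w : S × A => volume.withDensity (f 0 ((w.1, (0 : ℝ)), w.2)) :=
    (hf 0 hH).measurable_withDensity.comp (by fun_prop)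
  have m1 : Measurable fun s : S => (α.withDensity (π 0 (s, 0))).bind fun a =>
      volume.withDensity (f 0 ((s, 0), a)) :=
    measurable_bind_param (m := fun s : S => α.withDensity (π 0 (s, 0)))
      ((hπ 0 hH).measurable_withDensity.comp (by fun_prop))
      (fun s => (hπ 0 hH).isProbabilityMeasure _) m2
  unfold predLaw
  rw [Measure.lintegral_bind m1.aemeasurable hψ.aemeasurable]
  refine lintegral_congr fun s => ?_
  have m3 : Measurable fun a => volume.withDensity (f 0 ((s, (0 : ℝ)), a)) :=
    m2.comp (f := fun a => (s, a)) (by fun_prop)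
  rw [Measure.lintegral_bind m3.aemeasurable hψ.aemeasurable]
  exact lintegral_congr fun a => (hf 0 hH).lintegral_withDensity _ hψ

lemma isProbabilityMeasure_predLaw (hH : 0 < H) (hπ : ∀ h < H, IsCondDensity α (π h))
    (hf : ∀ h < H, IsCondDensity volume (f h)) : IsProbabilityMeasure (M.predLaw α π f) := by
  have hp := fun x => (hπ 0 hH).isProbabilityMeasure x
  constructor
  rw [← lintegral_one, M.lintegral_predLaw hH hπ hf measurable_const]
  simp [(hf 0 hH).2]

lemma isProbabilityMeasure_totalLaw (hπ : ∀ h < H, IsCondDensity α (π h)) :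
    IsProbabilityMeasure (M.totalLaw α H π) :=
  have := M.isProbabilityMeasure_trajLaw hπ
  Measure.isProbabilityMeasure_map (measurable_return H).aemeasurable

/-- Simulation lemma: the predicted law of the cumulative reward exceeds the true one by at most the
sum of the expected Bellman errors. -/
lemma predLaw_le (hH : 0 < H) (hπ : ∀ h < H, IsCondDensity α (π h))
    (hf : ∀ h < H, IsCondDensity volume (f h)) (hl : IsCondDensity volume fLast)
    (hlast : ∀ s y a, volume.withDensity (fLast ((s, y), a)) = M.reward (H - 1) (s, a))
    {B : Set ℝ} (hB : MeasurableSet B) :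
    M.predLaw α π f B ≤ M.totalLaw α H π B +
      ∑ h : Fin H, ∫⁻ q, M.bellmanErr α H fLast π f h q ∂(M.visit α H π h) := by
  obtain ⟨n, rfl⟩ : ∃ n, H = n + 1 := ⟨H - 1, by omega⟩
  have hψ : Measurable (B.indicator (1 : ℝ → ℝ≥0∞)) := measurable_one.indicator hB
  have hE : ∀ h : Fin (n + 1), Measurable (M.bellmanErr α (n + 1) fLast π f h) := fun h =>
    M.measurable_bellmanErr hπ hf hl h.2
  have hEs : ∀ h : Fin (n + 1), Measurable fun τ : Traj S A (n + 1) =>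
      M.bellmanErr α (n + 1) fLast π f h ((τ h).1, (τ h).2.1) := fun h =>
    (hE h).comp (measurable_stateAction h)
  have hψs : Measurable fun τ : Traj S A (n + 1) =>
      B.indicator (1 : ℝ → ℝ≥0∞) (∑ j, (τ j).2.2) := hψ.comp (measurable_return _)
  have hsum : Measurable fun τ : Traj S A (n + 1) => B.indicator (1 : ℝ → ℝ≥0∞) (∑ j, (τ j).2.2) +
      ∑ h : Fin (n + 1), M.bellmanErr α (n + 1) fLast π f h ((τ h).1, (τ h).2.1) :=
    hψs.add (Finset.measurable_fun_sum _ fun h _ => hEs h)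
  simp_rw [fun h => M.lintegral_visit (α := α) (π := π) h (hE h)]
  rw [← lintegral_finsetSum _ (fun h _ => hEs h), ← lintegral_indicator_one hB,
    ← lintegral_indicator_one hB, M.lintegral_predLaw hH hπ hf hψ, totalLaw,
    lintegral_map hψ (measurable_return _), ← lintegral_add_left hψs,
    M.lintegral_trajLaw hπ hsum]
  refine lintegral_mono fun s => ?_
  refine (M.lintegral_pred_le hπ hf hl hlast n 0 (by omega) (s, 0) hψ fun z => ?_).trans
    (le_of_eq ?_)
  · exact Set.indicator_le' (s := B) (fun _ _ => le_rfl) (fun _ _ => zero_le) z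
  · simp only [zero_add]

/-- `predLaw_le` bounds the excess in one direction only. Applied to a half-line and to its
complement, it bounds the absolute difference. -/
lemma cdfDist_le (hH : 0 < H) (hπ : ∀ h < H, IsCondDensity α (π h))
    (hf : ∀ h < H, IsCondDensity volume (f h)) (hl : IsCondDensity volume fLast)
    (hlast : ∀ s y a, volume.withDensity (fLast ((s, y), a)) = M.reward (H - 1) (s, a)) :
    cdfDist (M.predLaw α π f) (M.totalLaw α H π) ≤
      ∑ h : Fin H, (∫⁻ q, M.bellmanErr α H fLast π f h q ∂(M.visit α H π h)).toReal := by
  have := M.isProbabilityMeasure_predLaw hH hπ hf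
  have := M.isProbabilityMeasure_totalLaw hπ
  have hfin : ∀ h : Fin H, ∫⁻ q, M.bellmanErr α H fLast π f h q ∂(M.visit α H π h) ≠ ⊤ := by
    intro h
    have := M.isProbabilityMeasure_visit hπ h
    refine ne_top_of_le_ne_top ENNReal.one_ne_top ?_
    calc _ ≤ ∫⁻ _, 1 ∂(M.visit α H π h) :=
          lintegral_mono fun q => lintegral_tsub_le_one ((hf h h.2).2 q)
      _ = 1 := by simp
  have key : ∀ B : Set ℝ, MeasurableSet B → (M.predLaw α π f).real B ≤ (M.totalLaw α H π).real B +
      ∑ h : Fin H, (∫⁻ q, M.bellmanErr α H fLast π f h q ∂(M.visit α H π h)).toReal := by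
    intro B hB
    rw [← ENNReal.toReal_sum fun h _ => hfin h, Measure.real, Measure.real,
      ← ENNReal.toReal_add (measure_ne_top _ _) (ENNReal.sum_ne_top.2 fun h _ => hfin h)]
    exact ENNReal.toReal_mono (ENNReal.add_ne_top.2 ⟨measure_ne_top _ _,
      ENNReal.sum_ne_top.2 fun h _ => hfin h⟩) (M.predLaw_le hH hπ hf hl hlast hB)
  refine ciSup_le fun x => abs_le.2 ⟨?_, ?_⟩
  · have h1 := key _ (measurableSet_Iic (a := x)).compl
    rw [probReal_compl_eq_one_sub measurableSet_Iic, probReal_compl_eq_one_sub measurableSet_Iic]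
      at h1
    linarith
  · have h1 := key _ (measurableSet_Iic (a := x))
    linarith

/-- A tuple without Bellman errors consists of densities of the true return laws. -/
lemma withDensity_eq_returnLaw (hπ : ∀ h < H, IsCondDensity α (π h))
    (hf : ∀ h < H, IsCondDensity volume (f h)) (hl : IsCondDensity volume fLast)
    (hlast : ∀ s y a, volume.withDensity (fLast ((s, y), a)) = M.reward (H - 1) (s, a))
    (hfix : ∀ h < H, f h = M.target α H fLast π f h) {h : ℕ} (hh : h < H) (x : AugState S) (a : A) :
    volume.withDensity (f h (x, a)) = M.returnLaw α H π h x a := by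
  have herr : ∀ h < H, ∀ q, M.bellmanErr α H fLast π f h q = 0 := by
    intro h hh q
    unfold bellmanErr
    rw [← hfix h hh]
    simp
  set κ : AugState S × A → ℝ → S → Measure ℝ := fun q r s' =>
    (M.rollout α π (H - h - 1) (h + 1) (s', q.1.2 + r)).map fun τ => r + ∑ j, (τ j).2.2 with hκ
  have mR := M.measurable_rollout hπ (n := H - h - 1) (h := h + 1) (by omega)
  have pR := fun x => M.isProbabilityMeasure_rollout hπ (n := H - h - 1) (h := h + 1) (by omega) x
  have mκ : Measurable fun w : ((AugState S × A) × ℝ) × S => κ w.1.1 w.1.2 w.2 :=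
    measurable_map_param (m := fun w : ((AugState S × A) × ℝ) × S =>
      M.rollout α π (H - h - 1) (h + 1) (w.2, w.1.1.1.2 + w.1.2)) (mR.comp (by fun_prop))
      (fun _ => pR _) (by fun_prop)
  have hret : M.returnLaw α H π h x a = M.next h κ (x, a) := rfl
  have pκ : ∀ q r s', IsProbabilityMeasure (κ q r s') := fun q r s' =>
    have := pR (s', q.1.2 + r)
    Measure.isProbabilityMeasure_map (Measurable.aemeasurable (by fun_prop))
  have := M.isProbabilityMeasure_next h (κ := κ) mκ pκ (x, a)
  have := (hf h hh).isProbabilityMeasure (x, a)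
  rw [hret]
  -- Without Bellman errors the simulation inequality is an inequality of measures. Both are
  -- probability measures, so they coincide.
  refine Measure.eq_of_le_of_measure_univ_eq (Measure.le_iff.2 fun B hB => ?_) (by simp)
  have hψ : Measurable (B.indicator (1 : ℝ → ℝ≥0∞)) := measurable_one.indicator hB
  rw [← lintegral_indicator_one hB, ← lintegral_indicator_one hB,
    M.lintegral_next h (κ := κ) mκ _ hψ, (hf h hh).lintegral_withDensity _ hψ, hfix h hh]
  rcases Nat.lt_or_ge (h + 1) H with hlt | hge
  · have hT : M.target α H fLast π f h = M.bellman α π h (f (h + 1)) := if_pos hlt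
    rw [hT, M.lintegral_bellman_mul (hπ _ hlt) (hf _ hlt) _ hψ]
    refine lintegral_mono fun r => lintegral_mono fun s' => ?_
    rw [hκ]
    dsimp only
    rw [lintegral_map hψ (by fun_prop)]
    obtain ⟨n, hn⟩ : ∃ n, H - h - 1 = n + 1 := ⟨H - h - 2, by omega⟩
    rw [hn]
    refine (M.lintegral_pred_le hπ hf hl hlast n (h + 1) (by omega) (s', x.2 + r)
      (ψ := fun z => B.indicator (1 : ℝ → ℝ≥0∞) (z + r)) (hψ.comp (by fun_prop))
      fun z => ?_).trans (lintegral_mono fun τ => ?_)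
    · exact Set.indicator_le' (s := B) (fun _ _ => le_rfl) (fun _ _ => zero_le) _
    · rw [Finset.sum_eq_zero fun j _ => herr _ (by omega) _, add_zero, add_comm r]
  · have hT : M.target α H fLast π f h = fLast := if_neg (by omega)
    rw [hT, M.lintegral_last_mul hl hlast _ hψ, show H - 1 = h by omega]
    refine le_of_eq (lintegral_congr fun r => ?_)
    rw [hκ]
    dsimp only
    simp_rw [fun s' => lintegral_map (μ := M.rollout α π (H - h - 1) (h + 1) (s', x.2 + r))
      (g := fun τ => r + ∑ j, (τ j).2.2) hψ (by fun_prop)]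
    -- After the last step the rollout is empty and the return is just r.
    obtain ⟨m, hm, hm0⟩ : ∃ m, H - h - 1 = m ∧ m = 0 := ⟨_, rfl, by omega⟩
    rw [hm] at pR ⊢
    subst hm0
    simp

end Episode
end MDP

/-! ### Conditional density of the one-step-back samples -/

section Data

variable {α : Measure A} {H : ℕ} {F : ℕ → Set (AugState S × A → ℝ → ℝ≥0∞)}
  {Pol : Set (Policy S A)} {ε : ℝ} {nF nP : ℕ}
  {BF : BracketCover H volume (prodClass H F) ε nF} {BP : BracketCover H α Pol ε nP}
  {p : Fin nF} {q : Fin nP}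

lemma isProbabilityMeasure_drawLaw (hp : ∀ h < H, IsCondDensity volume (BF.normLower p h))
    (hq : ∀ h < H, IsCondDensity α (BP.normLower q h)) (h : Fin H) (τ : Traj S A H) :
    IsProbabilityMeasure (drawLaw BF BP h p q τ) := by
  unfold drawLaw
  split_ifs with hh
  · have := (hq _ hh).isProbabilityMeasure (τ ⟨h + 1, hh⟩).1
    exact isProbabilityMeasure_bind_param
      ((hp _ hh).measurable_withDensity.comp (by fun_prop))
      fun a => (hp _ hh).isProbabilityMeasure _
  · infer_instance

variable [SFinite α]

lemma measurable_drawLaw (hp : ∀ h < H, IsCondDensity volume (BF.normLower p h))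
    (hq : ∀ h < H, IsCondDensity α (BP.normLower q h)) (h : Fin H) :
    Measurable (drawLaw BF BP h p q) := by
  unfold drawLaw
  split_ifs with hh
  · exact measurable_bind_param
      (m := fun τ : Traj S A H => α.withDensity (BP.normLower q (h + 1) (τ ⟨h + 1, hh⟩).1))
      ((hq _ hh).measurable_withDensity.comp (by fun_prop))
      (fun τ => (hq _ hh).isProbabilityMeasure _)
      ((hp _ hh).measurable_withDensity.comp
        (f := fun w : Traj S A H × A => ((w.1 ⟨h + 1, hh⟩).1, w.2)) (by fun_prop))
  · exact measurable_const

/-- The one-step-back samples have the Bellman target of the normalized lower brackets as their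
conditional density. -/
lemma lintegral_sample (M : MDP S A) {π : Policy S A} {fLast : AugState S × A → ℝ → ℝ≥0∞}
    (hπ : ∀ h < H, IsCondDensity α (π h)) (hl : IsCondDensity volume fLast)
    (hlast : ∀ s y a, volume.withDensity (fLast ((s, y), a)) = M.reward (H - 1) (s, a))
    (hp : ∀ h < H, IsCondDensity volume (BF.normLower p h))
    (hq : ∀ h < H, IsCondDensity α (BP.normLower q h)) (h : Fin H)
    {φ : AugState S × A → ℝ → ℝ≥0∞} (hφ : Measurable (Function.uncurry φ)) :
    ∫⁻ τ, ∫⁻ w, φ ((τ h).1, (τ h).2.1) (w + (τ h).2.2) ∂(drawLaw BF BP h p q τ)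
        ∂(M.trajLaw α H π) =
      ∫⁻ x, ∫⁻ z, M.target α H fLast (BP.normLower q) (BF.normLower p) h x z * φ x z ∂volume
        ∂(M.visit α H π h) := by
  have hg := M.isCondDensity_target hq hp hl h
  have hφx : ∀ x, Measurable (φ x) := fun x => hφ.comp (measurable_prodMk_left (x := x))
  have hφs : ∀ τ : Traj S A H, Measurable fun w => φ ((τ h).1, (τ h).2.1) (w + (τ h).2.2) :=
    fun τ => (hφx _).comp (by fun_prop)
  have hR : Measurable fun x => ∫⁻ z, M.target α H fLast (BP.normLower q) (BF.normLower p) h x z *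
      φ x z :=
    Measurable.lintegral_prod_right' (f := fun w : (AugState S × A) × ℝ =>
      M.target α H fLast (BP.normLower q) (BF.normLower p) h w.1 w.2 * φ w.1 w.2) (hg.1.mul hφ)
  have hL : Measurable fun τ : Traj S A H =>
      ∫⁻ w, φ ((τ h).1, (τ h).2.1) (w + (τ h).2.2) ∂(drawLaw BF BP h p q τ) :=
    measurable_lintegral_param (measurable_drawLaw hp hq h) (isProbabilityMeasure_drawLaw hp hq h)
      (f := fun τ w => φ ((τ h).1, (τ h).2.1) (w + (τ h).2.2))
      (hφ.comp (f := fun v : Traj S A H × ℝ =>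
        (((v.1 h).1, (v.1 h).2.1), v.2 + (v.1 h).2.2)) (by fun_prop))
  have hRs : Measurable fun τ : Traj S A H =>
      ∫⁻ z, M.target α H fLast (BP.normLower q) (BF.normLower p) h ((τ h).1, (τ h).2.1) z *
        φ ((τ h).1, (τ h).2.1) z := hR.comp (MDP.measurable_stateAction h)
  rw [M.lintegral_visit h hR, M.lintegral_trajLaw hπ hL, M.lintegral_trajLaw hπ hRs]
  refine lintegral_congr fun s => ?_
  rcases Nat.lt_or_ge (h + 1) H with hlt | hge
  · set G : AugState S × A → ℝ → AugState S → ℝ≥0∞ := fun x r x' =>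
      ∫⁻ a', ∫⁻ z, BF.normLower p (h + 1) (x', a') z * φ x (z + r) ∂volume
        ∂(α.withDensity (BP.normLower q (h + 1) x')) with hG
    have mG : Measurable fun w : ((AugState S × A) × ℝ) × AugState S => G w.1.1 w.1.2 w.2 := by
      refine measurable_lintegral_param
        (m := fun w : ((AugState S × A) × ℝ) × AugState S =>
          α.withDensity (BP.normLower q (h + 1) w.2))
        ((hq _ hlt).measurable_withDensity.comp measurable_snd)
        (fun w => (hq _ hlt).isProbabilityMeasure _) ?_
      exact Measurable.lintegral_prod_right'
        (f := fun w : ((((AugState S × A) × ℝ) × AugState S) × A) × ℝ =>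
          BF.normLower p (h + 1) (w.1.1.2, w.1.2) w.2 * φ w.1.1.1.1 (w.2 + w.1.1.1.2))
        (((hp _ hlt).1.comp (f := fun w : ((((AugState S × A) × ℝ) × AugState S) × A) × ℝ =>
          ((w.1.1.2, w.1.2), w.2)) (by fun_prop)).mul
          (hφ.comp (f := fun w : ((((AugState S × A) × ℝ) × AugState S) × A) × ℝ =>
          (w.1.1.1.1, w.2 + w.1.1.1.2)) (by fun_prop)))
    have hdraw : ∀ τ : Traj S A H,
        ∫⁻ w, φ ((τ h).1, (τ h).2.1) (w + (τ h).2.2) ∂(drawLaw BF BP h p q τ) =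
        G ((τ h).1, (τ h).2.1) (τ h).2.2 (τ ⟨h + 1, hlt⟩).1 := by
      intro τ
      have m2 : Measurable fun a' =>
          volume.withDensity (BF.normLower p (h + 1) ((τ ⟨h + 1, hlt⟩).1, a')) :=
        (hp _ hlt).measurable_withDensity.comp (by fun_prop)
      unfold drawLaw
      rw [dif_pos hlt, Measure.lintegral_bind m2.aemeasurable (hφs τ).aemeasurable]
      exact lintegral_congr fun a' => (hp _ hlt).lintegral_withDensity _ (hφs τ)
    simp_rw [hdraw]
    -- By the Markov property, reward and next state are fresh draws from the kernels; whatever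
    -- policy was executed, it enters only through the state and action at step h. Draw plus reward
    -- then has the law described by `lintegral_bellman_mul`.
    have hM := M.lintegral_rollout_trans hπ (n := H) (h := 0) (by omega) (s, 0) h h.2 hlt mG
    refine hM.trans (lintegral_congr fun τ => ?_)
    have hT : M.target α H fLast (BP.normLower q) (BF.normLower p) h =
        M.bellman α (BP.normLower q) h (BF.normLower p (h + 1)) := if_pos hlt
    rw [hT, M.lintegral_bellman_mul (hq _ hlt) (hp _ hlt) _ (hφx _), zero_add]
  · have hT : M.target α H fLast (BP.normLower q) (BF.normLower p) h = fLast :=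
      if_neg (by omega)
    have hdraw : ∀ τ : Traj S A H,
        ∫⁻ w, φ ((τ h).1, (τ h).2.1) (w + (τ h).2.2) ∂(drawLaw BF BP h p q τ) =
        φ ((τ h).1, (τ h).2.1) (τ h).2.2 := by
      intro τ
      unfold drawLaw
      rw [dif_neg (by omega), lintegral_dirac' _ (hφs τ), zero_add]
    simp_rw [hdraw]
    have hM := M.lintegral_rollout_reward hπ (n := H) (h := 0) (by omega) (s, 0) h h.2 hφ
    refine hM.trans (lintegral_congr fun τ => ?_)
    rw [hT, M.lintegral_last_mul hl hlast _ (hφx _), zero_add, show H - 1 = (h : ℕ) by omega]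

end Data
end RSDisRL

namespace RSDisRL

/-! ## Brackets -/

namespace BracketCover

variable {X Y : Type*} [MeasurableSpace X] [MeasurableSpace Y] {H : ℕ} {ν : Measure Y}
  {G : Set (ℕ → X → Y → ℝ≥0∞)} {ε : ℝ} {n : ℕ} (B : BracketCover H ν G ε n)

lemma measurable_lower_apply (j : Fin n) {h : ℕ} (hh : h < H) (x : X) :
    Measurable (B.lower j h x) :=
  (B.measurable_lower j h hh).comp measurable_prodMk_left

lemma measurable_upper_apply (j : Fin n) {h : ℕ} (hh : h < H) (x : X) :
    Measurable (B.upper j h x) :=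
  (B.measurable_upper j h hh).comp measurable_prodMk_left

lemma lintegral_upper_tsub_le (g : G) {h : ℕ}
    (hh : h < H) (x : X) :
    ∫⁻ y, (B.upper (B.index g) h x y - g.1 h x y) ∂ν ≤ ENNReal.ofReal ε :=
  (lintegral_mono fun y => tsub_le_tsub_left (B.lower_le g h hh x y) _).trans
    (B.width_le (B.index g) h hh x)

lemma lintegral_upper_le (hε : 0 < ε) (hG : ∀ g ∈ G, ∀ h < H, IsCondDensity ν (g h)) (g : G)
    {h : ℕ} (hh : h < H) (x : X) :
    ∫⁻ y, B.upper (B.index g) h x y ∂ν ≤ ENNReal.ofReal (1 + ε) := by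
  have hg := (hG g g.2 h hh).measurable_apply x
  calc ∫⁻ y, B.upper (B.index g) h x y ∂ν
      ≤ ∫⁻ y, (g.1 h x y + (B.upper (B.index g) h x y - g.1 h x y)) ∂ν :=
        lintegral_mono fun y => le_add_tsub
    _ = 1 + ∫⁻ y, (B.upper (B.index g) h x y - g.1 h x y) ∂ν := by
        rw [lintegral_add_left hg, (hG g g.2 h hh).2 x]
    _ ≤ 1 + ENNReal.ofReal ε := by gcongr; exact B.lintegral_upper_tsub_le g hh x
    _ = _ := by rw [ENNReal.ofReal_add zero_le_one hε.le, ENNReal.ofReal_one]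

lemma lintegral_lower_le_one (hG : ∀ g ∈ G, ∀ h < H, IsCondDensity ν (g h)) (g : G) {h : ℕ}
    (hh : h < H) (x : X) : ∫⁻ y, B.lower (B.index g) h x y ∂ν ≤ 1 :=
  (hG g g.2 h hh).2 x ▸ lintegral_mono fun y => B.lower_le g h hh x y

lemma le_lintegral_lower (hε : 0 < ε) (hG : ∀ g ∈ G, ∀ h < H, IsCondDensity ν (g h)) (g : G)
    {h : ℕ} (hh : h < H) (x : X) :
    ENNReal.ofReal (1 - ε) ≤ ∫⁻ y, B.lower (B.index g) h x y ∂ν := by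
  rw [ENNReal.ofReal_sub _ hε.le, ENNReal.ofReal_one, tsub_le_iff_right]
  calc (1 : ℝ≥0∞) = ∫⁻ y, g.1 h x y ∂ν := ((hG g g.2 h hh).2 x).symm
    _ ≤ ∫⁻ y, (B.lower (B.index g) h x y +
          (B.upper (B.index g) h x y - B.lower (B.index g) h x y)) ∂ν :=
        lintegral_mono fun y => (B.le_upper g h hh x y).trans le_add_tsub
    _ = ∫⁻ y, B.lower (B.index g) h x y ∂ν +
          ∫⁻ y, (B.upper (B.index g) h x y - B.lower (B.index g) h x y) ∂ν :=
        lintegral_add_left (B.measurable_lower_apply _ hh x) _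
    _ ≤ _ := by gcongr; exact B.width_le _ h hh x

lemma lintegral_lower_ne_zero (hε : 0 < ε) (hε' : ε ≤ 1 / 2)
    (hG : ∀ g ∈ G, ∀ h < H, IsCondDensity ν (g h)) (g : G) {h : ℕ} (hh : h < H) (x : X) :
    ∫⁻ y, B.lower (B.index g) h x y ∂ν ≠ 0 :=
  ne_of_gt (lt_of_lt_of_le (ENNReal.ofReal_pos.2 (by linarith)) (B.le_lintegral_lower hε hG g hh x))

lemma isCondDensity_normLower [SFinite ν] (hε : 0 < ε) (hε' : ε ≤ 1 / 2)
    (hG : ∀ g ∈ G, ∀ h < H, IsCondDensity ν (g h)) (g : G) {h : ℕ} (hh : h < H) :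
    IsCondDensity ν (B.normLower (B.index g) h) := by
  have hm := B.measurable_lower (B.index g) h hh
  refine ⟨?_, fun x => ?_⟩
  · exact hm.div ((Measurable.lintegral_prod_right' hm).comp measurable_fst)
  · unfold normLower
    simp_rw [div_eq_mul_inv]
    rw [lintegral_mul_const _ (B.measurable_lower_apply _ hh x)]
    exact ENNReal.mul_inv_cancel (B.lintegral_lower_ne_zero hε hε' hG g hh x)
      (ne_top_of_le_ne_top ENNReal.one_ne_top (B.lintegral_lower_le_one hG g hh x))

/-- The lower end has mass at least 1 - ε, so normalizing it costs a factor of at most e^{2ε}. Such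
a pointwise bound is what survives multiplication along an entire data set. -/
lemma normLower_le (hε : 0 < ε) (hε' : ε ≤ 1 / 2) (hG : ∀ g ∈ G, ∀ h < H, IsCondDensity ν (g h))
    (g : G) {h : ℕ} (hh : h < H) (x : X) (y : Y) :
    B.normLower (B.index g) h x y ≤ ENNReal.ofReal (Real.exp (2 * ε)) * g.1 h x y := by
  unfold normLower
  refine ENNReal.div_le_of_le_mul ?_
  have h1 : (1 : ℝ≥0∞) ≤ ENNReal.ofReal (Real.exp (2 * ε)) *
      ∫⁻ y, B.lower (B.index g) h x y ∂ν := by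
    calc (1 : ℝ≥0∞) ≤ ENNReal.ofReal (Real.exp (2 * ε) * (1 - ε)) := by
          rw [ENNReal.one_le_ofReal]
          -- (1 + 2ε)(1 - ε) ≥ 1 because ε ≤ 1/2.
          nlinarith [Real.add_one_le_exp (2 * ε)]
      _ = ENNReal.ofReal (Real.exp (2 * ε)) * ENNReal.ofReal (1 - ε) :=
          ENNReal.ofReal_mul (Real.exp_pos _).le
      _ ≤ _ := by gcongr; exact B.le_lintegral_lower hε hG g hh x
  calc B.lower (B.index g) h x y ≤ g.1 h x y := B.lower_le g h hh x y
    _ = 1 * g.1 h x y := (one_mul _).symm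
    _ ≤ (ENNReal.ofReal (Real.exp (2 * ε)) * ∫⁻ y, B.lower (B.index g) h x y ∂ν) * g.1 h x y := by
        gcongr
    _ = _ := by ring

end BracketCover

/-! ## Well-specified problems -/

/-- The standing assumptions: classes of conditional densities, realizability at the last step,
Bellman completeness, and the range of the parameters. -/
structure WellSpecified {S A : Type*} [MeasurableSpace S] [MeasurableSpace A] (M : MDP S A)
    (α : Measure A) (H K : ℕ) (ε : ℝ) (F : ℕ → Set (AugState S × A → ℝ → ℝ≥0∞))
    (Pol : Set (Policy S A)) (fLast : AugState S × A → ℝ → ℝ≥0∞) : Prop where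
  one_le_horizon : 1 ≤ H
  two_le_episodes : 2 ≤ K
  width_pos : 0 < ε
  width_le : ε ≤ 1 / K
  density : ∀ h < H, ∀ f ∈ F h, IsCondDensity volume f
  policy : ∀ π ∈ Pol, ∀ h < H, IsCondDensity α (π h)
  last_mem : fLast ∈ F (H - 1)
  last : ∀ s y a, volume.withDensity (fLast ((s, y), a)) = M.reward (H - 1) (s, a)
  complete : ∀ h, h + 1 < H → ∀ g ∈ F (h + 1), ∀ π ∈ Pol, M.bellman α π h g ∈ F h

variable {S A : Type*} [MeasurableSpace S] [MeasurableSpace A]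

namespace WellSpecified

variable {M : MDP S A} {α : Measure A} {H K : ℕ} {ε : ℝ}
  {F : ℕ → Set (AugState S × A → ℝ → ℝ≥0∞)} {Pol : Set (Policy S A)}
  {fLast : AugState S × A → ℝ → ℝ≥0∞}

lemma density_prod (W : WellSpecified M α H K ε F Pol fLast)
    : ∀ f ∈ prodClass H F, ∀ h < H, IsCondDensity volume (f h) :=
  fun _ hf h hh => W.density h hh _ (hf h hh)

lemma density_last (W : WellSpecified M α H K ε F Pol fLast)
    : IsCondDensity volume fLast :=
  W.density _ (by have := W.one_le_horizon; omega) _ W.last_mem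

lemma width_mul_le (W : WellSpecified M α H K ε F Pol fLast)
    {k : ℕ} (hk : k ≤ K) : ε * k ≤ 1 := by
  have hK : (0 : ℝ) < K := by exact_mod_cast (by have := W.two_le_episodes; omega : 0 < K)
  have h1 := W.width_le
  rw [le_div_iff₀ hK] at h1
  have : (k : ℝ) ≤ K := by exact_mod_cast hk
  nlinarith [W.width_pos]

lemma width_le_half (W : WellSpecified M α H K ε F Pol fLast)
    : ε ≤ 1 / 2 := by
  have := W.width_mul_le W.two_le_episodes
  push_cast at this
  linarith

lemma target_mem (W : WellSpecified M α H K ε F Pol fLast)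
    {π : Policy S A} (hπ : π ∈ Pol) {f : Returns S A} (hf : f ∈ prodClass H F) {h : ℕ}
    (hh : h < H) : M.target α H fLast π f h ∈ F h := by
  unfold MDP.target
  split_ifs with h1
  · exact W.complete h h1 _ (hf _ h1) _ hπ
  · rw [show h = H - 1 by omega]; exact W.last_mem

/-- Provides the competitor for the confidence sets: the class is a product, so a single entry of f
may be exchanged for its Bellman target. -/
lemma update_target_mem (W : WellSpecified M α H K ε F Pol fLast)
    {π : Policy S A} (hπ : π ∈ Pol) {f : Returns S A} (hf : f ∈ prodClass H F)
    {h : ℕ} (hh : h < H) : Function.update f h (M.target α H fLast π f h) ∈ prodClass H F := by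
  intro h' hh'
  rcases eq_or_ne h' h with rfl | hne
  · rw [Function.update_self]; exact W.target_mem hπ hf hh
  · rw [Function.update_of_ne hne]; exact hf h' hh'

/-- Backward induction from the density of the last reward; completeness keeps each iterate in the
class. -/
lemma exists_fixedPoint (W : WellSpecified M α H K ε F Pol fLast)
    {π : Policy S A} (hπ : π ∈ Pol) :
    ∃ f ∈ prodClass H F, ∀ h < H, f h = M.target α H fLast π f h := by
  -- `v n` belongs to step H - 1 - n, counted back from the last step.
  let v : ℕ → AugState S × A → ℝ → ℝ≥0∞ := fun n =>
    Nat.rec fLast (fun n g => M.bellman α π (H - 1 - (n + 1)) g) n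
  have hv : ∀ h < H, v (H - 1 - h) = M.target α H fLast π (fun h => v (H - 1 - h)) h := by
    intro h hh
    unfold MDP.target
    split_ifs with h1
    · rw [show H - 1 - h = (H - 1 - (h + 1)) + 1 by omega]
      change M.bellman α π (H - 1 - ((H - 1 - (h + 1)) + 1)) (v (H - 1 - (h + 1))) = _
      rw [show H - 1 - ((H - 1 - (h + 1)) + 1) = h by omega]
    · rw [show H - 1 - h = 0 by omega]; rfl
  refine ⟨fun h => v (H - 1 - h), fun h hh => ?_, hv⟩
  have hmem : ∀ n < H, v n ∈ F (H - 1 - n) := by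
    intro n
    induction n with
    | zero => intro _; exact W.last_mem
    | succ n ih =>
      intro hn
      refine W.complete _ (by omega) _ ?_ _ hπ
      rw [show H - 1 - (n + 1) + 1 = H - 1 - n by omega]
      exact ih (by omega)
  have := hmem (H - 1 - h) (by omega)
  rwa [show H - 1 - (H - 1 - h) = h by omega] at this

variable {nF nP : ℕ} {BF : BracketCover H volume (prodClass H F) ε nF}
  {BP : BracketCover H α Pol ε nP}

lemma density_normLower (W : WellSpecified M α H K ε F Pol fLast)
    {p : Fin nF} (hp : p ∈ Set.range BF.index) :
    ∀ h < H, IsCondDensity volume (BF.normLower p h) := by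
  obtain ⟨f, rfl⟩ := hp
  exact fun h hh => BF.isCondDensity_normLower W.width_pos W.width_le_half W.density_prod f hh

/-- The samples are drawn from the brackets, not from f and π. Normalized lower ends exceed f and π
by a factor of at most e^{2ε} each, and the Bellman operator is monotone. The domination is
one-sided, and both likelihood arguments need no more. -/
lemma sample_le_target (W : WellSpecified M α H K ε F Pol fLast)
    (f : prodClass H F) (π : Pol) (h : ℕ) (x : AugState S × A) (z : ℝ) :
    M.target α H fLast (BP.normLower (BP.index π)) (BF.normLower (BF.index f)) h x z ≤
      ENNReal.ofReal (Real.exp (4 * ε)) * M.target α H fLast π f h x z := by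
  unfold MDP.target
  split_ifs with hh
  · refine M.bellman_le_mul ENNReal.ofReal_ne_top (fun y a z => ?_) x z
    calc _ ≤ (ENNReal.ofReal (Real.exp (2 * ε)) * π.1 (h + 1) y a) *
          (ENNReal.ofReal (Real.exp (2 * ε)) * f.1 (h + 1) (y, a) z) :=
          mul_le_mul' (BP.normLower_le W.width_pos W.width_le_half W.policy π hh y a)
            (BF.normLower_le W.width_pos W.width_le_half W.density_prod f hh (y, a) z)
      _ = (ENNReal.ofReal (Real.exp (2 * ε)) * ENNReal.ofReal (Real.exp (2 * ε))) *
          (π.1 (h + 1) y a * f.1 (h + 1) (y, a) z) := by ring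
      _ = _ := by
          rw [← ENNReal.ofReal_mul (Real.exp_pos _).le, ← Real.exp_add]
          congr 3; ring
  · calc fLast x z = 1 * fLast x z := (one_mul _).symm
      _ ≤ _ := by
        gcongr
        rw [ENNReal.one_le_ofReal]
        exact Real.one_le_exp (by linarith [W.width_pos])

variable [SFinite α]

lemma policy_normLower (W : WellSpecified M α H K ε F Pol fLast)
    {q : Fin nP} (hq : q ∈ Set.range BP.index) :
    ∀ h < H, IsCondDensity α (BP.normLower q h) := by
  obtain ⟨π, rfl⟩ := hq
  exact fun h hh => BP.isCondDensity_normLower W.width_pos W.width_le_half W.policy π hh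

lemma density_sample (W : WellSpecified M α H K ε F Pol fLast)
    {p : Fin nF} {q : Fin nP} (hp : p ∈ Set.range BF.index)
    (hq : q ∈ Set.range BP.index) (h : ℕ) :
    IsCondDensity volume (M.target α H fLast (BP.normLower q) (BF.normLower p) h) :=
  M.isCondDensity_target (W.policy_normLower hq) (W.density_normLower hp) W.density_last h

end WellSpecified
end RSDisRL

namespace RSDisRL

variable {S A : Type*} [MeasurableSpace S] [MeasurableSpace A]

/-! ### Exponential supermartingales along a run -/

namespace Run

variable {M : MDP S A} {α : Measure A} {H K : ℕ} {ε : ℝ}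
  {F : ℕ → Set (AugState S × A → ℝ → ℝ≥0∞)} {Pol : Set (Policy S A)}
  {nF nP : ℕ} {BF : BracketCover H volume (prodClass H F) ε nF}
  {BP : BracketCover H α Pol ε nP} {ρ : Measure ℝ → ℝ} {β : ℝ}
  {Ω : Type*} [mΩ : MeasurableSpace Ω] {P : Measure Ω}

/-- The augmented state and the action at step `h` of episode `k`. -/
def stateAction (run : Run M K BF BP ρ β P) (h : Fin H) (k : ℕ) (ω : Ω) : AugState S × A :=
  ((run.traj k ω h).1, (run.traj k ω h).2.1)

/-- The one-step-back sample at step `h` of episode `k`, for a pair of brackets. -/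
def sample (run : Run M K BF BP ρ β P) (h : Fin H) (p : Fin nF) (q : Fin nP) (k : ℕ) (ω : Ω) : ℝ :=
  run.draw k h p q ω + (run.traj k ω h).2.2

lemma measurable_data (run : Run M K BF BP ρ β P) {k : ℕ} (hk : k < K) (h : Fin H) (p : Fin nF)
    (q : Fin nP) : Measurable[run.info (k + 1)] fun ω =>
      (run.stateAction h k ω, run.sample h p q k ω) := by
  have h1 : Measurable[run.info (k + 1)] fun ω => run.traj k ω h :=
    (measurable_pi_apply h).comp (run.measurable_traj k hk)
  exact (h1.fst.prodMk h1.snd.fst).prodMk ((run.measurable_draw k hk h p q).add h1.snd.snd)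

lemma measurable_trajLaw (run : Run M K BF BP ρ β P) {k : ℕ} (hk : k < K) :
    Measurable[run.info k] fun ω => M.trajLaw α H (run.pol k ω) :=
  @Measure.measurable_of_measurable_coe _ _ _ (run.info k) _ fun B hB =>
    run.measurable_law k hk B hB

lemma measurable_lintegral_visit (run : Run M K BF BP ρ β P) {k : ℕ} (hk : k < K) (h : Fin H)
    {G : AugState S × A → ℝ≥0∞} (hG : Measurable G) :
    Measurable[run.info k] fun ω => ∫⁻ x, G x ∂(M.visit α H (run.pol k ω) h) := by
  have h1 : (fun ω => ∫⁻ x, G x ∂(M.visit α H (run.pol k ω) h)) = fun ω =>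
      ∫⁻ τ, G ((τ h).1, (τ h).2.1) ∂(M.trajLaw α H (run.pol k ω)) :=
    funext fun ω => M.lintegral_visit h hG
  rw [h1]
  exact (Measure.measurable_lintegral (hG.comp (MDP.measurable_stateAction h))).comp
    (run.measurable_trajLaw hk)

variable [SFinite α] {fLast : AugState S × A → ℝ → ℝ≥0∞}

/-- Given the past, the state, action and sample of an episode follow the visitation measure of the
executed policy and the Bellman target of the normalized lower brackets. -/
lemma setLIntegral_sample (W : WellSpecified M α H K ε F Pol fLast) (run : Run M K BF BP ρ β P)
    {k : ℕ} (hk : k < K) (h : Fin H) {p : Fin nF} {q : Fin nP} (hp : p ∈ Set.range BF.index)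
    (hq : q ∈ Set.range BP.index) {φ : AugState S × A → ℝ → ℝ≥0∞}
    (hφ : Measurable (Function.uncurry φ)) {E : Set Ω} (hE : MeasurableSet[run.info k] E) :
    ∫⁻ ω in E, φ (run.stateAction h k ω) (run.sample h p q k ω) ∂P =
      ∫⁻ ω in E, ∫⁻ x, ∫⁻ z, M.target α H fLast (BP.normLower q) (BF.normLower p) h x z * φ x z
        ∂volume ∂(M.visit α H (run.pol k ω) h) ∂P := by
  have hdp := W.density_normLower hp
  have hdq := W.policy_normLower hq
  have mdraw : Measurable fun τ => (drawLaw BF BP h p q τ).map (Prod.mk τ) :=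
    measurable_map_param (measurable_drawLaw hdp hdq h) (isProbabilityMeasure_drawLaw hdp hdq h)
      (g := Prod.mk) measurable_id
  set κ : Ω → Measure (Traj S A H × ℝ) := fun ω =>
    (M.trajLaw α H (run.pol k ω)).bind fun τ => (drawLaw BF BP h p q τ).map (Prod.mk τ) with hκ
  have mκ : Measurable κ := (Measure.measurable_bind' mdraw).comp
    ((run.measurable_trajLaw hk).mono (run.info.le k) le_rfl)
  have mdata : Measurable fun ω => (run.traj k ω, run.draw k h p q ω) :=
    ((run.measurable_traj k hk).prodMk (run.measurable_draw k hk h p q)).mono (run.info.le _) le_rfl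
  -- The conditional law, given on sets, becomes an identity of measures, which then integrates
  -- arbitrary test functions.
  have hlaw : (P.restrict E).map (fun ω => (run.traj k ω, run.draw k h p q ω)) =
      (P.restrict E).bind κ := by
    ext B hB
    rw [Measure.map_apply mdata hB, Measure.restrict_apply (mdata hB),
      Measure.bind_apply hB mκ.aemeasurable, ← run.cond_law k hk h p q E hE B hB, Set.inter_comm]
    rfl
  set Φ : Traj S A H × ℝ → ℝ≥0∞ := fun v =>
    φ ((v.1 h).1, (v.1 h).2.1) (v.2 + (v.1 h).2.2) with hΦ
  have mΦ : Measurable Φ :=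
    hφ.comp (f := fun v : Traj S A H × ℝ =>
      (((v.1 h).1, (v.1 h).2.1), v.2 + (v.1 h).2.2)) (by fun_prop)
  calc ∫⁻ ω in E, φ (run.stateAction h k ω) (run.sample h p q k ω) ∂P
      = ∫⁻ v, Φ v ∂((P.restrict E).map fun ω => (run.traj k ω, run.draw k h p q ω)) :=
        (lintegral_map mΦ mdata).symm
    _ = ∫⁻ ω in E, ∫⁻ v, Φ v ∂(κ ω) ∂P := by
        rw [hlaw, Measure.lintegral_bind mκ.aemeasurable mΦ.aemeasurable]
    _ = _ := by
        refine lintegral_congr fun ω => ?_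
        rw [hκ]
        dsimp only
        rw [Measure.lintegral_bind mdraw.aemeasurable mΦ.aemeasurable,
          ← lintegral_sample M (W.policy _ (run.pol k ω).2) W.density_last W.last hdp hdq h hφ]
        exact lintegral_congr fun τ => lintegral_map mΦ measurable_prodMk_left

/-- A sample almost surely avoids the points where its own density vanishes or is infinite. There
the likelihood ratios in `ℝ≥0∞` could not be multiplied back by the density. -/
lemma measure_density_eq_zero (W : WellSpecified M α H K ε F Pol fLast)
    (run : Run M K BF BP ρ β P) {k : ℕ} (hk : k < K) (h : Fin H) {p : Fin nF} {q : Fin nP}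
    (hp : p ∈ Set.range BF.index) (hq : q ∈ Set.range BP.index) :
    P {ω | M.target α H fLast (BP.normLower q) (BF.normLower p) h (run.stateAction h k ω)
        (run.sample h p q k ω) ∈ ({0, ⊤} : Set ℝ≥0∞)} = 0 := by
  have hg := W.density_sample hp hq h
  set g := M.target α H fLast (BP.normLower q) (BF.normLower p) h with hgdef
  have hD : MeasurableSet ({0, ⊤} : Set ℝ≥0∞) := (Set.toFinite _).measurableSet
  set φ : AugState S × A → ℝ → ℝ≥0∞ := fun x z => ({0, ⊤} : Set ℝ≥0∞).indicator 1 (g x z) with hφ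
  have mφ : Measurable (Function.uncurry φ) := (measurable_one.indicator hD).comp hg.1
  have h1 := run.setLIntegral_sample W hk h hp hq mφ MeasurableSet.univ
  rw [Measure.restrict_univ] at h1
  have h2 : ∀ x, ∫⁻ z, g x z * φ x z = 0 := by
    intro x
    have hfin := ae_lt_top (hg.measurable_apply x) (by rw [hg.2 x]; exact ENNReal.one_ne_top)
    refine lintegral_eq_zero_of_ae_eq_zero ?_
    filter_upwards [hfin] with z hz
    by_cases h0 : g x z = 0
    · simp [h0]
    · simp [hφ, h0, hz.ne]
  rw [← hgdef] at h1
  simp only [h2, lintegral_zero] at h1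
  have m3 : MeasurableSet {ω | g (run.stateAction h k ω) (run.sample h p q k ω) ∈
      ({0, ⊤} : Set ℝ≥0∞)} :=
    (hg.1.comp ((run.measurable_data hk h p q).mono (run.info.le _) le_rfl)) hD
  rw [← lintegral_indicator_one m3]
  exact h1

/-- Likelihood ratios of upper brackets. -/
lemma measure_ratio_le [IsProbabilityMeasure P] (W : WellSpecified M α H K ε F Pol fLast) (run : Run M K BF BP ρ β P)
    (h : Fin H) {p j : Fin nF} {q : Fin nP} (hp : p ∈ Set.range BF.index)
    (hq : q ∈ Set.range BP.index) (hj : j ∈ Set.range BF.index) {T : ℝ} (hT : 0 < T) {n : ℕ}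
    (hn : n ≤ K) :
    P {ω | ENNReal.ofReal T ≤ ∏ k ∈ Finset.range n,
      (BF.upper j h (run.stateAction h k ω) (run.sample h p q k ω) /
        M.target α H fLast (BP.normLower q) (BF.normLower p) h (run.stateAction h k ω)
          (run.sample h p q k ω) * ENNReal.ofReal (Real.exp (-ε)))} ≤ ENNReal.ofReal (1 / T) := by
  obtain ⟨f, rfl⟩ := hj
  have hg := W.density_sample hp hq h
  set g := M.target α H fLast (BP.normLower q) (BF.normLower p) h with hgdef
  set φ : AugState S × A → ℝ → ℝ≥0∞ := fun x z =>
    BF.upper (BF.index f) h x z / g x z * ENNReal.ofReal (Real.exp (-ε)) with hφ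
  have mφ : Measurable (Function.uncurry φ) :=
    ((BF.measurable_upper (BF.index f) h h.2).div hg.1).mul_const _
  refine measure_le_prod_le run.info
    (fun k ω => φ (run.stateAction h k ω) (run.sample h p q k ω)) K
    (fun k hk => mφ.comp (run.measurable_data hk h p q)) (fun k hk E hE => ?_) hT hn
  rw [run.setLIntegral_sample W hk h hp hq mφ hE, ← hgdef]
  calc _ ≤ ∫⁻ ω in E, ∫⁻ _, 1 ∂(M.visit α H (run.pol k ω) h) ∂P := by
        refine lintegral_mono fun ω => lintegral_mono fun x => ?_
        calc ∫⁻ z, g x z * φ x z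
            ≤ ∫⁻ z, BF.upper (BF.index f) h x z * ENNReal.ofReal (Real.exp (-ε)) := by
              refine lintegral_mono fun z => ?_
              rw [hφ]
              dsimp only
              rw [← mul_assoc]
              gcongr
              exact ENNReal.mul_div_le
          _ ≤ ENNReal.ofReal (1 + ε) * ENNReal.ofReal (Real.exp (-ε)) := by
              rw [lintegral_mul_const _ (BF.measurable_upper_apply _ h.2 x)]
              gcongr
              exact BF.lintegral_upper_le W.width_pos W.density_prod f h.2 x
          -- (1 + ε) e^{-ε} ≤ 1: the compensator absorbs the excess mass of the upper end.
          _ ≤ 1 := by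
              rw [← ENNReal.ofReal_mul (by linarith [W.width_pos]), ← ENNReal.ofReal_one]
              refine ENNReal.ofReal_le_ofReal ?_
              rw [Real.exp_neg, mul_inv_le_iff₀ (Real.exp_pos _), one_mul]
              linarith [Real.add_one_le_exp ε]
    _ = P E := by
        have hv := fun ω => M.isProbabilityMeasure_visit (W.policy _ (run.pol k ω).2) h
        simp

/-- The Hellinger affinity of an upper bracket and the density of the samples, averaged over the
visitation measure of the policy executed in episode `k`. -/
noncomputable def affinity (run : Run M K BF BP ρ β P) (fLast : AugState S × A → ℝ → ℝ≥0∞)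
    (h : Fin H) (p : Fin nF) (q : Fin nP) (k : ℕ) (ω : Ω) : ℝ≥0∞ :=
  ∫⁻ x, ∫⁻ z, (BF.upper p h x z *
    M.target α H fLast (BP.normLower q) (BF.normLower p) h x z) ^ ((1 : ℝ) / 2) ∂volume
    ∂(M.visit α H (run.pol k ω) h)

lemma measurable_affinity_integrand (W : WellSpecified M α H K ε F Pol fLast) (h : Fin H)
    {p : Fin nF} {q : Fin nP} (hp : p ∈ Set.range BF.index) (hq : q ∈ Set.range BP.index) :
    Measurable fun x => ∫⁻ z, (BF.upper p h x z *
      M.target α H fLast (BP.normLower q) (BF.normLower p) h x z) ^ ((1 : ℝ) / 2) :=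
  Measurable.lintegral_prod_right' (f := fun w : (AugState S × A) × ℝ => (BF.upper p h w.1 w.2 *
      M.target α H fLast (BP.normLower q) (BF.normLower p) h w.1 w.2) ^ ((1 : ℝ) / 2))
    (((BF.measurable_upper p h h.2).mul (W.density_sample hp hq h).1).pow_const _)

/-- The one-sided distance between the density of the samples and an upper bracket. -/
noncomputable def excess (M : MDP S A) (BF : BracketCover H volume (prodClass H F) ε nF)
    (BP : BracketCover H α Pol ε nP) (fLast : AugState S × A → ℝ → ℝ≥0∞)
    (h : Fin H) (p : Fin nF) (q : Fin nP) (x : AugState S × A) : ℝ≥0∞ :=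
  ∫⁻ z, (M.target α H fLast (BP.normLower q) (BF.normLower p) h x z - BF.upper p h x z)

lemma measurable_excess (W : WellSpecified M α H K ε F Pol fLast) (h : Fin H)
    {p : Fin nF} {q : Fin nP} (hp : p ∈ Set.range BF.index) (hq : q ∈ Set.range BP.index) :
    Measurable (excess M BF BP fLast h p q) :=
  Measurable.lintegral_prod_right' (f := fun w : (AugState S × A) × ℝ =>
      M.target α H fLast (BP.normLower q) (BF.normLower p) h w.1 w.2 - BF.upper p h w.1 w.2)
    ((W.density_sample hp hq h).1.sub (BF.measurable_upper p h h.2))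

/-- The inequality `lintegral_sqrt_mul_add_le` averaged over states and actions; Jensen's inequality
moves the square outside the average. -/
lemma affinity_add_le (W : WellSpecified M α H K ε F Pol fLast) (run : Run M K BF BP ρ β P)
    (h : Fin H) {p : Fin nF} {q : Fin nP} (hp : p ∈ Set.range BF.index)
    (hq : q ∈ Set.range BP.index) (k : ℕ) (ω : Ω) :
    run.affinity fLast h p q k ω +
      (∫⁻ x, excess M BF BP fLast h p q x ∂(M.visit α H (run.pol k ω) h)) ^ 2 / 2 ≤
      ENNReal.ofReal (1 + ε / 2) := by
  have hv := M.isProbabilityMeasure_visit (W.policy _ (run.pol k ω).2) h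
  have me := measurable_excess (BF := BF) (BP := BP) W h hp hq
  have hg := W.density_sample hp hq h
  obtain ⟨f, rfl⟩ := hp
  calc _ ≤ run.affinity fLast h (BF.index f) q k ω +
        (∫⁻ x, excess M BF BP fLast h (BF.index f) q x ^ 2 ∂(M.visit α H (run.pol k ω) h)) / 2 := by
        gcongr
        exact sq_lintegral_le me
    _ = ∫⁻ x, ((∫⁻ z, (BF.upper (BF.index f) h x z * M.target α H fLast (BP.normLower q)
          (BF.normLower (BF.index f)) h x z) ^ ((1 : ℝ) / 2)) +
          excess M BF BP fLast h (BF.index f) q x ^ 2 / 2) ∂(M.visit α H (run.pol k ω) h) := by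
        simp_rw [div_eq_mul_inv _ (2 : ℝ≥0∞)]
        rw [lintegral_add_right _ ((me.pow_const 2).mul_const _),
          lintegral_mul_const _ (me.pow_const 2)]
        rfl
    _ ≤ ∫⁻ _, ENNReal.ofReal (1 + ε / 2) ∂(M.visit α H (run.pol k ω) h) :=
        lintegral_mono fun x => lintegral_sqrt_mul_add_le
          (BF.measurable_upper_apply _ h.2 x) (hg.measurable_apply x) W.width_pos.le (hg.2 x)
          (BF.lintegral_upper_le W.width_pos W.density_prod f h.2 x)
    _ = ENNReal.ofReal (1 + ε / 2) := by simp

/-- Square roots of likelihood ratios, compensated by their conditional means. -/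
lemma measure_sqrt_ratio_le [IsProbabilityMeasure P] (W : WellSpecified M α H K ε F Pol fLast) (run : Run M K BF BP ρ β P)
    (h : Fin H) {p : Fin nF} {q : Fin nP} (hp : p ∈ Set.range BF.index)
    (hq : q ∈ Set.range BP.index) {T : ℝ} (hT : 0 < T) {n : ℕ} (hn : n ≤ K) :
    P {ω | ENNReal.ofReal T ≤ ∏ k ∈ Finset.range n,
      ((BF.upper p h (run.stateAction h k ω) (run.sample h p q k ω) /
        M.target α H fLast (BP.normLower q) (BF.normLower p) h (run.stateAction h k ω)
          (run.sample h p q k ω)) ^ ((1 : ℝ) / 2) *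
        ENNReal.ofReal (Real.exp (1 - (run.affinity fLast h p q k ω).toReal)))} ≤
      ENNReal.ofReal (1 / T) := by
  have hg := W.density_sample hp hq h
  have hA : ∀ k ω, run.affinity fLast h p q k ω ≠ ⊤ := fun k ω =>
    ne_top_of_le_ne_top ENNReal.ofReal_ne_top
      (le_self_add.trans (run.affinity_add_le W h hp hq k ω))
  set g := M.target α H fLast (BP.normLower q) (BF.normLower p) h with hgdef
  set φ : AugState S × A → ℝ → ℝ≥0∞ := fun x z =>
    (BF.upper p h x z / g x z) ^ ((1 : ℝ) / 2) with hφ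
  have mφ : Measurable (Function.uncurry φ) :=
    ((BF.measurable_upper p h h.2).div hg.1).pow_const _
  have mA : ∀ k < K, Measurable[run.info k] (run.affinity fLast h p q k) := fun k hk =>
    run.measurable_lintegral_visit hk h (measurable_affinity_integrand W h hp hq)
  have mc : ∀ k < K, Measurable[run.info k] fun ω =>
      ENNReal.ofReal (Real.exp (1 - (run.affinity fLast h p q k ω).toReal)) := fun k hk =>
    ENNReal.measurable_ofReal.comp (Real.measurable_exp.comp
      (measurable_const.sub (ENNReal.measurable_toReal.comp (mA k hk))))
  refine measure_le_prod_le run.info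
    (fun k ω => φ (run.stateAction h k ω) (run.sample h p q k ω) *
      ENNReal.ofReal (Real.exp (1 - (run.affinity fLast h p q k ω).toReal))) K
    (fun k hk => (mφ.comp (run.measurable_data hk h p q)).mul
      ((mc k hk).mono (run.info.mono (Nat.le_succ k)) le_rfl)) (fun k hk E hE => ?_) hT hn
  set c : Ω → ℝ≥0∞ := fun ω =>
    ENNReal.ofReal (Real.exp (1 - (run.affinity fLast h p q k ω).toReal)) with hc
  have hE' := run.info.le k _ hE
  calc ∫⁻ ω in E, φ (run.stateAction h k ω) (run.sample h p q k ω) * c ω ∂P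
      = ∫⁻ ω, φ (run.stateAction h k ω) (run.sample h p q k ω) * E.indicator c ω ∂P := by
        rw [← lintegral_indicator hE']
        refine lintegral_congr fun ω => ?_
        by_cases hω : ω ∈ E <;> simp [hω]
    _ ≤ ∫⁻ ω, run.affinity fLast h p q k ω * E.indicator c ω ∂P := by
        -- The compensator depends on ω only through the law of the trajectory under the policy of
        -- episode k, hence is known before the episode and can be treated as a constant.
        refine lintegral_mul_le_of_setLIntegral_le (run.info.le k)
          (mφ.comp ((run.measurable_data hk h p q).mono (run.info.le _) le_rfl))
          ((mA k hk).mono (run.info.le _) le_rfl) ((mc k hk).indicator hE) fun E' hE' => ?_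
        rw [run.setLIntegral_sample W hk h hp hq mφ hE']
        exact lintegral_mono fun ω => lintegral_mono fun x => lintegral_mono fun z =>
          mul_div_sqrt_le _ _
    _ ≤ ∫⁻ ω, E.indicator 1 ω ∂P := by
        refine lintegral_mono fun ω => ?_
        by_cases hω : ω ∈ E
        · simp only [hω, Set.indicator_of_mem, Pi.one_apply, hc]
          rw [← ENNReal.ofReal_toReal (hA k ω), ENNReal.toReal_ofReal ENNReal.toReal_nonneg,
            ← ENNReal.ofReal_mul ENNReal.toReal_nonneg, ← ENNReal.ofReal_one]
          refine ENNReal.ofReal_le_ofReal ?_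
          set a := (run.affinity fLast h p q k ω).toReal
          -- a ≤ e^{a - 1}, so the compensated conditional mean a e^{1 - a} is at most 1.
          have h1 := Real.add_one_le_exp (a - 1)
          calc a * Real.exp (1 - a) ≤ Real.exp (a - 1) * Real.exp (1 - a) := by
                gcongr; linarith
            _ = 1 := by rw [← Real.exp_add]; simp
        · simp [hω]
    _ = P E := lintegral_indicator_one hE'

end Run
end RSDisRL

/-! ### Union bound and products of likelihood ratios -/

namespace RSDisRL

/-- The condition `c` discards brackets assigned to no member of the class: their lower ends may
have mass zero, and then normalizing gives no density. -/
lemma measure_exists_le {Ω ι : Type*} [MeasurableSpace Ω] [Fintype ι] {P : Measure Ω}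
    {c : ι → Prop} {Q : ι → Ω → Prop} {b : ℝ≥0∞} (h : ∀ i, c i → P {ω | Q i ω} ≤ b) :
    P {ω | ∃ i, c i ∧ Q i ω} ≤ Fintype.card ι * b := by
  have h1 : {ω | ∃ i, c i ∧ Q i ω} = ⋃ i, {ω | c i ∧ Q i ω} := by ext; simp
  rw [h1]
  calc P (⋃ i, {ω | c i ∧ Q i ω}) ≤ ∑ i, P {ω | c i ∧ Q i ω} := measure_iUnion_fintype_le _ _
    _ ≤ ∑ _i : ι, b := by
        refine Finset.sum_le_sum fun i _ => ?_
        by_cases hi : c i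
        · simpa [hi] using h i hi
        · simp [hi]
    _ = Fintype.card ι * b := by simp

/-- Turns the comparison of log-likelihoods, which may be infinite, into one of products in `ℝ≥0∞`.
-/
lemma log_prod_sub_le_iff (s : Finset ℕ) (a b : ℕ → ℝ≥0∞) (β : ℝ) :
    ∑ i ∈ s, ENNReal.log (a i) - (β : EReal) ≤ ∑ i ∈ s, ENNReal.log (b i) ↔
      ∏ i ∈ s, a i ≤ ENNReal.ofReal (Real.exp β) * ∏ i ∈ s, b i := by
  have hlog : ∀ a : ℕ → ℝ≥0∞, ∑ i ∈ s, ENNReal.log (a i) = ENNReal.log (∏ i ∈ s, a i) := by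
    intro a
    induction s using Finset.cons_induction with
    | empty => simp
    | cons i s hi ih => rw [Finset.sum_cons, Finset.prod_cons, ih, ENNReal.log_mul_add]
  rw [hlog, hlog, EReal.sub_le_iff_le_add (by simp) (by simp), ← ENNReal.log_le_log_iff,
    ENNReal.log_mul_add, ENNReal.log_ofReal_of_pos (Real.exp_pos _), Real.log_exp, add_comm]

/-- If the likelihood ratios of `u` against `g` are bounded by `T`, and `g` is dominated by `t`, then
the likelihood of `u` is bounded by that of `t`. -/
lemma prod_le_of_prod_ratio_lt {k : ℕ} {u g t : ℕ → ℝ≥0∞} {T ε : ℝ}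
    (hT : 0 < T) (hg : ∀ i < k, g i ∉ ({0, ⊤} : Set ℝ≥0∞))
    (hgt : ∀ i < k, g i ≤ ENNReal.ofReal (Real.exp (4 * ε)) * t i)
    (hlt : ∏ i ∈ Finset.range k, (u i / g i * ENNReal.ofReal (Real.exp (-ε))) < ENNReal.ofReal T) :
    ∏ i ∈ Finset.range k, u i ≤
      ENNReal.ofReal (Real.exp (Real.log T + 5 * (ε * k))) * ∏ i ∈ Finset.range k, t i := by
  have hterm : ∀ i ∈ Finset.range k, u i ≤ (u i / g i * ENNReal.ofReal (Real.exp (-ε))) *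
      (ENNReal.ofReal (Real.exp (5 * ε)) * t i) := by
    intro i hi
    have hi' := Finset.mem_range.1 hi
    have h0 : g i ≠ 0 := fun h => hg i hi' (by simp [h])
    have hT : g i ≠ ⊤ := fun h => hg i hi' (by simp [h])
    calc u i = u i / g i * g i := (ENNReal.div_mul_cancel h0 hT).symm
      _ ≤ u i / g i * (ENNReal.ofReal (Real.exp (4 * ε)) * t i) := by gcongr; exact hgt i hi'
      _ = u i / g i * (ENNReal.ofReal (Real.exp (-ε)) * ENNReal.ofReal (Real.exp (5 * ε)) * t i) := by
          rw [← ENNReal.ofReal_mul (Real.exp_pos _).le, ← Real.exp_add]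
          congr 4; ring
      _ = _ := by ring
  calc ∏ i ∈ Finset.range k, u i
      ≤ ∏ i ∈ Finset.range k, ((u i / g i * ENNReal.ofReal (Real.exp (-ε))) *
        (ENNReal.ofReal (Real.exp (5 * ε)) * t i)) := Finset.prod_le_prod' hterm
    _ = (∏ i ∈ Finset.range k, (u i / g i * ENNReal.ofReal (Real.exp (-ε)))) *
        ((ENNReal.ofReal (Real.exp (5 * ε))) ^ k * ∏ i ∈ Finset.range k, t i) := by
        rw [Finset.prod_mul_distrib]
        congr 1
        rw [Finset.prod_mul_distrib, Finset.prod_const, Finset.card_range]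
    _ ≤ ENNReal.ofReal T * ((ENNReal.ofReal (Real.exp (5 * ε))) ^ k *
          ∏ i ∈ Finset.range k, t i) := by gcongr
    _ = _ := by
        rw [← mul_assoc, ← ENNReal.ofReal_pow (Real.exp_pos _).le, ← ENNReal.ofReal_mul hT.le,
          ← Real.exp_nat_mul, Real.exp_add, Real.exp_log hT]
        congr 4; ring

/-- A likelihood bound for `u` against `g` and a bound on the compensated square roots of the ratios
limit the sum of the losses of affinity. -/
lemma sum_one_sub_le {k : ℕ} {u g : ℕ → ℝ≥0∞} {a : ℕ → ℝ} {T b : ℝ}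
    (hT : 0 < T) (hg : ∀ i < k, g i ∉ ({0, ⊤} : Set ℝ≥0∞))
    (hgu : ∏ i ∈ Finset.range k, g i ≤
      ENNReal.ofReal (Real.exp b) * ∏ i ∈ Finset.range k, u i)
    (hlt : ∏ i ∈ Finset.range k, ((u i / g i) ^ ((1 : ℝ) / 2) *
      ENNReal.ofReal (Real.exp (1 - a i))) < ENNReal.ofReal T) :
    ∑ i ∈ Finset.range k, (1 - a i) ≤ Real.log T + b / 2 := by
  have h0 : ∀ i ∈ Finset.range k, g i ≠ 0 := fun i hi h =>
    hg i (Finset.mem_range.1 hi) (by simp [h])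
  have hT' : ∀ i ∈ Finset.range k, g i ≠ ⊤ := fun i hi h =>
    hg i (Finset.mem_range.1 hi) (by simp [h])
  set R := ∏ i ∈ Finset.range k, u i / g i with hR
  have hRu : ∏ i ∈ Finset.range k, u i = R * ∏ i ∈ Finset.range k, g i := by
    rw [hR, ← Finset.prod_mul_distrib]
    exact Finset.prod_congr rfl fun i hi => (ENNReal.div_mul_cancel (h0 i hi) (hT' i hi)).symm
  have h1 : 1 ≤ ENNReal.ofReal (Real.exp b) * R := by
    rw [hRu, ← mul_assoc] at hgu
    have hne : ∏ i ∈ Finset.range k, g i ≠ 0 := Finset.prod_ne_zero_iff.2 h0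
    have hnt : ∏ i ∈ Finset.range k, g i ≠ ⊤ := ENNReal.prod_ne_top hT'
    by_contra! hcon
    have := ENNReal.mul_lt_mul_left hne hnt hcon
    rw [one_mul] at this
    exact absurd hgu (not_le.2 this)
  -- The square root halves the exponent, which is the origin of b / 2 in the bound.
  have h2 : 1 ≤ ENNReal.ofReal (Real.exp (b / 2)) * R ^ ((1 : ℝ) / 2) := by
    calc (1 : ℝ≥0∞) = 1 ^ ((1 : ℝ) / 2) := by simp
      _ ≤ (ENNReal.ofReal (Real.exp b) * R) ^ ((1 : ℝ) / 2) := by gcongr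
      _ = _ := by
          rw [ENNReal.mul_rpow_of_nonneg _ _ (by norm_num), ENNReal.ofReal_rpow_of_pos
            (Real.exp_pos _), ← Real.exp_mul]
          congr 3; ring
  set s := ∑ i ∈ Finset.range k, (1 - a i) with hs
  have h3 : ENNReal.ofReal (Real.exp s) ≤ ENNReal.ofReal (Real.exp (b / 2) * T) := by
    calc ENNReal.ofReal (Real.exp s) = 1 * ENNReal.ofReal (Real.exp s) := (one_mul _).symm
      _ ≤ (ENNReal.ofReal (Real.exp (b / 2)) * R ^ ((1 : ℝ) / 2)) * ENNReal.ofReal (Real.exp s) := by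
          gcongr
      _ = ENNReal.ofReal (Real.exp (b / 2)) * ∏ i ∈ Finset.range k, ((u i / g i) ^ ((1 : ℝ) / 2) *
          ENNReal.ofReal (Real.exp (1 - a i))) := by
          rw [Finset.prod_mul_distrib, ENNReal.prod_rpow_of_nonneg (by norm_num),
            ← ENNReal.ofReal_prod_of_nonneg (fun i _ => (Real.exp_pos _).le), ← Real.exp_sum,
            mul_assoc]
      _ ≤ ENNReal.ofReal (Real.exp (b / 2)) * ENNReal.ofReal T := by gcongr
      _ = _ := (ENNReal.ofReal_mul (Real.exp_pos _).le).symm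
  have h4 := (ENNReal.ofReal_le_ofReal_iff (by positivity)).1 h3
  have h5 := Real.log_le_log (Real.exp_pos s) h4
  rw [Real.log_exp, Real.log_mul (Real.exp_pos _).ne' hT.ne', Real.log_exp] at h5
  linarith

variable {S A : Type*} [MeasurableSpace S] [MeasurableSpace A]

/-! ### Exceptional events and what holds outside them -/

namespace Run

variable {M : MDP S A} {α : Measure A} {H K : ℕ} {ε : ℝ}
  {F : ℕ → Set (AugState S × A → ℝ → ℝ≥0∞)} {Pol : Set (Policy S A)}
  {nF nP : ℕ} {BF : BracketCover H volume (prodClass H F) ε nF}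
  {BP : BracketCover H α Pol ε nP} {ρ : Measure ℝ → ℝ} {β : ℝ}
  {Ω : Type*} [mΩ : MeasurableSpace Ω] {P : Measure Ω} {fLast : AugState S × A → ℝ → ℝ≥0∞}

lemma mem_confSet_iff (run : Run M K BF BP ρ β P) (k : ℕ) (ω : Ω) (π : Pol) (f : prodClass H F) :
    f ∈ run.confSet k ω π ↔ ∀ h : Fin H, ∀ f' ∈ prodClass H F,
      ∏ i ∈ Finset.range k, f' h (run.stateAction h i ω)
          (run.sample h (BF.index f) (BP.index π) i ω) ≤
        ENNReal.ofReal (Real.exp β) * ∏ i ∈ Finset.range k, f.1 h (run.stateAction h i ω)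
          (run.sample h (BF.index f) (BP.index π) i ω) :=
  forall_congr' fun _ => forall_congr' fun _ => forall_congr' fun _ =>
    log_prod_sub_le_iff _ _ _ _

/-- The event that some sample has a degenerate conditional density. -/
def degenerateEvent (run : Run M K BF BP ρ β P) (fLast : AugState S × A → ℝ → ℝ≥0∞) : Set Ω :=
  {ω | ∃ i : Fin K × Fin H × Fin nF × Fin nP,
    (i.2.2.1 ∈ Set.range BF.index ∧ i.2.2.2 ∈ Set.range BP.index) ∧
    M.target α H fLast (BP.normLower i.2.2.2) (BF.normLower i.2.2.1) i.2.1
      (run.stateAction i.2.1 i.1 ω) (run.sample i.2.1 i.2.2.1 i.2.2.2 i.1 ω) ∈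
      ({0, ⊤} : Set ℝ≥0∞)}

/-- The event that some likelihood ratio of an upper bracket reaches `T`. -/
def ratioEvent (run : Run M K BF BP ρ β P) (fLast : AugState S × A → ℝ → ℝ≥0∞) (T : ℝ) : Set Ω :=
  {ω | ∃ i : Fin (K + 1) × Fin H × Fin nF × Fin nP × Fin nF,
    (i.2.2.1 ∈ Set.range BF.index ∧ i.2.2.2.1 ∈ Set.range BP.index ∧
      i.2.2.2.2 ∈ Set.range BF.index) ∧
    ENNReal.ofReal T ≤ ∏ k ∈ Finset.range i.1,
      (BF.upper i.2.2.2.2 i.2.1 (run.stateAction i.2.1 k ω)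
          (run.sample i.2.1 i.2.2.1 i.2.2.2.1 k ω) /
        M.target α H fLast (BP.normLower i.2.2.2.1) (BF.normLower i.2.2.1) i.2.1
          (run.stateAction i.2.1 k ω) (run.sample i.2.1 i.2.2.1 i.2.2.2.1 k ω) *
        ENNReal.ofReal (Real.exp (-ε)))}

/-- The event that some compensated square root of a likelihood ratio reaches `T`. -/
def sqrtRatioEvent (run : Run M K BF BP ρ β P) (fLast : AugState S × A → ℝ → ℝ≥0∞) (T : ℝ) :
    Set Ω :=
  {ω | ∃ i : Fin (K + 1) × Fin H × Fin nF × Fin nP,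
    (i.2.2.1 ∈ Set.range BF.index ∧ i.2.2.2 ∈ Set.range BP.index) ∧
    ENNReal.ofReal T ≤ ∏ k ∈ Finset.range i.1,
      ((BF.upper i.2.2.1 i.2.1 (run.stateAction i.2.1 k ω)
          (run.sample i.2.1 i.2.2.1 i.2.2.2 k ω) /
        M.target α H fLast (BP.normLower i.2.2.2) (BF.normLower i.2.2.1) i.2.1
          (run.stateAction i.2.1 k ω) (run.sample i.2.1 i.2.2.1 i.2.2.2 k ω)) ^ ((1 : ℝ) / 2) *
        ENNReal.ofReal (Real.exp (1 - (run.affinity fLast i.2.1 i.2.2.1 i.2.2.2 k ω).toReal)))}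

/-- Outside the events of degeneracy and of large ratios, the confidence sets contain the true
return laws. -/
lemma exists_mem_confSet (W : WellSpecified M α H K ε F Pol fLast) (run : Run M K BF BP ρ β P)
    {T : ℝ} (hT : 0 < T) (hβ : Real.log T + 5 ≤ β) {ω : Ω}
    (h0 : ω ∉ run.degenerateEvent fLast) (h1 : ω ∉ run.ratioEvent fLast T) {k : ℕ} (hk : k ≤ K)
    (π : Pol) {f : Returns S A} (hf : f ∈ prodClass H F)
    (hfix : ∀ h < H, f h = M.target α H fLast π f h) : ⟨f, hf⟩ ∈ run.confSet k ω π := by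
  rw [mem_confSet_iff]
  intro h f' hf'
  set p := BF.index ⟨f, hf⟩ with hp
  set q := BP.index π with hq
  have hlt := not_le.1 fun hle => h1 ⟨(⟨k, by omega⟩, h, p, q, BF.index ⟨f', hf'⟩),
    ⟨⟨_, rfl⟩, ⟨_, rfl⟩, ⟨_, rfl⟩⟩, hle⟩
  calc ∏ i ∈ Finset.range k, f' h (run.stateAction h i ω) (run.sample h p q i ω)
      ≤ ∏ i ∈ Finset.range k, BF.upper (BF.index ⟨f', hf'⟩) h (run.stateAction h i ω)
          (run.sample h p q i ω) :=
        Finset.prod_le_prod' fun i _ => BF.le_upper ⟨f', hf'⟩ h h.2 _ _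
    _ ≤ ENNReal.ofReal (Real.exp (Real.log T + 5 * (ε * k))) *
          ∏ i ∈ Finset.range k, f h (run.stateAction h i ω) (run.sample h p q i ω) := by
        refine prod_le_of_prod_ratio_lt hT (fun i hi hmem => h0 ⟨(⟨i, by omega⟩, h, p, q),
          ⟨⟨_, rfl⟩, ⟨_, rfl⟩⟩, hmem⟩) (fun i _ => ?_) hlt
        have := W.sample_le_target (BF := BF) (BP := BP) ⟨f, hf⟩ π h (run.stateAction h i ω)
          (run.sample h p q i ω)
        -- Since f is its own target, the sample density is dominated by the likelihood of f itself.
        rwa [← hfix h h.2] at this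
    _ ≤ _ := by
        gcongr
        have := W.width_mul_le hk
        linarith

/-- `plan` constrains the choice only if some confidence set is nonempty; the fixed point of the
executed policy supplies a member. -/
lemma est_mem_confSet (W : WellSpecified M α H K ε F Pol fLast)
    (run : Run M K BF BP ρ β P) {T : ℝ} (hT : 0 < T) (hβ : Real.log T + 5 ≤ β) {ω : Ω}
    (h0 : ω ∉ run.degenerateEvent fLast) (h1 : ω ∉ run.ratioEvent fLast T) {k : ℕ} (hk : k < K) :
    run.est k ω ∈ run.confSet k ω (run.pol k ω) := by
  obtain ⟨f, hf, hfix⟩ := W.exists_fixedPoint (run.pol k ω).2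
  exact (run.plan k hk ω ⟨run.pol k ω, _,
    run.exists_mem_confSet W hT hβ h0 h1 hk.le (run.pol k ω) hf hfix⟩).1

/-- Outside the exceptional events, the members of the confidence sets lose little affinity on the
past visitation measures. -/
lemma sum_affinity_le (W : WellSpecified M α H K ε F Pol fLast)
    (run : Run M K BF BP ρ β P) {T : ℝ} (hT : 0 < T) {ω : Ω}
    (h0 : ω ∉ run.degenerateEvent fLast)
    (h2 : ω ∉ run.sqrtRatioEvent fLast T) {k : ℕ} (hk : k ≤ K) {π : Pol} {f : prodClass H F}
    (hf : f ∈ run.confSet k ω π) (h : Fin H) :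
    ∑ i ∈ Finset.range k, (1 - (run.affinity fLast h (BF.index f) (BP.index π) i ω).toReal) ≤
      Real.log T + (β + 4) / 2 := by
  set p := BF.index f with hp
  set q := BP.index π with hq
  have hlt := not_le.1 fun hle => h2 ⟨(⟨k, by omega⟩, h, p, q), ⟨⟨_, rfl⟩, ⟨_, rfl⟩⟩, hle⟩
  refine sum_one_sub_le hT (fun i hi hmem => h0 ⟨(⟨i, by omega⟩, h, p, q),
    ⟨⟨_, rfl⟩, ⟨_, rfl⟩⟩, hmem⟩) ?_ hlt
  -- The competitor is f with its h-th entry replaced by the Bellman target. Its likelihood is at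
  -- least e^{-4} times that of the sample density, and f falls short of it by at most the factor
  -- e^β.
  have hconf := (run.mem_confSet_iff k ω π f).1 hf h _ (W.update_target_mem π.2 f.2 h.2)
  rw [Function.update_self] at hconf
  dsimp only
  calc ∏ i ∈ Finset.range k, M.target α H fLast (BP.normLower q) (BF.normLower p) h
        (run.stateAction h i ω) (run.sample h p q i ω)
      ≤ ∏ i ∈ Finset.range k, (ENNReal.ofReal (Real.exp (4 * ε)) * M.target α H fLast π f h
        (run.stateAction h i ω) (run.sample h p q i ω)) :=
        Finset.prod_le_prod' fun i _ => W.sample_le_target f π h _ _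
    _ = ENNReal.ofReal (Real.exp (4 * (ε * k))) * ∏ i ∈ Finset.range k, M.target α H fLast π f h
        (run.stateAction h i ω) (run.sample h p q i ω) := by
        rw [Finset.prod_mul_distrib, Finset.prod_const, Finset.card_range,
          ← ENNReal.ofReal_pow (Real.exp_pos _).le, ← Real.exp_nat_mul]
        congr 3; ring
    _ ≤ ENNReal.ofReal (Real.exp 4) * (ENNReal.ofReal (Real.exp β) * ∏ i ∈ Finset.range k,
          f.1 h (run.stateAction h i ω) (run.sample h p q i ω)) := by
        gcongr
        have := W.width_mul_le hk
        linarith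
    _ ≤ ENNReal.ofReal (Real.exp 4) * (ENNReal.ofReal (Real.exp β) * ∏ i ∈ Finset.range k,
          BF.upper p h (run.stateAction h i ω) (run.sample h p q i ω)) := by
        gcongr with i hi
        exact BF.le_upper f h h.2 _ _
    _ = _ := by
        rw [← mul_assoc, ← ENNReal.ofReal_mul (Real.exp_pos _).le, ← Real.exp_add, add_comm β]

variable [SFinite α]

lemma measure_degenerateEvent (W : WellSpecified M α H K ε F Pol fLast)
    (run : Run M K BF BP ρ β P) : P (run.degenerateEvent fLast) = 0 := by
  refine le_antisymm ?_ zero_le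
  refine (measure_exists_le (b := 0) fun i hi => ?_).trans (by simp)
  exact (run.measure_density_eq_zero W i.1.2 i.2.1 hi.1 hi.2).le

lemma measure_ratioEvent [IsProbabilityMeasure P] (W : WellSpecified M α H K ε F Pol fLast)
    (run : Run M K BF BP ρ β P) {T : ℝ} (hT : 0 < T) :
    P (run.ratioEvent fLast T) ≤
      ENNReal.ofReal (((K : ℝ) + 1) * H * nF * nP * nF * (1 / T)) := by
  refine (measure_exists_le (b := ENNReal.ofReal (1 / T)) fun i hi => ?_).trans (le_of_eq ?_)
  · exact run.measure_ratio_le W i.2.1 hi.1 hi.2.1 hi.2.2 hT (by omega)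
  · simp only [Fintype.card_prod, Fintype.card_fin]
    rw [ENNReal.ofReal_mul (by positivity), ← ENNReal.ofReal_natCast]
    congr 2; push_cast; ring

lemma measure_sqrtRatioEvent [IsProbabilityMeasure P] (W : WellSpecified M α H K ε F Pol fLast)
    (run : Run M K BF BP ρ β P) {T : ℝ} (hT : 0 < T) :
    P (run.sqrtRatioEvent fLast T) ≤
      ENNReal.ofReal (((K : ℝ) + 1) * H * nF * nP * (1 / T)) := by
  refine (measure_exists_le (b := ENNReal.ofReal (1 / T)) fun i hi => ?_).trans (le_of_eq ?_)
  · exact run.measure_sqrt_ratio_le W i.2.1 hi.1 hi.2 hT (by omega)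
  · simp only [Fintype.card_prod, Fintype.card_fin]
    rw [ENNReal.ofReal_mul (by positivity), ← ENNReal.ofReal_natCast]
    congr 2; push_cast; ring

end Run
end RSDisRL

namespace RSDisRL

variable {S A : Type*} [MeasurableSpace S] [MeasurableSpace A]
  {M : MDP S A} {α : Measure A} {H K : ℕ} {ε : ℝ}
  {F : ℕ → Set (AugState S × A → ℝ → ℝ≥0∞)} {Pol : Set (Policy S A)}
  {nF nP : ℕ} {BF : BracketCover H volume (prodClass H F) ε nF}
  {BP : BracketCover H α Pol ε nP} {fLast : AugState S × A → ℝ → ℝ≥0∞}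

/-! ### From loss of affinity to Bellman errors and their sum -/

namespace WellSpecified

lemma bellmanErr_le_one (W : WellSpecified M α H K ε F Pol fLast) (f : prodClass H F) (π : Pol)
    (h : Fin H) (x : AugState S × A) : M.bellmanErr α H fLast π f h x ≤ 1 :=
  lintegral_tsub_le_one ((W.density_prod f f.2 h h.2).2 x)

lemma lintegral_bellmanErr_le_one (W : WellSpecified M α H K ε F Pol fLast) (f : prodClass H F)
    (π : Pol) (h : Fin H) (μ : Measure (AugState S × A)) [IsProbabilityMeasure μ] :
    ∫⁻ x, M.bellmanErr α H fLast π f h x ∂μ ≤ 1 :=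
  calc _ ≤ ∫⁻ _, 1 ∂μ := lintegral_mono fun x => W.bellmanErr_le_one f π h x
    _ = 1 := by simp

variable [SFinite α]

/-- Triangle inequality through the sample density g. Exchanging f for its upper end costs ε, and g
exceeds the target of f by a mass of at most 1 - e^{-4ε} ≤ 4ε. -/
lemma bellmanErr_le (W : WellSpecified M α H K ε F Pol fLast) (f : prodClass H F) (π : Pol)
    (h : Fin H) (x : AugState S × A) :
    M.bellmanErr α H fLast π f h x ≤
      Run.excess M BF BP fLast h (BF.index f) (BP.index π) x + ENNReal.ofReal (5 * ε) := by
  have hg := W.density_sample (BF := BF) (BP := BP) ⟨f, rfl⟩ ⟨π, rfl⟩ h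
  have hgt := W.sample_le_target (BF := BF) (BP := BP) f π h x
  set g := M.target α H fLast (BP.normLower (BP.index π)) (BF.normLower (BF.index f)) h with hgdef
  have hf := W.density_prod f f.2 h h.2
  have hε := W.width_pos
  have h1 : ∫⁻ z, (f.1 h x z - g x z) ≤
      Run.excess M BF BP fLast h (BF.index f) (BP.index π) x + ENNReal.ofReal ε := by
    -- The sides must be swapped: u ≥ f helps to bound g - f, not f - g.
    rw [lintegral_tsub_comm (hf.measurable_apply x) (hg.measurable_apply x) (hf.2 x) (hg.2 x)]
    calc ∫⁻ z, (g x z - f.1 h x z)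
        ≤ ∫⁻ z, ((g x z - BF.upper (BF.index f) h x z) +
            (BF.upper (BF.index f) h x z - f.1 h x z)) :=
          lintegral_mono fun z => tsub_le_tsub_add_tsub
      _ = (∫⁻ z, (g x z - BF.upper (BF.index f) h x z)) +
            ∫⁻ z, (BF.upper (BF.index f) h x z - f.1 h x z) :=
          lintegral_add_left
            ((hg.measurable_apply x).sub (BF.measurable_upper_apply _ h.2 x)) _
      _ ≤ _ := by
          gcongr
          · exact le_rfl
          · exact BF.lintegral_upper_tsub_le f h.2 x
  have h2 : ∫⁻ z, (g x z - M.target α H fLast π f h x z) ≤ ENNReal.ofReal (4 * ε) := by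
    calc ∫⁻ z, (g x z - M.target α H fLast π f h x z)
        ≤ ∫⁻ z, g x z * ENNReal.ofReal (4 * ε) := by
          refine lintegral_mono fun z => ?_
          rw [tsub_le_iff_left]
          have hle : g x z * ENNReal.ofReal (Real.exp (-(4 * ε))) ≤
              M.target α H fLast π f h x z := by
            calc _ ≤ (ENNReal.ofReal (Real.exp (4 * ε)) * M.target α H fLast π f h x z) *
                  ENNReal.ofReal (Real.exp (-(4 * ε))) := by gcongr; exact hgt z
              _ = (ENNReal.ofReal (Real.exp (4 * ε)) * ENNReal.ofReal (Real.exp (-(4 * ε)))) *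
                  M.target α H fLast π f h x z := by ring
              _ = _ := by
                  rw [← ENNReal.ofReal_mul (Real.exp_pos _).le, ← Real.exp_add]; simp
          calc g x z = g x z * 1 := (mul_one _).symm
            _ ≤ g x z * (ENNReal.ofReal (Real.exp (-(4 * ε))) + ENNReal.ofReal (4 * ε)) := by
                gcongr
                rw [← ENNReal.ofReal_add (Real.exp_pos _).le (by linarith), ENNReal.one_le_ofReal]
                linarith [Real.add_one_le_exp (-(4 * ε))]
            _ = g x z * ENNReal.ofReal (Real.exp (-(4 * ε))) + g x z * ENNReal.ofReal (4 * ε) :=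
                mul_add _ _ _
            _ ≤ _ := by gcongr
      _ = ENNReal.ofReal (4 * ε) := by
          rw [lintegral_mul_const _ (hg.measurable_apply x), hg.2 x, one_mul]
  calc M.bellmanErr α H fLast π f h x
      ≤ ∫⁻ z, ((f.1 h x z - g x z) + (g x z - M.target α H fLast π f h x z)) :=
        lintegral_mono fun z => tsub_le_tsub_add_tsub
    _ = (∫⁻ z, (f.1 h x z - g x z)) + ∫⁻ z, (g x z - M.target α H fLast π f h x z) :=
        lintegral_add_left ((hf.measurable_apply x).sub (hg.measurable_apply x)) _
    _ ≤ (Run.excess M BF BP fLast h (BF.index f) (BP.index π) x + ENNReal.ofReal ε) +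
          ENNReal.ofReal (4 * ε) := add_le_add h1 h2
    _ = _ := by
        rw [add_assoc, ← ENNReal.ofReal_add hε.le (by linarith)]
        congr 2; ring

/-- Links the real-valued functions in the eluder dimension with the `ℝ≥0∞`-valued errors of the
simulation lemma. -/
lemma integral_tvDist (W : WellSpecified M α H K ε F Pol fLast) (f : prodClass H F) (π : Pol)
    (h : Fin H) (μ : Measure (AugState S × A)) :
    ∫ x, tvDist (f.1 h x) (M.target α H fLast π f h x) ∂μ =
      (∫⁻ x, M.bellmanErr α H fLast π f h x ∂μ).toReal := by
  have hf := W.density_prod f f.2 h h.2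
  have ht := W.density h h.2 _ (W.target_mem π.2 f.2 h.2)
  have h1 : ∀ x, tvDist (f.1 h x) (M.target α H fLast π f h x) =
      (M.bellmanErr α H fLast π f h x).toReal := fun x => by
    rw [tvDist_eq (hf.measurable_apply x) (ht.measurable_apply x) (hf.2 x) (ht.2 x),
      lintegral_tsub_comm (ht.measurable_apply x) (hf.measurable_apply x) (ht.2 x) (hf.2 x)]
    rfl
  simp_rw [h1]
  refine integral_toReal (M.measurable_bellmanErr (W.policy π π.2) (W.density_prod f f.2)
    W.density_last h.2).aemeasurable (Filter.Eventually.of_forall fun x => ?_)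
  exact (W.bellmanErr_le_one f π h x).trans_lt ENNReal.one_lt_top

end WellSpecified

namespace Run

variable [SFinite α] {ρ : Measure ℝ → ℝ} {β : ℝ} {Ω : Type*} [mΩ : MeasurableSpace Ω] {P : Measure Ω}

lemma sq_bellmanErr_le (W : WellSpecified M α H K ε F Pol fLast) (run : Run M K BF BP ρ β P)
    (f : prodClass H F) (π : Pol) (h : Fin H) (i : ℕ) (ω : Ω) :
    (∫⁻ x, M.bellmanErr α H fLast π f h x ∂(M.visit α H (run.pol i ω) h)).toReal ^ 2 ≤
      4 * (1 - (run.affinity fLast h (BF.index f) (BP.index π) i ω).toReal) + 27 * ε := by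
  have hv := M.isProbabilityMeasure_visit (W.policy _ (run.pol i ω).2) h
  have hA := run.affinity_add_le W h ⟨f, rfl⟩ ⟨π, rfl⟩ i ω
  set a := run.affinity fLast h (BF.index f) (BP.index π) i ω with ha
  set e := ∫⁻ x, excess M BF BP fLast h (BF.index f) (BP.index π) x
    ∂(M.visit α H (run.pol i ω) h) with he
  have hε := W.width_pos
  have hε2 := W.width_le_half
  have me := measurable_excess (BF := BF) (BP := BP) W h ⟨f, rfl⟩ ⟨π, rfl⟩
  have he1 : e ≤ 1 := by
    calc e ≤ ∫⁻ _, 1 ∂(M.visit α H (run.pol i ω) h) := lintegral_mono fun x =>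
          lintegral_tsub_le_one ((W.density_sample ⟨f, rfl⟩ ⟨π, rfl⟩ h).2 x)
      _ = 1 := by simp
  have heT : e ≠ ⊤ := ne_top_of_le_ne_top ENNReal.one_ne_top he1
  have haT : a ≠ ⊤ := ne_top_of_le_ne_top ENNReal.ofReal_ne_top (le_self_add.trans hA)
  have hA' : a.toReal + e.toReal ^ 2 / 2 ≤ 1 + ε / 2 := by
    have := ENNReal.toReal_mono ENNReal.ofReal_ne_top hA
    rwa [ENNReal.toReal_add haT (ENNReal.div_ne_top (ENNReal.pow_ne_top heT) (by norm_num)),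
      ENNReal.toReal_div, ENNReal.toReal_pow, ENNReal.toReal_ofReal (by linarith)] at this
  have hD : (∫⁻ x, M.bellmanErr α H fLast π f h x ∂(M.visit α H (run.pol i ω) h)).toReal ≤
      e.toReal + 5 * ε := by
    have h1 : ∫⁻ x, M.bellmanErr α H fLast π f h x ∂(M.visit α H (run.pol i ω) h) ≤
        e + ENNReal.ofReal (5 * ε) := by
      calc _ ≤ ∫⁻ x, (excess M BF BP fLast h (BF.index f) (BP.index π) x +
            ENNReal.ofReal (5 * ε)) ∂(M.visit α H (run.pol i ω) h) :=
            lintegral_mono fun x => W.bellmanErr_le f π h x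
        _ = _ := by rw [lintegral_add_left me]; simp [he]
    have := ENNReal.toReal_mono (ENNReal.add_ne_top.2 ⟨heT, ENNReal.ofReal_ne_top⟩) h1
    rwa [ENNReal.toReal_add heT ENNReal.ofReal_ne_top, ENNReal.toReal_ofReal (by linarith)] at this
  have hD0 : 0 ≤ (∫⁻ x, M.bellmanErr α H fLast π f h x
    ∂(M.visit α H (run.pol i ω) h)).toReal := ENNReal.toReal_nonneg
  have hsq := pow_le_pow_left₀ hD0 hD 2
  -- (e + 5ε)² ≤ 2e² + 50ε², where e² ≤ 2(1 - a) + ε and 50ε² ≤ 25ε because ε ≤ 1/2.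
  nlinarith [sq_nonneg (e.toReal - 5 * ε)]

/-- Outside the exceptional events, the Bellman errors of the chosen candidates are small on the
past visitation measures. -/
lemma sum_sq_bellmanErr_le (W : WellSpecified M α H K ε F Pol fLast) (run : Run M K BF BP ρ β P)
    {T : ℝ} (hT : 0 < T) {ω : Ω} (h0 : ω ∉ run.degenerateEvent fLast)
    (h2 : ω ∉ run.sqrtRatioEvent fLast T) {k : ℕ} (hk : k ≤ K) {π : Pol} {f : prodClass H F}
    (hf : f ∈ run.confSet k ω π) (h : Fin H) :
    ∑ i ∈ Finset.range k,
      (∫⁻ x, M.bellmanErr α H fLast π f h x ∂(M.visit α H (run.pol i ω) h)).toReal ^ 2 ≤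
      4 * Real.log T + 2 * β + 35 := by
  calc _ ≤ ∑ i ∈ Finset.range k,
        (4 * (1 - (run.affinity fLast h (BF.index f) (BP.index π) i ω).toReal) + 27 * ε) :=
        Finset.sum_le_sum fun i _ => run.sq_bellmanErr_le W f π h i ω
    _ = 4 * ∑ i ∈ Finset.range k,
        (1 - (run.affinity fLast h (BF.index f) (BP.index π) i ω).toReal) + 27 * (ε * k) := by
        rw [Finset.sum_add_distrib, ← Finset.mul_sum, Finset.sum_const, Finset.card_range,
          nsmul_eq_mul]
        ring
    _ ≤ _ := by
        have := run.sum_affinity_le W hT h0 h2 hk hf h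
        have := W.width_mul_le hk
        linarith

lemma sum_cdfDist_le (W : WellSpecified M α H K ε F Pol fLast) (run : Run M K BF BP ρ β P)
    {T : ℝ} (hT : 0 < T) (hT0 : 0 ≤ Real.log T) (hβ : Real.log T + 5 ≤ β) {ω : Ω}
    (h0 : ω ∉ run.degenerateEvent fLast) (h1 : ω ∉ run.ratioEvent fLast T)
    (h2 : ω ∉ run.sqrtRatioEvent fLast T) {d : ℕ}
    (hd : M.bellmanEluderDim α H fLast F Pol (1 / K) = d) :
    ∑ k ∈ Finset.range K,
      cdfDist (M.predLaw α (run.pol k ω) (run.est k ω)) (M.totalLaw α H (run.pol k ω)) ≤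
      H * (1 + Real.sqrt (d * K) +
        2 * Real.sqrt ((4 * Real.log T + 2 * β + 35) * d * K)) := by
  have hH := W.one_le_horizon
  have hK := W.two_le_episodes
  have hv := fun i h => M.isProbabilityMeasure_visit (W.policy _ (run.pol i ω).2) h
  have hconf : ∀ k < K, run.est k ω ∈ run.confSet k ω (run.pol k ω) := fun k hk =>
    run.est_mem_confSet W hT hβ h0 h1 hk
  calc _ ≤ ∑ k ∈ Finset.range K, ∑ h : Fin H, (∫⁻ x, M.bellmanErr α H fLast (run.pol k ω)
          (run.est k ω) h x ∂(M.visit α H (run.pol k ω) h)).toReal :=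
        Finset.sum_le_sum fun k _ => M.cdfDist_le hH (W.policy _ (run.pol k ω).2)
          (W.density_prod _ (run.est k ω).2) W.density_last W.last
    _ = ∑ h : Fin H, ∑ k ∈ Finset.range K, (∫⁻ x, M.bellmanErr α H fLast (run.pol k ω)
          (run.est k ω) h x ∂(M.visit α H (run.pol k ω) h)).toReal := Finset.sum_comm
    _ ≤ ∑ _h : Fin H, (1 + Real.sqrt (d * K) +
          2 * Real.sqrt ((4 * Real.log T + 2 * β + 35) * d * K)) := by
        refine Finset.sum_le_sum fun h _ => ?_
        have hdh : distEluderDim (M.bellmanErrors α H fLast F Pol h)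
            {μ | ∃ π ∈ Pol, μ = M.visit α H π h} (1 / K) ≤ d := by
          rw [← hd]
          exact le_iSup (fun h : Fin H => distEluderDim (M.bellmanErrors α H fLast F Pol h)
            {μ | ∃ π ∈ Pol, μ = M.visit α H π h} (1 / K)) h
        have hint := fun k i => W.integral_tvDist (run.est k ω) (run.pol k ω) h
          (M.visit α H (run.pol i ω) h)
        -- The test function of episode k is the Bellman error of the candidate chosen then;
        -- evaluated on the measures of earlier episodes it is small by membership in the confidence
        -- set.
        have key := sum_le_of_distEluderDim (by omega) hdh
          (fun k => M.visit α H (run.pol k ω) h)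
          (fun k x => tvDist ((run.est k ω).1 h x)
            (M.target α H fLast (run.pol k ω) (run.est k ω) h x))
          (fun k _ => ⟨_, (run.pol k ω).2, rfl⟩)
          (fun k _ => ⟨_, (run.est k ω).2, _, (run.pol k ω).2, rfl⟩)
          (fun k => by
            rw [hint, abs_of_nonneg ENNReal.toReal_nonneg]
            have := hv k h
            exact ENNReal.toReal_le_of_le_ofReal zero_le_one (by
              simpa using W.lintegral_bellmanErr_le_one (run.est k ω) (run.pol k ω) h _))
          (B := 4 * Real.log T + 2 * β + 35) (by linarith)
          (fun k hk => by
            simp_rw [hint]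
            exact run.sum_sq_bellmanErr_le W hT h0 h2 hk.le (hconf k hk) h)
        simpa only [hint, abs_of_nonneg ENNReal.toReal_nonneg] using key
    _ = _ := by rw [Finset.sum_const, Finset.card_univ, Fintype.card_fin, nsmul_eq_mul]

end Run

/-! ## The radius -/

/-- The threshold for likelihood ratios. -/
noncomputable def ratioThreshold (H K nF nP : ℕ) (δ : ℝ) : ℝ :=
  2 * ((K + 1) * H * nF * nP * nF) / δ

/-- The threshold is 2/δ times the number of tuples in the larger union bound. With R = KH/δ ≥ 2 it
is at most 4R (nF)² nP ≤ (nF nP R)³, hence the factor 3; and log 2 > 1/2 gives the lower bound that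
lets γ absorb constants. -/
lemma ratioThreshold_bounds {nF nP : ℕ} (hH : 1 ≤ H) (hK : 2 ≤ K) (hF : 1 ≤ nF)
    (hP : 1 ≤ nP) {δ : ℝ} (hδ : 0 < δ) (hδ1 : δ ≤ 1) :
    1 ≤ ratioThreshold H K nF nP δ ∧ Real.log (ratioThreshold H K nF nP δ) ≤
      3 * (Real.log nF + Real.log nP + Real.log (K * H / δ)) ∧
      1 / 2 ≤ Real.log nF + Real.log nP + Real.log (K * H / δ) := by
  have hH' : (1 : ℝ) ≤ H := by exact_mod_cast hH
  have hK' : (2 : ℝ) ≤ K := by exact_mod_cast hK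
  have hF' : (1 : ℝ) ≤ nF := by exact_mod_cast hF
  have hP' : (1 : ℝ) ≤ nP := by exact_mod_cast hP
  set R : ℝ := K * H / δ with hR
  have hR2 : 2 ≤ R := by
    rw [hR, le_div_iff₀ hδ]
    nlinarith
  have hR0 : 0 < R := by linarith
  have hlogR : 1 / 2 ≤ Real.log R := by
    have := Real.log_le_log (by norm_num) hR2
    linarith [Real.log_two_gt_d9]
  have hlF := Real.log_nonneg hF'
  have hlP := Real.log_nonneg hP'
  refine ⟨?_, ?_, by linarith⟩
  · unfold ratioThreshold
    rw [le_div_iff₀ hδ, one_mul]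
    have h1 : (1 : ℝ) ≤ (K + 1) * H * nF * nP * nF :=
      one_le_mul_of_one_le_of_one_le (one_le_mul_of_one_le_of_one_le
        (one_le_mul_of_one_le_of_one_le (one_le_mul_of_one_le_of_one_le (by linarith) hH') hF') hP')
        hF'
    linarith
  · have hle : ratioThreshold H K nF nP δ ≤ (nF * nP * R) ^ 3 := by
      have h1 : 2 * (((K : ℝ) + 1) * H) / δ ≤ R ^ 3 := by
        calc 2 * (((K : ℝ) + 1) * H) / δ ≤ 4 * (K * H) / δ := by
              refine div_le_div_of_nonneg_right ?_ hδ.le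
              nlinarith
          _ = 4 * R := by rw [hR]; ring
          _ ≤ R ^ 3 := by nlinarith [mul_nonneg hR0.le (sub_nonneg.2 hR2)]
      calc ratioThreshold H K nF nP δ
          = (2 * (((K : ℝ) + 1) * H) / δ) * ((nF : ℝ) ^ 2 * (nP : ℝ) ^ 1) := by
            unfold ratioThreshold; ring
        _ ≤ R ^ 3 * ((nF : ℝ) ^ 3 * (nP : ℝ) ^ 3) := by
            gcongr <;> first | assumption | norm_num
        _ = _ := by ring
    have hpos : 0 < ratioThreshold H K nF nP δ := by
      unfold ratioThreshold; positivity
    calc _ ≤ Real.log ((nF * nP * R) ^ 3) := Real.log_le_log hpos hle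
      _ = _ := by
          rw [Real.log_pow, Real.log_mul (by positivity) hR0.ne',
            Real.log_mul (by positivity) (by positivity)]
          push_cast; ring

/-! ### Assembly: probabilities and constants -/

namespace Run

variable [SFinite α] {ρ : Measure ℝ → ℝ} {Ω : Type*} [mΩ : MeasurableSpace Ω] {P : Measure Ω}
  [IsProbabilityMeasure P]

theorem concentration_and_ellipticalPotential (W : WellSpecified M α H K ε F Pol fLast) {δ γ : ℝ}
    (hδ : 0 < δ) (hδ1 : δ ≤ 1)
    (hγdef : γ = Real.log nF + Real.log nP + Real.log (K * H / δ))
    (run : Run M K BF BP ρ (13 * γ) P) :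
    run.Concentration δ ∧ ∀ d : ℕ, M.bellmanEluderDim α H fLast F Pol (1 / K) = d →
      run.EllipticalPotential δ (26 * H * Real.sqrt (max (d : ℝ) 1 * γ * K)) := by
  obtain ⟨ω₀⟩ : Nonempty Ω := nonempty_of_isProbabilityMeasure P
  have hF1 : 1 ≤ nF := Fin.pos (BF.index (run.est 0 ω₀))
  have hP1 : 1 ≤ nP := Fin.pos (BP.index (run.pol 0 ω₀))
  obtain ⟨hT1, hlog, hγ⟩ := ratioThreshold_bounds W.one_le_horizon W.two_le_episodes hF1 hP1 hδ hδ1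
  rw [← hγdef] at hlog hγ
  set T := ratioThreshold H K nF nP δ with hTdef
  have hT : 0 < T := by linarith
  have hT0 := Real.log_nonneg hT1
  -- log T ≤ 3γ and 5 ≤ 10γ: the origin of the constant 13.
  have hβ : Real.log T + 5 ≤ 13 * γ := by linarith
  have hprob : ((K : ℝ) + 1) * H * nF * nP * nF * (1 / T) ≤ δ / 2 := by
    refine le_of_eq ?_
    have h1 : (0 : ℝ) < H := by exact_mod_cast W.one_le_horizon
    have h2 : (0 : ℝ) < nF := by exact_mod_cast hF1
    have h3 : (0 : ℝ) < nP := by exact_mod_cast hP1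
    rw [hTdef, ratioThreshold]
    field_simp
  have hprob' : ((K : ℝ) + 1) * H * nF * nP * (1 / T) ≤ δ / 2 := by
    refine le_trans ?_ hprob
    have h1 : (1 : ℝ) ≤ nF := by exact_mod_cast hF1
    have h2 : (0 : ℝ) ≤ ((K : ℝ) + 1) * H * nF * nP := by positivity
    have h3 : 0 ≤ 1 / T := by positivity
    exact mul_le_mul_of_nonneg_right (le_mul_of_one_le_right h2 h1) h3
  have hP0 := run.measure_degenerateEvent W
  have hPr := (run.measure_ratioEvent W hT).trans (ENNReal.ofReal_le_ofReal hprob)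
  have hPs := (run.measure_sqrtRatioEvent W hT).trans (ENNReal.ofReal_le_ofReal hprob')
  constructor
  · refine (measure_mono (t := run.degenerateEvent fLast ∪ run.ratioEvent fLast T)
      fun ω hω => ?_).trans ?_
    · by_contra hcon
      rw [Set.mem_union, not_or] at hcon
      refine hω fun k hk π => ?_
      obtain ⟨f, hf, hfix⟩ := W.exists_fixedPoint π.2
      exact ⟨⟨f, hf⟩, run.exists_mem_confSet W hT hβ hcon.1 hcon.2 hk π hf hfix,
        fun h hh x a => M.withDensity_eq_returnLaw (W.policy π π.2) (W.density_prod f hf)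
          W.density_last W.last hfix hh x a⟩
    · refine (measure_union_le _ _).trans ?_
      rw [hP0, zero_add]
      exact hPr.trans (ENNReal.ofReal_le_ofReal (by linarith))
  · intro d hd
    refine (measure_mono (t := run.degenerateEvent fLast ∪ (run.ratioEvent fLast T ∪
      run.sqrtRatioEvent fLast T)) fun ω hω => ?_).trans ?_
    · by_contra hcon
      simp only [Set.mem_union, not_or] at hcon
      refine hω ((run.sum_cdfDist_le W hT hT0 hβ hcon.1 hcon.2.1 hcon.2.2 hd).trans ?_)
      have hK' : (2 : ℝ) ≤ K := by exact_mod_cast W.two_le_episodes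
      have hd0 : (0 : ℝ) ≤ d := Nat.cast_nonneg d
      have hm1 : (1 : ℝ) ≤ max (d : ℝ) 1 := le_max_right _ _
      have hmd : (d : ℝ) ≤ max (d : ℝ) 1 := le_max_left _ _
      set D := max (d : ℝ) 1 with hD
      set X := Real.sqrt (D * γ * K) with hX
      have hγ0 : 0 ≤ γ := by linarith
      have hX0 : 0 ≤ X := Real.sqrt_nonneg _
      have hX2 : X ^ 2 = D * γ * K := Real.sq_sqrt (by positivity)
      have hDK : D * K ≤ 2 * (D * γ * K) := by
        have : 0 ≤ D * K := by positivity
        nlinarith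
      have e1 : (1 : ℝ) ≤ 2 * X := by
        refine abs_le_of_sq_le_sq' ?_ (by positivity) |>.2
        nlinarith
      have e2 : Real.sqrt (d * K) ≤ 2 * X := by
        refine Real.sqrt_le_iff.2 ⟨by positivity, ?_⟩
        have : (d : ℝ) * K ≤ D * K := by gcongr
        nlinarith
      -- 12γ + 26γ + 70γ = 108γ ≤ 11²γ. With `e1` and `e2` the total is 2 + 2 + 2 · 11 = 26.
      have e3 : Real.sqrt ((4 * Real.log T + 2 * (13 * γ) + 35) * d * K) ≤ 11 * X := by
        refine Real.sqrt_le_iff.2 ⟨by positivity, ?_⟩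
        calc (4 * Real.log T + 2 * (13 * γ) + 35) * d * K ≤ (121 * γ) * D * K := by
              gcongr
              linarith
          _ = (11 * X) ^ 2 := by rw [mul_pow, hX2]; ring
      calc _ ≤ (H : ℝ) * (2 * X + 2 * X + 2 * (11 * X)) := by gcongr
        _ = _ := by ring
    · refine (measure_union_le _ _).trans ?_
      rw [hP0, zero_add]
      refine (measure_union_le _ _).trans ?_
      refine (add_le_add hPr hPs).trans ?_
      rw [← ENNReal.ofReal_add (by linarith) (by linarith)]
      exact ENNReal.ofReal_le_ofReal (by linarith)

end Run

end RSDisRL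

theorem theorem6 :
    ∃ c C : ℝ, 0 < c ∧ 0 < C ∧
    ∀ (S : Type*) (A : Type*) [MeasurableSpace S] [MeasurableSpace A]
      (M : MDP S A) (α : Measure A) [SigmaFinite α]
      (H K : ℕ) (_ : 1 ≤ H) (_ : 2 ≤ K)
      (δ ε : ℝ) (_ : 0 < δ) (_ : δ ≤ 1) (_ : 0 < ε) (_ : ε ≤ 1 / K)
      -- the return density classes and the policy class
      (F : ℕ → Set (AugState S × A → ℝ → ℝ≥0∞)) (Pol : Set (Policy S A))
      (_ : ∀ h < H, ∀ f ∈ F h, IsCondDensity volume f)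
      (_ : ∀ π ∈ Pol, ∀ h < H, IsCondDensity α (π h))
      -- realizability at the last step
      (fLast : AugState S × A → ℝ → ℝ≥0∞) (_ : fLast ∈ F (H - 1))
      (_ : ∀ s y a, volume.withDensity (fLast ((s, y), a)) = M.reward (H - 1) (s, a))
      -- distributional Bellman completeness
      (_ : ∀ h, h + 1 < H → ∀ g ∈ F (h + 1), ∀ π ∈ Pol, M.bellman α π h g ∈ F h)
      -- minimal bracket covers
      (BF : BracketCover H volume (prodClass H F) ε
        (bracketingNumber H volume (prodClass H F) ε))
      (BP : BracketCover H α Pol ε (bracketingNumber H α Pol ε))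
      (ρ : Measure ℝ → ℝ)
      (Ω : Type*) [MeasurableSpace Ω] (P : Measure Ω) [IsProbabilityMeasure P]
      (run : Run M K BF BP ρ (c * gammaMLE α H K F Pol ε δ) P),
      run.Concentration δ ∧
      ∀ d : ℕ, M.bellmanEluderDim α H fLast F Pol (1 / K) = d →
        run.EllipticalPotential δ
          (C * H * Real.sqrt (max (d : ℝ) 1 * gammaMLE α H K F Pol ε δ * K)) := by
  refine ⟨13, 26, by norm_num, by norm_num, ?_⟩
  intro S A _ _ M α _ H K hH hK δ ε hδ hδ1 hε hεK F Pol hF hPol fLast hlm hl hcomp BF BP ρ Ω _ P _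
    run
  exact run.concentration_and_ellipticalPotential
    ⟨hH, hK, hε, hεK, hF, hPol, hlm, hl, hcomp⟩ hδ hδ1 rfl
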